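/- Let $p$ be a prime, $k$ an algebraically closed field of characteristic $p$, $W(k)$ its ring of Witt vectors and $\sigma$ the Frobenius of $W(k)$. Let $B$ be an unramified field extension of $\mathbb{Q}_p$ of finite degree $r$, with ring of integers $\mathcal{O}_B$. Let $M$ be a free $W(k)$-module of finite rank $h$ with a $\sigma$-linear map $F:M\to M$ that becomes an isomorphism after inverting $p$, and with a faithful action $\iota:\mathcal{O}_B\to \mathrm{End}_{W(k)}(M)$ commuting with $F$. Fix a ring homomorphism $\tau:\mathcal{O}_B\to W(k)$. For $i\in\mathbb{Z}/r\mathbb{Z}$ let $M^{(i)}=\{m\in M \mid \iota(b)m=\sigma^i(\tau(b))m \text{ for all } b\in\mathcal{O}_B\}$, and let $\varphi_i=F^r|_{M^{(i)}}$. (It is standard that $\sigma^r\circ\tau=\tau$, that $M=\bigoplus_i M^{(i)}$ with all $M^{(i)}$ of rank $d=h/r$, that $F$ maps $M^{(i)}$ into $M^{(i+1)}$, and that $\varphi_i$ is a $\sigma^r$-linear endomorphism of $M^{(i)}$.) The relative position of lattices $N\subseteq L$ of the same rank $n$ is the increasing tuple $(a_1,\dots,a_n)\in\mathbb{N}^n$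 such that $L$ has a basis $(e_j)$ for which $(p^{a_j}e_j)$ is a basis of $N$. The Hodge polygon of $(L,\varphi)$ is the relative position of $L$ and $\varphi(L)$. The Newton polygon of $(L,\varphi)$ is the increasing tuple in which a slope $\lambda\in\mathbb{Q}$ occurs as often as the rank of the span of all $v\in L$ with $\varphi^n v=p^s v$ for some integers $n>0$, $s\ge 0$ with $s/n=\lambda$. For increasing tuples of the same length $n$, $x\preceq y$ means $\sum_{j\le l}(x_j-y_j)\ge 0$ for all $l\le n$, with equality for $l=n$. The $r$-reduction of a tuple all of whose entries have multiplicity divisible by $r$ is obtained by replacing each entry $\lambda$ of multiplicity $m$ by $r\lambda$ with multiplicity $m/r$. Let $\nu$ be the Newton polygon of $(M,F)$ and let $\mu^{(i)}$ be the Hodge polygon of $(M^{(i)},\varphi_i)$. Let $m_i$ be the relative position of $M^{(i)}$ and $F(M^{(i-1)})$. Arrange the entries of the Hodge polygon $\mu$ of $(M,F)$ in the blocks $m_i$ $(i\in\mathbb{Z}/r\mathbb{Z})$ and let $\sigma$ act by replacing each block by the following one; let $\overline{\mu}=\frac1r\sum_{s=0}^{r-1}\sigma^s(\mu)$ be the $\sigma$-invariant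 Hodge polygon (its entries sorted increasingly). Let $\nu'$ and $\overline{\mu}'$ be the $r$-reductions of $\nu$ and $\overline{\mu}$. Then for every $i$, the Newton polygon of $(M^{(i)},\varphi_i)$ is $\nu'$, and $$\nu'\preceq\mu^{(i)}\preceq\overline{\mu}'.$$ -/

import Mathlib

set_option linter.unusedSectionVars false

noncomputable section

namespace FCrystals

/-! ## Polygons

A polygon is given by the multiset of its slopes, i.e. by the tuple of the slopes in increasing
order. -/

/-- The ordinate at `l` of the polygon with slopes `s`: the sum of the `l` smallest slopes. -/
def polygonValue (s : Multiset ℚ) (l : ℕ) : ℚ := ((s.sort (· ≤ ·)).take l).sum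

/-- `s ⪯ t`: the polygons have the same length and the same end point, and the polygon of `s` lies
on or above the polygon of `t`, i.e. `∑_{i ≤ l} (s_i - t_i) ≥ 0` for all `l`. -/
def PolygonLE (s t : Multiset ℚ) : Prop :=
  s.card = t.card ∧ (∀ l : ℕ, l ≤ s.card → polygonValue t l ≤ polygonValue s l) ∧ s.sum = t.sum

/-- The `r`-reduction of a polygon all of whose multiplicities are divisible by `r`: a slope `q` of
multiplicity `m` is replaced by the slope `r q` with multiplicity `m / r`. -/
def rReduction (r : ℕ) (s : Multiset ℚ) : Multiset ℚ :=
  ∑ q ∈ s.toFinset, Multiset.replicate (s.count q / r) ((r : ℚ) * q)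

variable (p : ℕ) [hp : Fact p.Prime] {k : Type*} [Field k] [CharP k p] [IsAlgClosed k]
  {M : Type*} [AddCommGroup M] [Module (WittVector p k) M]

/-! ## Hodge polygons -/

/-- The multiset `s = {a_1, …, a_n}` is the relative position of the lattices `N ⊆ L`: there is a
`W(k)`-basis `e_1, …, e_n` of `L` such that `p ^ a_1 e_1, …, p ^ a_n e_n` is a basis of `N`. -/
def HasRelativePosition (L N : Submodule (WittVector p k) M) (s : Multiset ℕ) : Prop :=
  ∃ (n : ℕ) (e : Fin n → M) (a : Fin n → ℕ),
    LinearIndependent (WittVector p k) e ∧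
    Submodule.span (WittVector p k) (Set.range e) = L ∧
    Submodule.span (WittVector p k) (Set.range fun i => (p : WittVector p k) ^ a i • e i) = N ∧
    s = Finset.univ.val.map a

/-- Elementary divisors: the relative position exists if `L / N` is `p`-power torsion. -/
theorem exists_hasRelativePosition [Module.Free (WittVector p k) M]
    [Module.Finite (WittVector p k) M] (L N : Submodule (WittVector p k) M) (hNL : N ≤ L)
    (htors : ∀ m ∈ L, ∃ n : ℕ, (p : WittVector p k) ^ n • m ∈ N) :
    ∃ s, HasRelativePosition p L N s := by
  classical
  obtain ⟨n, o, hno, bO, bN, a, h⟩ := Submodule.exists_smith_normal_form_of_le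
    (Module.Free.chooseBasis (WittVector p k) M) N L hNL
  have hp0 : (p : WittVector p k) ≠ 0 := WittVector.p_nonzero p k
  have hsurj : Function.Surjective (Fin.castLE hno) := by
    intro i
    by_contra hi
    push Not at hi
    obtain ⟨t, ht⟩ := htors (bO i) (bO i).2
    have h1 : ∀ x : N, bO.repr ⟨x, hNL x.2⟩ i = 0 := by
      intro x
      have hx := bN.sum_repr x
      have : (⟨x, hNL x.2⟩ : L) =
          ∑ j, (bN.repr x j * a j) • bO (Fin.castLE hno j) := by
        apply Subtype.ext
        have := congrArg (Subtype.val) hx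
        simp only [Submodule.coe_sum, Submodule.coe_smul, h] at this ⊢
        rw [← this]
        simp [mul_smul]
      rw [this]
      simp [hi]
    have h2 := h1 ⟨_, ht⟩
    have h3 : (⟨(p : WittVector p k) ^ t • (bO i : M), hNL ht⟩ : L) =
        (p : WittVector p k) ^ t • bO i := rfl
    rw [h3] at h2
    simp [hp0] at h2
  have hle : o ≤ n := by
    simpa using Fintype.card_le_of_surjective _ hsurj
  obtain rfl : n = o := le_antisymm hno hle
  have h' : ∀ i, (bN i : M) = a i • (bO i : M) := h
  have ha : ∀ i, a i ≠ 0 := by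
    intro i hi
    have := bN.ne_zero i
    apply this
    apply Subtype.ext
    simp [h', hi]
  choose m u hu using fun i => WittVector.exists_eq_pow_p_mul' (a i) (ha i)
  refine ⟨_, n, fun i => (bO i : M), m, ?_, ?_, ?_, rfl⟩
  · exact bO.linearIndependent.map' L.subtype (Submodule.ker_subtype L)
  · have : Set.range (fun i => (bO i : M)) = L.subtype '' Set.range bO := by
      rw [← Set.range_comp]; rfl
    rw [this, ← Submodule.map_span, bO.span_eq, Submodule.map_top, Submodule.range_subtype]
  · have hN : Submodule.span (WittVector p k) (Set.range fun i => (bN i : M)) = N := by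
      have : Set.range (fun i => (bN i : M)) = N.subtype '' Set.range bN := by
        rw [← Set.range_comp]; rfl
      rw [this, ← Submodule.map_span, bN.span_eq, Submodule.map_top, Submodule.range_subtype]
    have hx : ∀ i, (bN i : M) = (u i : WittVector p k) • ((p : WittVector p k) ^ m i • (bO i : M)) := by
      intro i
      rw [h', hu i, smul_smul, mul_comm]
    refine le_antisymm ?_ ?_
    · rw [Submodule.span_le]
      rintro _ ⟨i, rfl⟩
      have : (p : WittVector p k) ^ m i • (bO i : M) =
          ((u i)⁻¹ : (WittVector p k)ˣ).val • (bN i : M) := by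
        rw [hx, smul_smul, Units.inv_mul, one_smul]
      simp only [SetLike.mem_coe]
      rw [this]
      exact N.smul_mem _ (bN i).2
    · rw [← hN, Submodule.span_le]
      rintro _ ⟨i, rfl⟩
      simp only [SetLike.mem_coe]
      rw [hx]
      exact Submodule.smul_mem _ _ (Submodule.subset_span ⟨i, rfl⟩)

open Classical in
/-- The relative position of the lattices `N ⊆ L` (with the value `0` if there is none). -/
def relativePosition (L N : Submodule (WittVector p k) M) : Multiset ℕ :=
  if h : ∃ s, HasRelativePosition p L N s then h.choose else 0

/-- The submodule `G(L)`. (The image of a submodule under a `σ^a`-linear map is a submodule, as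
`σ` is bijective on `W(k)`.) -/
def imageLattice (L : Submodule (WittVector p k) M) (G : M → M) :
    Submodule (WittVector p k) M :=
  Submodule.span (WittVector p k) (G '' L)

/-- The Hodge polygon of `(L, G)`, where `L` is a lattice stable under the `σ^a`-linear map `G`:
the relative position of `L` and `G(L)`. -/
def hodgePolygon (L : Submodule (WittVector p k) M) (G : M → M) : Multiset ℚ :=
  (relativePosition p L (imageLattice p L G)).map (fun a : ℕ => (a : ℚ))

/-! ## Newton polygons -/

/-- The part of slope `q` of `(L, G)`: the span of all `v ∈ L` such that `G ^ n v = p ^ s v` for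
some `n > 0` and `s` with `s / n = q`. As `k` is algebraically closed, it spans the isoclinic
summand of slope `q` of the isocrystal `(L[1/p], G)`. -/
def slopePart (L : Submodule (WittVector p k) M) (G : M → M) (q : ℚ) :
    Submodule (WittVector p k) M :=
  Submodule.span (WittVector p k)
    {v | v ∈ L ∧ ∃ n s : ℕ, 0 < n ∧ (s : ℚ) / n = q ∧ G^[n] v = (p : WittVector p k) ^ s • v}

/-- The Newton polygon of `(L, G)`: the slope `q` occurs with multiplicity the rank of the part of
slope `q`. Only finitely many of these ranks are nonzero, see `finite_slopes`. -/
def newtonPolygon (L : Submodule (WittVector p k) M) (G : M → M) : Multiset ℚ :=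
  ∑ᶠ q : ℚ, Multiset.replicate (Module.finrank (WittVector p k) (slopePart p L G q)) q

/-! ### Finiteness of the set of slopes -/

section Finite

variable {p}

theorem iterate_semilinear {τ : WittVector p k →+* WittVector p k} (G : M →ₛₗ[τ] M) (n : ℕ)
    (c : WittVector p k) (x y : M) :
    G^[n] (c • x + y) = (τ^[n] c) • G^[n] x + G^[n] y := by
  induction n generalizing c x y with
  | zero => simp
  | succ n ih => simp [Function.iterate_succ_apply, ih]

theorem iterate_sum {τ : WittVector p k →+* WittVector p k} (G : M →ₛₗ[τ] M) (n : ℕ)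
    (S : Finset ℚ) (c : ℚ → WittVector p k) (v : ℚ → M) :
    G^[n] (∑ q ∈ S, c q • v q) = ∑ q ∈ S, (τ^[n] (c q)) • G^[n] (v q) := by
  classical
  induction S using Finset.induction_on with
  | empty => simp
  | insert a S ha ih => rw [Finset.sum_insert ha, Finset.sum_insert ha, iterate_semilinear, ih]

theorem iterate_eigen {τ : WittVector p k →+* WittVector p k} (G : M →ₛₗ[τ] M) {n s : ℕ} {v : M}
    (h : G^[n] v = (p : WittVector p k) ^ s • v) (t : ℕ) :
    G^[n * t] v = (p : WittVector p k) ^ (s * t) • v := by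
  induction t with
  | zero => simp
  | succ t ih =>
    have h1 : ∀ j : ℕ, τ^[j] ((p : WittVector p k) ^ s) = (p : WittVector p k) ^ s := by
      intro j
      induction j with
      | zero => rfl
      | succ j ihj => rw [Function.iterate_succ_apply, map_pow, map_natCast]; exact ihj
    have h2 := iterate_semilinear G (n * t) ((p : WittVector p k) ^ s) v 0
    have h3 : G^[n * t] 0 = 0 := iterate_map_zero G _
    rw [add_zero, h3, add_zero, h1, ih] at h2
    rw [Nat.mul_succ, Function.iterate_add_apply, h, h2, smul_smul, ← pow_add]
    congr 2
    ring

theorem eigen_independent [Module.Free (WittVector p k) M]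
    {τ : WittVector p k →+* WittVector p k} (G : M →ₛₗ[τ] M)
    (S : Finset ℚ) (v : ℚ → M) (hv0 : ∀ q ∈ S, v q ≠ 0)
    (hv : ∀ q ∈ S, ∃ n s : ℕ, 0 < n ∧ (s : ℚ) / n = q ∧
      G^[n] (v q) = (p : WittVector p k) ^ s • v q)
    (c : ℚ → WittVector p k) (hc : ∑ q ∈ S, c q • v q = 0) : ∀ q ∈ S, c q = 0 := by
  classical
  have hp0 : (p : WittVector p k) ≠ 0 := WittVector.p_nonzero p k
  have htors : ∀ (x : WittVector p k) (m : M), x • m = 0 → x = 0 ∨ m = 0 := by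
    intro x m h
    exact smul_eq_zero.mp h
  induction S using Finset.induction_on generalizing c with
  | empty => simp
  | insert a S ha ih =>
    have IH := ih (fun q hq => hv0 q (Finset.mem_insert_of_mem hq))
      (fun q hq => hv q (Finset.mem_insert_of_mem hq))
    rw [Finset.sum_insert ha] at hc
    have key : c a = 0 := by
      by_contra hca
      have hcS : ∀ q ∈ S, c q = 0 := by
        have hcommon : ∃ N : ℕ, 0 < N ∧ ∀ q ∈ insert a S, ∃ s : ℕ, (s : ℚ) / N = q ∧
            G^[N] (v q) = (p : WittVector p k) ^ s • v q := by
          choose! n s hn hs hG using hv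
          refine ⟨∏ q ∈ insert a S, n q, Finset.prod_pos hn, fun q hq => ?_⟩
          obtain ⟨t, ht⟩ := Finset.dvd_prod_of_mem n hq
          have hpos : 0 < ∏ q ∈ insert a S, n q := Finset.prod_pos hn
          rw [ht] at hpos ⊢
          refine ⟨s q * t, ?_, iterate_eigen G (hG q hq) t⟩
          have h1 : (t : ℚ) ≠ 0 := by
            have := Nat.pos_of_mul_pos_left hpos
            positivity
          have h2 := hs q hq
          push_cast
          rw [mul_div_mul_right _ _ h1]
          exact h2
        obtain ⟨N, hN, hs⟩ := hcommon
        choose! s hsq hsG using hs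
        have hG : (τ^[N] (c a) * (p : WittVector p k) ^ s a) • v a +
            ∑ q ∈ S, (τ^[N] (c q) * (p : WittVector p k) ^ s q) • v q = 0 := by
          have h1 : G^[N] (∑ q ∈ insert a S, c q • v q) = 0 := by
            rw [Finset.sum_insert ha, hc]; exact iterate_map_zero G _
          rw [iterate_sum, Finset.sum_insert ha] at h1
          rw [← h1]
          congr 1
          · rw [hsG a (Finset.mem_insert_self _ _), smul_smul]
          · refine Finset.sum_congr rfl fun q hq => ?_
            rw [hsG q (Finset.mem_insert_of_mem hq), smul_smul]
        have hrel := IH (fun q => τ^[N] (c a) * (p : WittVector p k) ^ s a * c q -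
            c a * (τ^[N] (c q) * (p : WittVector p k) ^ s q)) (by
          have e1 := congrArg (fun x => (τ^[N] (c a) * (p : WittVector p k) ^ s a) • x) hc
          have e2 := congrArg (fun x => c a • x) hG
          simp only [smul_add, smul_zero, Finset.smul_sum, smul_smul] at e1 e2
          simp only [sub_smul, Finset.sum_sub_distrib]
          have e3 := congrArg₂ (· - ·) e1 e2
          simp only [sub_zero] at e3
          rw [← e3, mul_comm (c a) (τ^[N] (c a) * (p : WittVector p k) ^ s a)]
          abel)
        intro q hq
        by_contra hcq
        have h0 := hrel q hq
        simp only [sub_eq_zero] at h0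
        have hτN : ∀ x : WittVector p k, emultiplicity (p : WittVector p k) (τ^[N] x) =
            emultiplicity (p : WittVector p k) x ∨ x = 0 := by
          intro x
          by_cases hx : x = 0
          · exact Or.inr hx
          left
          obtain ⟨m, u, rfl⟩ := WittVector.exists_eq_pow_p_mul' x hx
          have hm : ∀ (y : WittVector p k) (j : ℕ), τ^[j] ((p : WittVector p k) ^ m * y) =
              (p : WittVector p k) ^ m * τ^[j] y := by
            intro y j
            induction j generalizing y with
            | zero => rfl
            | succ j ihj =>
              rw [Function.iterate_succ_apply, Function.iterate_succ_apply, ← ihj]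
              simp
          have hu : IsUnit (τ^[N] (u : WittVector p k)) := by
            have : ∀ j : ℕ, IsUnit (τ^[j] (u : WittVector p k)) := by
              intro j
              induction j with
              | zero => exact u.isUnit
              | succ j ihj => rw [Function.iterate_succ_apply']; exact ihj.map τ
            exact this N
          have hP : Prime (p : WittVector p k) := (WittVector.irreducible p).prime
          rw [hm, emultiplicity_mul hP, emultiplicity_mul hP,
            emultiplicity_of_isUnit_right hP.not_isUnit hu,
            emultiplicity_of_isUnit_right hP.not_isUnit u.isUnit]
        have hP : Prime (p : WittVector p k) := (WittVector.irreducible p).prime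
        have h1 := congrArg (emultiplicity (p : WittVector p k)) h0
        have hfin : ∀ x : WittVector p k, x ≠ 0 →
            ∃ m : ℕ, emultiplicity (p : WittVector p k) x = m := by
          intro x hx
          exact ⟨_, (FiniteMultiplicity.of_not_isUnit hP.not_isUnit hx).emultiplicity_eq_multiplicity⟩
        obtain ⟨ma, hma⟩ := hfin _ hca
        obtain ⟨mq, hmq⟩ := hfin _ hcq
        have ha' := (hτN (c a)).resolve_right hca
        have hq' := (hτN (c q)).resolve_right hcq
        simp only [emultiplicity_mul hP, emultiplicity_pow_self_of_prime hP, ha', hq', hma, hmq]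
          at h1
        norm_cast at h1
        have hsa : s a = s q := by omega
        have hqa : a = q := by
          rw [← hsq a (Finset.mem_insert_self _ _), hsa, hsq q (Finset.mem_insert_of_mem hq)]
        exact ha (hqa ▸ hq)
      rw [Finset.sum_eq_zero (fun q hq => by rw [hcS q hq, zero_smul]), add_zero] at hc
      rcases htors _ _ hc with h | h
      · exact hca h
      · exact hv0 a (Finset.mem_insert_self _ _) h
    rw [key, zero_smul, zero_add] at hc
    intro q hq
    rcases Finset.mem_insert.mp hq with rfl | hq
    · exact key
    · exact IH c hc q hq

/-- A semilinear map of a finite free module has only finitely many slopes. -/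
theorem finite_slopes [Module.Free (WittVector p k) M] [Module.Finite (WittVector p k) M]
    {τ : WittVector p k →+* WittVector p k} (G : M →ₛₗ[τ] M)
    (L : Submodule (WittVector p k) M) : {q : ℚ | slopePart p L G q ≠ ⊥}.Finite := by
  classical
  have h : ∀ q : ℚ, slopePart p L G q ≠ ⊥ → ∃ v : M, v ≠ 0 ∧ ∃ n s : ℕ, 0 < n ∧ (s : ℚ) / n = q ∧
      G^[n] v = (p : WittVector p k) ^ s • v := by
    intro q hq
    by_contra hcon
    push Not at hcon
    apply hq
    rw [slopePart, Submodule.span_eq_bot]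
    rintro v ⟨-, n, s, hn, hs, hG⟩
    by_contra hv
    exact hcon v hv n s hn hs hG
  choose! v hv0 hv using h
  have hli : LinearIndependent (WittVector p k)
      (fun q : {q : ℚ | slopePart p L G q ≠ ⊥} => v q) := by
    rw [linearIndependent_iff']
    intro T g hg q hq
    let c : ℚ → WittVector p k := fun x =>
      if hx : slopePart p L G x ≠ ⊥ then g ⟨x, hx⟩ else 0
    have hcg : ∀ x : {q : ℚ | slopePart p L G q ≠ ⊥}, c x = g x := fun x => dif_pos x.2
    have hmem : ∀ x ∈ T.map (Function.Embedding.subtype _), slopePart p L G x ≠ ⊥ := by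
      intro x hx
      obtain ⟨y, -, rfl⟩ := Finset.mem_map.mp hx
      exact y.2
    have hsum : ∑ x ∈ T.map (Function.Embedding.subtype _), c x • v x = 0 := by
      rw [Finset.sum_map, ← hg]
      refine Finset.sum_congr rfl fun x _ => ?_
      rw [← hcg x]
      rfl
    have := eigen_independent G _ v (fun x hx => hv0 x (hmem x hx))
      (fun x hx => hv x (hmem x hx)) c hsum q.1
      (Finset.mem_map.mpr ⟨q, hq, rfl⟩)
    rw [← hcg q]
    exact this
  exact Set.finite_coe_iff.mp hli.finite

end Finite

/-! ## Crystals with `O_B`-action -/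

/-- A `σ`-`F`-crystal of `O`-modules over the algebraically closed field `k` with underlying
`W(k)`-module `M`: a `σ`-linear map `F : M → M` that becomes an isomorphism after inverting `p`,
together with a faithful action of `O` commuting with `F`. Over `k` there is no need to record the
connection. -/
structure FCrystal (k : Type*) [Field k] [CharP k p] [IsAlgClosed k] (O : Type*) [CommRing O]
    (M : Type*) [AddCommGroup M] [Module (WittVector p k) M] where
  /-- the Frobenius -/
  F : M →ₛₗ[(WittVector.frobenius : WittVector p k →+* WittVector p k)] M
  /-- `F` has no kernel after inverting `p` -/
  ker_torsion : ∀ m, F m = 0 → ∃ n : ℕ, (p : WittVector p k) ^ n • m = 0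
  /-- `F` has no cokernel after inverting `p` -/
  coker_torsion : ∀ m, ∃ (n : ℕ) (m' : M), F m' = (p : WittVector p k) ^ n • m
  /-- the action -/
  ι : O →+* Module.End (WittVector p k) M
  faithful : Function.Injective ι
  commute : ∀ b m, F (ι b m) = ι b (F m)

namespace FCrystal

variable {p} {O : Type*} [CommRing O] (X : FCrystal p k O M)

/-- The summand `M^(i)` of `M` on which `O` acts through the character `σ^i ∘ τ`. -/
def isotypic (τ : O →+* WittVector p k) (i : ℕ) : Submodule (WittVector p k) M where
  carrier := {m | ∀ b, X.ι b m = (WittVector.frobenius^[i] (τ b)) • m}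
  add_mem' {x y} hx hy b := by rw [map_add, hx b, hy b, smul_add]
  zero_mem' b := by simp
  smul_mem' c x hx b := by rw [map_smul, hx b, smul_smul, smul_smul, mul_comm]

/-- The Newton polygon `ν` of `(M, F)`. -/
def newton : Multiset ℚ := newtonPolygon p (⊤ : Submodule (WittVector p k) M) X.F

/-- The Newton polygon of `(M^(i), φ_i)`, where `φ_i` is the restriction of `F^r` to `M^(i)`. -/
def newtonIsotypic (τ : O →+* WittVector p k) (r i : ℕ) : Multiset ℚ :=
  newtonPolygon p (X.isotypic τ i) X.F^[r]

/-- The Hodge polygon `μ^(i)` of `(M^(i), φ_i)`, where `φ_i` is the restriction of `F^r` to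
`M^(i)`. -/
def hodgeIsotypic (τ : O →+* WittVector p k) (r i : ℕ) : Multiset ℚ :=
  hodgePolygon p (X.isotypic τ i) X.F^[r]

/-- The Hodge polygon `μ` of `(M, F)`, arranged in blocks indexed by `i`: the block with
index `i + 1` is the increasing tuple `m_{i+1}`, the relative position of `M^(i+1)` and
`F(M^(i))`. The blocks are indexed here by natural numbers; they depend on the index modulo the
degree `r` only. The entry of index `j` of the block of `M^(i+1)` is `X.hodgeBlocks τ i j`
(`j = 0, …, d - 1`). -/
def hodgeBlocks (τ : O →+* WittVector p k) : ℕ → ℕ → ℚ := fun i j =>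
  (((relativePosition p (X.isotypic τ (i + 1)) (imageLattice p (X.isotypic τ i) X.F)).sort
    (· ≤ ·)).getD j 0 : ℕ)

end FCrystal

/-- The action of the Frobenius `σ` on tuples arranged in blocks: every block is replaced by the
following one. -/
def blockShift (x : ℕ → ℕ → ℚ) : ℕ → ℕ → ℚ := fun i j => x (i + 1) j

/-- The average `(1 / r) ∑_{s < r} σ^s(x)`. -/
def blockAverage (r : ℕ) (x : ℕ → ℕ → ℚ) : ℕ → ℕ → ℚ := fun i j =>
  (1 / (r : ℚ)) * ∑ s ∈ Finset.range r, (blockShift^[s] x) i j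

/-- The multiset of entries of a tuple that consists of `r` blocks of length `d`. -/
def blockEntries (r d : ℕ) (x : ℕ → ℕ → ℚ) : Multiset ℚ :=
  (Finset.range r ×ˢ Finset.range d).val.map fun ij => x ij.1 ij.2

namespace FCrystal

variable {p} {O : Type*} [CommRing O] (X : FCrystal p k O M)

/-- The `σ`-invariant Hodge polygon `(1 / r) ∑_{s < r} σ^s(μ)` of `(M, F)`. It has `r` blocks of
length `d = h / r`, where `h` is the rank of `M`. -/
def sigmaInvariantHodge (τ : O →+* WittVector p k) (r : ℕ) : Multiset ℚ :=
  blockEntries r (Module.finrank (WittVector p k) M / r) (blockAverage r (X.hodgeBlocks τ))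

end FCrystal

end FCrystals

end

namespace FCrystals

/-! ## Combinatorics of polygons -/

/-! Both inequalities come from alternating forms. Elementary divisors make a semilinear map G : L →
L' diagonal with entries p^a_j. The l-th ordinate of the Hodge polygon is the minimum of ∑_{j ∈ S}
a_j over sets S of l indices, which is the largest A such that pulling back l-forms along G is
divisible by p^A (`HasSmithForm.formsDivisible`, `HasSmithForm.le_of_formsDivisible`). Such
exponents add up under composition (`FormsDivisible.comp`), and valuations of determinants are
additive (`DetScales.comp`).

Upper bound on the Hodge side: φ_i is the composite of the r maps F : M^(t) → M^(t+1), so the l-th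
ordinate of μ^(i) is at least the sum of the l-th ordinates of the m_t. Averaging makes all blocks
equal to (1/r) ∑ m_t, the r-reduction leaves one copy of ∑ m_t, and a sum of increasing tuples is
increasing; so that sum is the ordinate of the reduced average. Determinants give the end point.

Newton above Hodge is Mazur's argument (`IsEigenbasis.mul_le_sum`). If φ^N v_j = p^s_j v_j, then
φ^(NK) multiplies the value of an l-form on l of the v_j by p^(K ∑ s_j), while the result is
divisible by p^(NKA). As K grows, NA ≤ ∑ s_j follows.

Such eigenvectors span up to p-power torsion by the theorem of Dieudonné and Manin
(`exists_pow_smul_mem_span_eigenvectors`), where k algebraically closed enters. One eigenvector is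
obtained over W(k)[π], π^n = p, by solving an equation whose reduction is an additive polynomial
over k; an extension argument gives the rest. F transports an eigenbasis of M^(0) to every M^(q)
with the same s_j, and all these together form an eigenbasis of (M, F) with slopes s_j/(rN), each r
times: this is the statement on Newton polygons.

The grading itself comes from an element b of O_B whose image in k generates a field with p^r
elements. The σ^i τ(b), i < r, differ by units, so Lagrange interpolation in ι(b) has coefficients
in W(k) and yields the projections onto the M^(i). -/

theorem sum_take_le_of_pairwise {x : ℚ} {l : List ℚ} (h : (x :: l).Pairwise (· ≤ ·)) {n : ℕ}
    (hn : n ≤ l.length) : ((x :: l).take n).sum ≤ (l.take n).sum := by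
  induction n generalizing x l with
  | zero => simp
  | succ n ih =>
    cases l with
    | nil => simp at hn
    | cons y l =>
      rw [List.take_succ_cons, List.take_succ_cons, List.sum_cons, List.sum_cons]
      exact add_le_add (List.rel_of_pairwise_cons h (by simp)) (ih h.of_cons (by simpa using hn))

/-- Where the sublist skips the head of a sorted list, removing that head can only increase the sums
of initial segments. -/
theorem sum_take_le_sum_of_sublist {l t : List ℚ} (hl : l.Pairwise (· ≤ ·)) (ht : t.Sublist l) :
    (l.take t.length).sum ≤ t.sum := by
  induction ht with
  | slnil => simp
  | cons x h ih => exact (sum_take_le_of_pairwise hl h.length_le).trans (ih hl.of_cons)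
  | cons_cons x h ih => simpa using ih hl.of_cons

theorem polygonValue_card (s : Multiset ℚ) : polygonValue s s.card = s.sum := by
  rw [polygonValue, ← Multiset.length_sort (r := (· ≤ ·)), List.take_length, ← Multiset.sum_coe,
    Multiset.sort_eq]

section

variable {ι : Type*} [Fintype ι] (a : ι → ℚ)

/-- With `exists_sum_eq_polygonValue`, this describes the ordinate as a minimum over index sets, so
that no sorting appears in the inequalities. -/
theorem polygonValue_le_sum (S : Finset ι) :
    polygonValue (Finset.univ.val.map a) S.card ≤ ∑ j ∈ S, a j := by
  have h1 : S.val.map a ≤ Finset.univ.val.map a :=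
    Multiset.map_le_map (Finset.val_le_iff.mpr (Finset.subset_univ S))
  rw [← Multiset.sort_eq (Finset.univ.val.map a) (· ≤ ·), ← Multiset.coe_toList (S.val.map a),
    Multiset.coe_le] at h1
  obtain ⟨t, ht, hts⟩ := h1
  have h2 := sum_take_le_sum_of_sublist (Multiset.pairwise_sort _ _) hts
  rw [ht.length_eq, ht.sum_eq, Multiset.length_toList, Multiset.card_map, Multiset.sum_toList] at h2
  exact h2

theorem exists_sum_eq_polygonValue {l : ℕ} (hl : l ≤ Fintype.card ι) :
    ∃ S : Finset ι, S.card = l ∧ ∑ j ∈ S, a j = polygonValue (Finset.univ.val.map a) l := by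
  classical
  have h1 : (((Finset.univ.val.map a).sort (· ≤ ·)).take l).Subperm
      ((Finset.univ : Finset ι).toList.map a) := by
    rw [← Multiset.coe_le]
    calc _ ≤ (((Finset.univ.val.map a).sort (· ≤ ·) : List ℚ) : Multiset ℚ) :=
          Multiset.coe_le.mpr (List.take_sublist _ _).subperm
      _ = _ := by rw [Multiset.sort_eq, ← Multiset.map_coe, Finset.coe_toList]
  obtain ⟨t, ht, hts⟩ := h1
  obtain ⟨u, hu, rfl⟩ := List.sublist_map_iff.mp hts
  have hnd : u.Nodup := hu.nodup (Finset.nodup_toList _)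
  refine ⟨u.toFinset, ?_, ?_⟩
  · rw [List.toFinset_card_of_nodup hnd]
    have := ht.length_eq
    rw [List.length_map, List.length_take, Multiset.length_sort, Multiset.card_map] at this
    rw [this]
    exact min_eq_left hl
  · rw [List.sum_toFinset _ hnd, ht.sum_eq, polygonValue]

end

theorem polygonValue_map_natCast (s : Multiset ℕ) (l : ℕ) (hl : l ≤ s.card) :
    polygonValue (s.map (fun a : ℕ => (a : ℚ))) l =
      ∑ j ∈ Finset.range l, ((s.sort (· ≤ ·)).getD j 0 : ℚ) := by
  have h : (s.map (fun a : ℕ => (a : ℚ))).sort (· ≤ ·) =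
      (s.sort (· ≤ ·)).map (fun a : ℕ => (a : ℚ)) :=
    (Multiset.map_sort (f := fun a : ℕ => (a : ℚ)) (r := (· ≤ ·)) (r' := (· ≤ ·)) s
      (by intros; simp)).symm
  have hl' : l ≤ (s.sort (· ≤ ·)).length := by rwa [Multiset.length_sort]
  rw [polygonValue, h]
  generalize s.sort (· ≤ ·) = L at hl'
  induction l with
  | zero => simp
  | succ l ih =>
    rw [Finset.sum_range_succ, ← ih (by omega) (by omega), List.take_add_one]
    have : l < L.length := hl'
    simp [this]

theorem polygonValue_map_range {d l : ℕ} (c : ℕ → ℚ)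
    (hc : ∀ i j, i ≤ j → j < d → c i ≤ c j) (hl : l ≤ d) :
    polygonValue ((Multiset.range d).map c) l = ∑ j ∈ Finset.range l, c j := by
  have h : ((Multiset.range d).map c).sort (· ≤ ·) = (List.range d).map c := by
    refine List.Perm.eq_of_pairwise' (r := (· ≤ ·)) (Multiset.pairwise_sort _ _) ?_ ?_
    · rw [List.pairwise_map]
      refine (List.pairwise_lt_range).imp_of_mem ?_
      intro i j _ hj hij
      exact hc i j hij.le (List.mem_range.mp hj)
    · rw [← Multiset.coe_eq_coe, Multiset.sort_eq]
      rfl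
  rw [polygonValue, h, ← List.map_take, List.take_range, min_eq_left hl]
  rfl

/-- The division of multiplicities is exact here. Both polygons to be reduced, the Newton polygon of
(M, F) and the averaged Hodge polygon, occur in the form r • t. -/
theorem rReduction_nsmul {r : ℕ} (hr : 0 < r) (t : Multiset ℚ) :
    rReduction r (r • t) = t.map fun q => (r : ℚ) * q := by
  classical
  rw [rReduction, Multiset.toFinset_nsmul _ _ hr.ne']
  conv_rhs => rw [← Multiset.toFinset_sum_count_nsmul_eq t]
  rw [← Multiset.coe_mapAddMonoidHom, map_sum]
  refine Finset.sum_congr rfl fun q _ => ?_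
  rw [Multiset.count_nsmul, Nat.mul_div_cancel_left _ hr, map_nsmul, Multiset.coe_mapAddMonoidHom,
    Multiset.map_singleton, Multiset.nsmul_singleton]

theorem blockEntries_of_forall_eq {r d : ℕ} (x : ℕ → ℕ → ℚ) (c : ℕ → ℚ)
    (h : ∀ i < r, ∀ j < d, x i j = c j) :
    blockEntries r d x = r • (Multiset.range d).map c := by
  have h1 : blockEntries r d x = (Finset.range r ×ˢ Finset.range d).val.map fun ij => c ij.2 := by
    refine Multiset.map_congr rfl fun ij hij => ?_
    have := Finset.mem_product.mp (Finset.mem_val.mp hij)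
    exact h _ (Finset.mem_range.mp this.1) _ (Finset.mem_range.mp this.2)
  rw [h1, Finset.product_val, ← Finset.range_val]
  clear h h1
  induction r with
  | zero => simp
  | succ r ih =>
    rw [Finset.range_val, Multiset.range_succ, Multiset.cons_product, Multiset.map_add,
      ← Finset.range_val, ih, succ_nsmul', Multiset.map_map]
    rfl

theorem blockShift_iterate (s : ℕ) (x : ℕ → ℕ → ℚ) (i j : ℕ) :
    (blockShift^[s] x) i j = x (i + s) j := by
  induction s generalizing x with
  | zero => rfl
  | succ s ih => rw [Function.iterate_succ_apply, ih, blockShift, add_assoc]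

/-- This makes the averaged tuple independent of the block, and allows the r-fold composite to start
in any degree i. -/
theorem sum_range_add_of_periodic {A : Type*} [AddCommMonoid A] {r : ℕ} (f : ℕ → A)
    (hf : ∀ i, f (i + r) = f i) (i : ℕ) :
    ∑ s ∈ Finset.range r, f (i + s) = ∑ s ∈ Finset.range r, f s := by
  induction i with
  | zero => simp
  | succ i ih =>
    rw [← ih]
    cases r with
    | zero => simp
    | succ r =>
      rw [Finset.sum_range_succ, Finset.sum_range_succ' (fun s => f (i + s))]
      congr 1
      · refine Finset.sum_congr rfl fun s _ => ?_
        congr 1; omega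
      · rw [add_zero, ← hf i]
        congr 1; omega

/-! ## Semilinear maps and alternating forms -/

/-- `G` is additive and semilinear with respect to the automorphism `τ`. -/
structure IsSemilinear {R P Q : Type*} [CommRing R] [AddCommGroup P] [Module R P]
    [AddCommGroup Q] [Module R Q] (τ : R ≃+* R) (G : P → Q) : Prop where
  map_add : ∀ x y, G (x + y) = G x + G y
  map_smul : ∀ (c : R) x, G (c • x) = τ c • G x

section Semilinear

variable {R P Q T : Type*} [CommRing R] [AddCommGroup P] [Module R P] [AddCommGroup Q] [Module R Q]
  [AddCommGroup T] [Module R T] {τ τ' : R ≃+* R} {G : P → Q} {H : Q → T}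

namespace IsSemilinear

theorem map_zero (hG : IsSemilinear τ G) : G 0 = 0 := by
  simpa using hG.map_smul 0 0

theorem map_sub (hG : IsSemilinear τ G) (x y : P) : G (x - y) = G x - G y := by
  rw [eq_sub_iff_add_eq, ← hG.map_add, sub_add_cancel]

theorem map_sum (hG : IsSemilinear τ G) {ι : Type*} (S : Finset ι) (x : ι → P) :
    G (∑ j ∈ S, x j) = ∑ j ∈ S, G (x j) :=
  _root_.map_sum (AddMonoidHom.mk' G hG.map_add) x S

theorem map_pow_smul (hG : IsSemilinear τ G) (p n : ℕ) (x : P) :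
    G ((p : R) ^ n • x) = (p : R) ^ n • G x := by
  rw [hG.map_smul, map_pow, map_natCast]

theorem iterate {G : P → P} (hG : IsSemilinear τ G) (n : ℕ) : IsSemilinear (τ ^ n) G^[n] := by
  induction n with
  | zero => exact ⟨fun _ _ => rfl, fun _ _ => rfl⟩
  | succ n ih =>
    refine ⟨fun x y => ?_, fun c x => ?_⟩
    · rw [Function.iterate_succ_apply', Function.iterate_succ_apply', Function.iterate_succ_apply',
        ih.map_add, hG.map_add]
    · rw [Function.iterate_succ_apply', Function.iterate_succ_apply', ih.map_smul, hG.map_smul,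
        pow_succ']
      rfl

theorem iterate_eigen {G : P → P} (hG : IsSemilinear τ G) {p n s : ℕ} {v : P}
    (h : G^[n] v = (p : R) ^ s • v) (t : ℕ) : G^[n * t] v = (p : R) ^ (s * t) • v := by
  induction t with
  | zero => simp
  | succ t ih =>
    rw [Nat.mul_succ, Function.iterate_add_apply, h, (hG.iterate _).map_pow_smul, ih, smul_smul,
      ← pow_add, Nat.mul_succ, add_comm]

/-- The twist `τ⁻¹ ∘ ω ∘ G` of the alternating form `ω`. -/
def twist (hG : IsSemilinear τ G) {l : ℕ} (ω : Q [⋀^Fin l]→ₗ[R] R) : P [⋀^Fin l]→ₗ[R] R where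
  toFun x := τ.symm (ω (G ∘ x))
  map_update_add' := by
    intro _ m i x y
    simp only [Function.comp_update, hG.map_add, ω.map_update_add, _root_.map_add]
  map_update_smul' := by
    intro _ m i c x
    simp only [Function.comp_update, hG.map_smul, ω.map_update_smul, smul_eq_mul, map_mul,
      RingEquiv.symm_apply_apply]
  map_eq_zero_of_eq' x i j hx hij := by
    rw [ω.map_eq_zero_of_eq (G ∘ x) (by simp [hx]) hij, _root_.map_zero]

theorem twist_apply (hG : IsSemilinear τ G) {l : ℕ} (ω : Q [⋀^Fin l]→ₗ[R] R) (x : Fin l → P) :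
    hG.twist ω x = τ.symm (ω (G ∘ x)) := rfl

theorem apply_twist (hG : IsSemilinear τ G) {l : ℕ} (ω : Q [⋀^Fin l]→ₗ[R] R) (x : Fin l → P) :
    τ (hG.twist ω x) = ω (G ∘ x) := by rw [twist_apply, RingEquiv.apply_symm_apply]

end IsSemilinear

/-- An alternating form all of whose values are divisible by `c` is a multiple of `c`. -/
theorem exists_eq_smul_of_forall_dvd [IsDomain R] {l : ℕ} (ω : P [⋀^Fin l]→ₗ[R] R) {c : R}
    (hc : c ≠ 0) (h : ∀ x, c ∣ ω x) : ∃ ω' : P [⋀^Fin l]→ₗ[R] R, ω = c • ω' := by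
  choose g hg using h
  refine ⟨{ toFun := g, map_update_add' := ?_, map_update_smul' := ?_, map_eq_zero_of_eq' := ?_ },
    AlternatingMap.ext hg⟩
  · intro _ m i x y
    apply mul_left_cancel₀ hc
    rw [mul_add, ← hg, ← hg, ← hg, ω.map_update_add]
  · intro _ m i d x
    apply mul_left_cancel₀ hc
    rw [← hg, ω.map_update_smul, hg, smul_eq_mul, smul_eq_mul]
    ring
  · intro x i j hx hij
    apply mul_left_cancel₀ hc
    rw [← hg, ω.map_eq_zero_of_eq x hx hij, mul_zero]

theorem sum_orderEmbOfFin {n l : ℕ} (S : Finset (Fin n)) (hS : S.card = l) (a : Fin n → ℕ) :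
    ∑ i, a (S.orderEmbOfFin hS i) = ∑ j ∈ S, a j := by
  conv_rhs => rw [← Finset.map_orderEmbOfFin_univ S hS, Finset.sum_map]
  rfl

/-- A form which takes a product as its value on multiples of distinct coordinate vectors. -/
theorem exists_form_eq_prod {n l : ℕ} (φ : P →ₗ[R] (Fin n → R)) (g : Fin l → Fin n)
    (hg : Function.Injective g) : ∃ ω : P [⋀^Fin l]→ₗ[R] R, ∀ (x : Fin l → P) (c : Fin l → R),
      (∀ i, φ (x i) = c i • Pi.single (g i) 1) → ω x = ∏ i, c i := by
  refine ⟨Matrix.detRowAlternating.compLinearMap ((LinearMap.funLeft R R g).comp φ),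
    fun x c hx => ?_⟩
  rw [AlternatingMap.compLinearMap_apply]
  have : (fun i => ((LinearMap.funLeft R R g).comp φ) (x i)) = Matrix.diagonal c := by
    funext i j
    rw [LinearMap.comp_apply, hx, LinearMap.funLeft_apply, Pi.smul_apply, Pi.single_apply,
      Matrix.diagonal_apply]
    by_cases hij : i = j
    · simp [hij]
    · rw [if_neg hij, if_neg fun h => hij (hg h).symm, smul_zero]
  rw [this]
  exact Matrix.det_diagonal

end Semilinear

/-! ## Elementary divisors of semilinear maps -/

section Smith

variable {R P Q T : Type*} [CommRing R] [IsDomain R] [AddCommGroup P] [Module R P]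
  [AddCommGroup Q] [Module R Q] [AddCommGroup T] [Module R T] {p : ℕ}
  {τ τ' : R ≃+* R} {G : P → Q} {H : Q → T}

/-- In suitable bases `f` and `e` the map `G` is given by `f_j ↦ p ^ a_j e_j`. -/
def HasSmithForm (R : Type*) [CommRing R] {P Q : Type*} [AddCommGroup P] [Module R P]
    [AddCommGroup Q] [Module R Q] (p : ℕ) (G : P → Q) {n : ℕ} (a : Fin n → ℕ) : Prop :=
  ∃ (f : Module.Basis (Fin n) R P) (e : Module.Basis (Fin n) R Q),
    ∀ j, G (f j) = (p : R) ^ a j • e j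

/-- The map induced by `G` on alternating `l`-forms is divisible by `p ^ A`. -/
def FormsDivisible (R : Type*) [CommRing R] {P Q : Type*} [AddCommGroup P] [Module R P]
    [AddCommGroup Q] [Module R Q] (p l A : ℕ) (G : P → Q) : Prop :=
  ∀ (ω : Q [⋀^Fin l]→ₗ[R] R) (x : Fin l → P), (p : R) ^ A ∣ ω (G ∘ x)

/-- The determinant of `G` has valuation `A`. -/
def DetScales (p n A : ℕ) (τ : R ≃+* R) (G : P → Q) : Prop :=
  ∀ (b : Module.Basis (Fin n) R P) (b' : Module.Basis (Fin n) R Q),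
    ∃ u : Rˣ, ∀ x : Fin n → P, b'.det (G ∘ x) = u * (p : R) ^ A * τ (b.det x)

/-- The twisted pullback is a linear alternating form, so modulo p^A it is determined by its values
on tuples of distinct basis vectors f_j. There multilinearity extracts the factor p^(∑ a_j). -/
theorem HasSmithForm.formsDivisible (hG : IsSemilinear τ G) {n : ℕ} {a : Fin n → ℕ}
    (h : HasSmithForm R p G a) {l A : ℕ}
    (hA : ∀ S : Finset (Fin n), S.card = l → A ≤ ∑ j ∈ S, a j) : FormsDivisible R p l A G := by
  obtain ⟨f, e, hfe⟩ := h
  intro ω x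
  have key : (Submodule.mkQ (Ideal.span {(p : R) ^ A})).compAlternatingMap (hG.twist ω) = 0 := by
    refine Module.Basis.ext_alternating f fun v hv => ?_
    rw [LinearMap.compAlternatingMap_apply, AlternatingMap.zero_apply, Submodule.mkQ_apply,
      Submodule.Quotient.mk_eq_zero, Ideal.mem_span_singleton, hG.twist_apply]
    have h1 : (G ∘ fun i => f (v i)) = fun i => (p : R) ^ a (v i) • e (v i) := by
      funext i
      exact hfe _
    have h2 : A ≤ ∑ i, a (v i) := by
      have := hA (Finset.univ.map ⟨v, hv⟩) (by simp)
      rwa [Finset.sum_map] at this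
    rw [h1, ← AlternatingMap.coe_multilinearMap, MultilinearMap.map_smul_univ,
      Finset.prod_pow_eq_pow_sum, smul_eq_mul, map_mul, map_pow, map_natCast]
    exact (pow_dvd_pow _ h2).mul_right _
  have h3 := congrArg (fun ψ => ψ x) key
  simp only [LinearMap.compAlternatingMap_apply, AlternatingMap.zero_apply, Submodule.mkQ_apply,
    Submodule.Quotient.mk_eq_zero, Ideal.mem_span_singleton] at h3
  have h4 := map_dvd τ h3
  rwa [map_pow, map_natCast, hG.apply_twist] at h4

/-- The pullback of ω along H has all values divisible by p^B, hence equals p^B ω' for a form ω', to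
which the divisibility for G applies. The twists are harmless because ring automorphisms fix p. -/
theorem FormsDivisible.comp (hp : (p : R) ≠ 0) (hH : IsSemilinear τ' H) {l A B : ℕ}
    (hdH : FormsDivisible R p l B H) (hdG : FormsDivisible R p l A G) :
    FormsDivisible R p l (A + B) (H ∘ G) := by
  intro ω x
  obtain ⟨ω', hω'⟩ := exists_eq_smul_of_forall_dvd (hH.twist ω) (pow_ne_zero B hp) fun y => by
    have := map_dvd τ'.symm (hdH ω y)
    rwa [map_pow, map_natCast] at this
  rw [Function.comp_assoc, ← hH.apply_twist, hω', AlternatingMap.smul_apply, smul_eq_mul, map_mul,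
    map_pow, map_natCast, add_comm, pow_add]
  have h := map_dvd τ' (hdG ω' x)
  rw [map_pow, map_natCast] at h
  exact mul_dvd_mul_left _ h

theorem FormsDivisible.iterate (hp : (p : R) ≠ 0) {G : P → P} (hG : IsSemilinear τ G) {l A : ℕ}
    (h : FormsDivisible R p l A G) (n : ℕ) : FormsDivisible R p l (n * A) G^[n] := by
  induction n with
  | zero => intro ω x; simp
  | succ n ih =>
    rw [Function.iterate_succ, Nat.succ_mul, add_comm]
    exact ih.comp hp (hG.iterate n) h

/-- The bound of `HasSmithForm.formsDivisible` is sharp: the coordinate minor indexed by S takes the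
value p^(∑_{j ∈ S} a_j) on the images of the f_j with j in S. -/
theorem HasSmithForm.le_of_formsDivisible (hp : Prime (p : R)) {n : ℕ} {a : Fin n → ℕ}
    (h : HasSmithForm R p G a) {l A : ℕ} (hA : FormsDivisible R p l A G) (S : Finset (Fin n))
    (hS : S.card = l) : A ≤ ∑ j ∈ S, a j := by
  obtain ⟨f, e, hfe⟩ := h
  obtain ⟨ω, hω⟩ := exists_form_eq_prod (e.equivFun : Q →ₗ[R] (Fin n → R)) (S.orderEmbOfFin hS)
    (S.orderEmbOfFin hS).injective
  have h1 := hA ω (fun i => f (S.orderEmbOfFin hS i))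
  rw [hω _ (fun i => (p : R) ^ a (S.orderEmbOfFin hS i)) (fun i => by
    rw [Function.comp_apply, hfe, LinearMap.map_smul]
    congr 1
    funext j
    simp [Pi.single_apply, eq_comm]),
    Finset.prod_pow_eq_pow_sum, pow_dvd_pow_iff hp.ne_zero hp.not_isUnit] at h1
  rwa [sum_orderEmbOfFin] at h1

/-- Top forms are multiples of a determinant, so one evaluation on f suffices; changing bases costs
only units. -/
theorem HasSmithForm.detScales (hG : IsSemilinear τ G) {n : ℕ} {a : Fin n → ℕ}
    (h : HasSmithForm R p G a) : DetScales p n (∑ j, a j) τ G := by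
  obtain ⟨f, e, hfe⟩ := h
  intro b b'
  obtain ⟨u, hu⟩ : IsUnit (f.det b) := f.isUnit_det b
  have hfb : ∀ x, f.det x = u * b.det x := fun x => by
    have := congrArg (fun ψ => ψ x) (f.det.eq_smul_basis_det b)
    rw [hu]
    simpa using this
  obtain ⟨u', hu'⟩ : IsUnit (b'.det e) := b'.isUnit_det e
  have h1 := (hG.twist b'.det).eq_smul_basis_det f
  have h2 : (G ∘ f) = fun i => (p : R) ^ a i • e i := funext hfe
  refine ⟨u' * Units.map τ u, fun x => ?_⟩
  have h3 : b'.det (fun i => (p : R) ^ a i • e i) = (p : R) ^ (∑ j, a j) * u' := by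
    rw [← AlternatingMap.coe_multilinearMap, MultilinearMap.map_smul_univ,
      Finset.prod_pow_eq_pow_sum, hu']
    rfl
  rw [← hG.apply_twist, h1, hG.twist_apply, h2, h3, AlternatingMap.smul_apply, hfb]
  simp only [smul_eq_mul, map_mul, RingEquiv.apply_symm_apply, map_pow, map_natCast, Units.val_mul,
    Units.coe_map, MonoidHom.coe_coe]
  ring

theorem DetScales.comp {n A B : ℕ} (b : Module.Basis (Fin n) R Q) (hdH : DetScales p n B τ' H)
    (hdG : DetScales p n A τ G) : DetScales p n (A + B) (τ.trans τ') (H ∘ G) := by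
  intro b₁ b₂
  obtain ⟨u, hu⟩ := hdH b b₂
  obtain ⟨w, hw⟩ := hdG b₁ b
  refine ⟨u * Units.map τ' w, fun x => ?_⟩
  rw [Function.comp_assoc, hu, hw]
  simp only [map_mul, map_pow, map_natCast, Units.val_mul, Units.coe_map, MonoidHom.coe_coe,
    RingEquiv.trans_apply]
  ring

theorem detScales_id {n : ℕ} : DetScales p n 0 (1 : R ≃+* R) (id : P → P) := by
  intro b₁ b₂
  obtain ⟨u, hu⟩ : IsUnit (b₂.det b₁) := b₂.isUnit_det b₁
  refine ⟨u, fun x => ?_⟩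
  have := congrArg (fun ψ => ψ x) (b₂.det.eq_smul_basis_det b₁)
  rw [hu]
  simpa using this

theorem DetScales.iterate {G : P → P} {n A : ℕ} (b : Module.Basis (Fin n) R P)
    (h : DetScales p n A τ G) (m : ℕ) : DetScales p n (m * A) (τ ^ m) G^[m] := by
  induction m with
  | zero => simpa using detScales_id
  | succ m ih =>
    rw [Function.iterate_succ, Nat.succ_mul, add_comm, pow_succ]
    exact ih.comp b h

theorem DetScales.unique (hp : Prime (p : R)) {n A B : ℕ} {τ τ' : R ≃+* R}
    (b : Module.Basis (Fin n) R P)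
    (b' : Module.Basis (Fin n) R Q) (h : DetScales p n A τ G) (h' : DetScales p n B τ' G) :
    A = B := by
  obtain ⟨u, hu⟩ := h b b'
  obtain ⟨w, hw⟩ := h' b b'
  -- At x = b the determinant is 1, so the two possibly different automorphisms drop out.
  have h1 := (hu b).symm.trans (hw b)
  rw [b.det_self, map_one, map_one, mul_one, mul_one] at h1
  have h2 : Associated ((p : R) ^ A) ((p : R) ^ B) :=
    ((associated_unit_mul_left _ _ u.isUnit).symm.trans (Associated.of_eq h1)).trans
      (associated_unit_mul_left _ _ w.isUnit)
  exact le_antisymm ((pow_dvd_pow_iff hp.ne_zero hp.not_isUnit).mp h2.dvd)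
    ((pow_dvd_pow_iff hp.ne_zero hp.not_isUnit).mp h2.symm.dvd)

theorem emultiplicity_ringEquiv (τ : R ≃+* R) (x : R) :
    emultiplicity (p : R) (τ x) = emultiplicity (p : R) x := by
  refine emultiplicity_eq_emultiplicity_iff.mpr fun n => ?_
  conv_rhs => rw [← map_dvd_iff τ, map_pow, map_natCast]

/-- If `p ^ (K A)` divides `p ^ (K B) x` for all `K` and `x ≠ 0`, then `A ≤ B`. -/
theorem le_of_forall_pow_dvd [WfDvdMonoid R] (hp : Prime (p : R)) {A B : ℕ} {x : R} (hx : x ≠ 0)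
    (h : ∀ K : ℕ, (p : R) ^ (K * A) ∣ (p : R) ^ (K * B) * x) : A ≤ B := by
  by_contra hlt
  obtain ⟨n, hn⟩ := FiniteMultiplicity.of_not_isUnit hp.not_isUnit hx
  apply hn
  have h1 := h (n + 1)
  have h2 : (n + 1) * A = (n + 1) * B + (n + 1) * (A - B) := by
    rw [← mul_add]; congr 1; omega
  rw [h2, pow_add, mul_dvd_mul_iff_left (pow_ne_zero _ hp.ne_zero)] at h1
  exact (pow_dvd_pow _ (Nat.le_mul_of_pos_right _ (by omega))).trans h1

end Smith

/-! ## Eigenbases and Mazur's inequality -/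

section Mazur

variable {R P : Type*} [CommRing R] [IsDomain R] [AddCommGroup P] [Module R P] {p : ℕ}
  {τ : R ≃+* R}

/-- A linearly independent family in `L`, spanning `L` up to `p`-power torsion, of vectors with
`G ^ N v_j = p ^ s_j v_j`. -/
structure IsEigenbasis (p : ℕ) (L : Submodule R P) (G : P → P) (N : ℕ) {ι : Type*} (s : ι → ℕ)
    (v : ι → P) : Prop where
  pos : 0 < N
  mem : ∀ j, v j ∈ L
  eigen : ∀ j, G^[N] (v j) = (p : R) ^ s j • v j
  linearIndependent : LinearIndependent R v
  saturates : ∀ m ∈ L, ∃ c : ℕ, (p : R) ^ c • m ∈ Submodule.span R (Set.range v)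

theorem exists_uniform_pow_smul_mem {L L' : Submodule R P} (hL : L.FG)
    (h : ∀ m ∈ L, ∃ c : ℕ, (p : R) ^ c • m ∈ L') : ∃ c : ℕ, ∀ m ∈ L, (p : R) ^ c • m ∈ L' := by
  obtain ⟨S, hS⟩ := hL
  have h' : ∀ m : P, ∃ c : ℕ, m ∈ L → (p : R) ^ c • m ∈ L' := fun m => by
    by_cases hm : m ∈ L
    · obtain ⟨c, hc⟩ := h m hm
      exact ⟨c, fun _ => hc⟩
    · exact ⟨0, fun h => absurd h hm⟩
  choose c hc using h'
  refine ⟨∑ m ∈ S, c m, fun m hm => ?_⟩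
  have : L ≤ L'.comap (LinearMap.lsmul R P ((p : R) ^ ∑ m ∈ S, c m)) := by
    rw [← hS, Submodule.span_le]
    intro x hx
    change (p : R) ^ _ • x ∈ L'
    obtain ⟨t, ht⟩ := Nat.exists_eq_add_of_le' (Finset.single_le_sum (f := c)
      (fun _ _ => Nat.zero_le _) hx)
    rw [ht, pow_add, mul_smul]
    exact L'.smul_mem _ (hc x (hS ▸ Submodule.subset_span hx))
  exact this hm

theorem pow_smul_mem_of_le {L : Submodule R P} {a b : ℕ} (hab : a ≤ b) {x : P}
    (h : (p : R) ^ a • x ∈ L) : (p : R) ^ b • x ∈ L := by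
  obtain ⟨t, rfl⟩ := Nat.exists_eq_add_of_le' hab
  rw [pow_add, mul_smul]
  exact L.smul_mem _ h

variable [Module.Finite R P] {G : P → P} {n N : ℕ} {s : Fin n → ℕ} {v : Fin n → P}

/-- The v_j need not span P, but p^c P lies in their span for one c, as P is finitely generated. The
map takes x to the coordinates of p^c x. -/
theorem IsEigenbasis.exists_coordinates [Module.IsTorsionFree R P]
    (hv : IsEigenbasis p (⊤ : Submodule R P) G N s v) :
    ∃ (c : ℕ) (φ : P →ₗ[R] (Fin n → R)), ∀ j, φ (v j) = (p : R) ^ c • Pi.single j 1 := by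
  obtain ⟨c, hc⟩ := exists_uniform_pow_smul_mem Module.Finite.fg_top hv.saturates
  let b := Module.Basis.span hv.linearIndependent
  refine ⟨c, b.equivFun.toLinearMap.comp
    ((LinearMap.lsmul R P ((p : R) ^ c)).codRestrict _ fun m => hc m trivial), fun j => ?_⟩
  have h1 : (LinearMap.lsmul R P ((p : R) ^ c)).codRestrict
      (Submodule.span R (Set.range v)) (fun m => hc m trivial) (v j) = (p : R) ^ c • b j := by
    apply Subtype.ext
    simp only [b, Submodule.coe_smul, Module.Basis.span_apply]
    rfl
  rw [LinearMap.comp_apply, h1, LinearMap.map_smul]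
  congr 1
  funext i
  simp [Pi.single_apply, eq_comm]

/-- Mazur's inequality. Under G^(NK) the value of ω on l eigenvectors acquires the factor p^(K ∑
s_j) and is divisible by p^(KNA). The original value is nonzero, so its finite valuation becomes
negligible for large K. -/
theorem IsEigenbasis.mul_le_sum [Module.IsTorsionFree R P] [WfDvdMonoid R] (hp : Prime (p : R))
    (hG : IsSemilinear τ G)
    (hv : IsEigenbasis p (⊤ : Submodule R P) G N s v) {l A : ℕ} (hA : FormsDivisible R p l A G)
    (S : Finset (Fin n)) (hS : S.card = l) : N * A ≤ ∑ j ∈ S, s j := by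
  obtain ⟨c, φ, hφ⟩ := hv.exists_coordinates
  obtain ⟨ω, hω⟩ := exists_form_eq_prod φ (S.orderEmbOfFin hS) (S.orderEmbOfFin hS).injective
  have h1 := hω (fun i => v (S.orderEmbOfFin hS i)) (fun _ => (p : R) ^ c) (fun i => hφ _)
  refine le_of_forall_pow_dvd hp (x := ω fun i => v (S.orderEmbOfFin hS i)) ?_ fun K => ?_
  · rw [h1]
    exact Finset.prod_ne_zero_iff.mpr fun _ _ => pow_ne_zero _ hp.ne_zero
  · have h2 := hA.iterate hp.ne_zero hG (N * K) ω fun i => v (S.orderEmbOfFin hS i)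
    have h3 : (G^[N * K] ∘ fun i => v (S.orderEmbOfFin hS i)) =
        fun i => (p : R) ^ (s (S.orderEmbOfFin hS i) * K) • v (S.orderEmbOfFin hS i) := by
      funext i
      exact hG.iterate_eigen (hv.eigen _) K
    rw [h3, ← AlternatingMap.coe_multilinearMap, MultilinearMap.map_smul_univ,
      Finset.prod_pow_eq_pow_sum, smul_eq_mul, ← Finset.sum_mul,
      sum_orderEmbOfFin] at h2
    rw [mul_comm K (∑ j ∈ S, s j), ← mul_assoc, mul_comm K N]
    exact h2

/-- No limit is needed: the determinant of v is nonzero, and G^N multiplies it by p^(∑ s_j) on the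
one hand, by p^(NA) up to a unit and an automorphism on the other. Automorphisms preserve the
valuation. -/
theorem IsEigenbasis.sum_eq [Module.IsTorsionFree R P] [WfDvdMonoid R] (hp : Prime (p : R))
    (hv : IsEigenbasis p (⊤ : Submodule R P) G N s v) {A : ℕ} (b : Module.Basis (Fin n) R P)
    (hA : DetScales p n A τ G) : ∑ j, s j = N * A := by
  obtain ⟨c, φ, hφ⟩ := hv.exists_coordinates
  obtain ⟨ω, hω⟩ := exists_form_eq_prod φ id Function.injective_id
  have h1 := hω v (fun _ => (p : R) ^ c) (fun i => hφ _)
  have h2 : b.det v ≠ 0 := by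
    intro h
    rw [ω.eq_smul_basis_det b, AlternatingMap.smul_apply, h, smul_zero, Finset.prod_const,
      ← pow_mul] at h1
    exact pow_ne_zero _ hp.ne_zero h1.symm
  obtain ⟨u, hu⟩ := hA.iterate b N b b
  have h3 := hu v
  have h4 : G^[N] ∘ v = fun j => (p : R) ^ s j • v j := funext hv.eigen
  rw [h4, ← AlternatingMap.coe_multilinearMap, MultilinearMap.map_smul_univ,
    Finset.prod_pow_eq_pow_sum, smul_eq_mul, AlternatingMap.coe_multilinearMap] at h3
  have h5 := congrArg (emultiplicity (p : R)) h3
  obtain ⟨m, hm⟩ : ∃ m : ℕ, emultiplicity (p : R) (b.det v) = m :=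
    ⟨_, (FiniteMultiplicity.of_not_isUnit hp.not_isUnit h2).emultiplicity_eq_multiplicity⟩
  rw [emultiplicity_mul hp, emultiplicity_mul hp, emultiplicity_mul hp, emultiplicity_ringEquiv,
    emultiplicity_pow_self_of_prime hp, emultiplicity_pow_self_of_prime hp,
    emultiplicity_of_isUnit_right hp.not_isUnit u.isUnit, hm, zero_add] at h5
  norm_cast at h5
  omega

end Mazur

/-! ## Successive approximation -/

/-- An additive endomorphism of a `p`-adically complete group which is surjective modulo `p` is
surjective. -/
theorem surjective_of_surjective_mod {A : Type*} [AddCommGroup A] (p : ℕ) (T : A →+ A)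
    (hc : ∀ s : ℕ → A, ∃ t, ∀ N, ∃ z, t = ∑ i ∈ Finset.range N, p ^ i • s i + p ^ N • z)
    (hs : ∀ a : A, (∀ N : ℕ, ∃ z, a = p ^ N • z) → a = 0)
    (hT : ∀ u, ∃ t u', T t = u - p • u') : Function.Surjective T := by
  intro u
  choose f g hfg using hT
  -- w n is the remainder after n corrections: u = ∑_{i < n} p^i T(f(w i)) + p^n w n.
  let w : ℕ → A := fun n => g^[n] u
  obtain ⟨t, ht⟩ := hc fun n => f (w n)
  have h : ∀ N, ∑ i ∈ Finset.range N, p ^ i • T (f (w i)) = u - p ^ N • w N := by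
    intro N
    induction N with
    | zero => simp [w]
    | succ N ih =>
      have h1 : w (N + 1) = g (w N) := Function.iterate_succ_apply' g N u
      rw [Finset.sum_range_succ, ih, hfg, h1, smul_sub, smul_smul, ← pow_succ]
      abel
  refine ⟨t, sub_eq_zero.mp (hs _ fun N => ?_)⟩
  obtain ⟨z, hz⟩ := ht N
  refine ⟨T z - w N, ?_⟩
  rw [hz, map_add, map_sum, map_nsmul, smul_sub]
  simp only [map_nsmul]
  rw [h]
  abel

/-! ### Witt vectors: limits, divisibility by p and Frobenius -/

section Witt

variable {p : ℕ} [hp : Fact p.Prime] {k : Type*} [Field k] [CharP k p] [IsAlgClosed k]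

theorem _root_.WittVector.natCast_prime : Prime (p : WittVector p k) :=
  (WittVector.irreducible p).prime

theorem _root_.WittVector.dvd_iff_constantCoeff {x : WittVector p k} :
    (p : WittVector p k) ∣ x ↔ WittVector.constantCoeff x = 0 := by
  rw [← Ideal.mem_span_singleton, WittVector.mem_span_p_iff_coeff_zero_eq_zero]
  rfl

theorem _root_.WittVector.exists_limit (s : ℕ → WittVector p k) : ∃ t, ∀ N, ∃ z,
    t = ∑ i ∈ Finset.range N, p ^ i • s i + p ^ N • z := by
  obtain ⟨t, ht⟩ := IsPrecomplete.prec' (I := Ideal.span {(p : WittVector p k)})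
    (fun N => ∑ i ∈ Finset.range N, p ^ i • s i) (by
      intro m n hmn
      rw [SModEq.comm, SModEq.sub_mem, smul_eq_mul, Ideal.mul_top, Ideal.span_singleton_pow,
        Ideal.mem_span_singleton, ← Finset.sum_range_add_sum_Ico _ hmn, add_sub_cancel_left]
      refine Finset.dvd_sum fun i hi => ?_
      rw [nsmul_eq_mul, Nat.cast_pow]
      exact (pow_dvd_pow _ (Finset.mem_Ico.mp hi).1).mul_right _)
  refine ⟨t, fun N => ?_⟩
  have h := ht N
  rw [SModEq.comm, SModEq.sub_mem, smul_eq_mul, Ideal.mul_top, Ideal.span_singleton_pow,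
    Ideal.mem_span_singleton] at h
  obtain ⟨z, hz⟩ := h
  exact ⟨z, by rw [nsmul_eq_mul, Nat.cast_pow, ← hz]; ring⟩

theorem _root_.WittVector.eq_zero_of_forall_pow_dvd {x : WittVector p k}
    (h : ∀ N : ℕ, (p : WittVector p k) ^ N ∣ x) : x = 0 := by
  by_contra hx
  obtain ⟨n, hn⟩ := FiniteMultiplicity.of_not_isUnit
    (WittVector.natCast_prime (p := p) (k := k)).not_isUnit hx
  exact hn (h _)

theorem _root_.WittVector.eq_zero_of_forall_eq_nsmul (a : WittVector p k)
    (h : ∀ N : ℕ, ∃ z, a = p ^ N • z) : a = 0 := by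
  refine WittVector.eq_zero_of_forall_pow_dvd fun N => ?_
  obtain ⟨z, hz⟩ := h N
  exact ⟨z, by rw [hz, nsmul_eq_mul, Nat.cast_pow]⟩

theorem _root_.WittVector.constantCoeff_frobeniusEquiv_pow (j : ℕ) (x : WittVector p k) :
    WittVector.constantCoeff ((WittVector.frobeniusEquiv p k ^ j) x) =
      WittVector.constantCoeff x ^ p ^ j := by
  induction j generalizing x with
  | zero => simp
  | succ j ih =>
    rw [pow_succ, RingAut.mul_apply, ih, pow_succ, mul_comm, pow_mul]
    congr 1
    exact WittVector.coeff_frobenius_charP p x 0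

/-! ### Additive polynomials -/

open Polynomial in
-- All exponents p^(j+1) vanish in k, so the polynomial has derivative -1. It is therefore not
-- constant, even if every b_j is zero, and has a root.
theorem exists_additive_polynomial_eq (m : ℕ) (b : ℕ → k) (u : k) :
    ∃ x, ∑ j ∈ Finset.range m, b j * x ^ p ^ (j + 1) - x = u := by
  let P : k[X] := ∑ j ∈ Finset.range m, C (b j) * X ^ p ^ (j + 1) - X - C u
  have hd : derivative P = -1 := by
    simp only [P, derivative_sub, derivative_sum, derivative_C_mul, derivative_X_pow,
      derivative_X, derivative_C]
    rw [Finset.sum_eq_zero fun j _ => by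
      rw [pow_succ, Nat.cast_mul, CharP.cast_eq_zero k p]; simp]
    ring
  have hP : P.degree ≠ 0 := by
    intro h
    rw [eq_C_of_degree_eq_zero h, derivative_C] at hd
    exact one_ne_zero (neg_eq_zero.mp hd.symm)
  obtain ⟨x, hx⟩ := IsAlgClosed.exists_root P hP
  refine ⟨x, ?_⟩
  rw [IsRoot.def] at hx
  simp only [P, eval_sub, eval_finsetSum, eval_mul, eval_C, eval_pow, eval_X] at hx
  exact sub_eq_zero.mp hx

open Polynomial in
-- After division by X the polynomial has constant term -1, so its roots are nonzero, and the term
-- of b_{j₀} keeps it from being constant.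
theorem exists_ne_zero_additive_polynomial_eq_zero (m : ℕ) (b : ℕ → k) {j₀ : ℕ} (hj₀ : j₀ < m)
    (hb : b j₀ ≠ 0) :
    ∃ x ≠ 0, ∑ j ∈ Finset.range m, b j * x ^ p ^ (j + 1) - x = 0 := by
  have hp1 : 1 < p := hp.out.one_lt
  let P : k[X] := ∑ j ∈ Finset.range m, C (b j) * X ^ (p ^ (j + 1) - 1) - 1
  have hpos : ∀ j : ℕ, 0 < p ^ (j + 1) - 1 := fun j =>
    Nat.sub_pos_of_lt (Nat.one_lt_pow (Nat.succ_ne_zero j) hp1)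
  have hcoeff : P.coeff (p ^ (j₀ + 1) - 1) = b j₀ := by
    simp only [P, coeff_sub, finsetSum_coeff, coeff_C_mul, coeff_X_pow, coeff_one]
    rw [if_neg (hpos j₀).ne', sub_zero, Finset.sum_eq_single j₀]
    · simp
    · intro j _ hj
      rw [if_neg, mul_zero]
      intro h
      have h1 : p ^ (j₀ + 1) = p ^ (j + 1) := by
        have := hpos j; have := hpos j₀; omega
      have := Nat.pow_right_injective hp1 h1
      omega
    · intro h
      exact absurd (Finset.mem_range.mpr hj₀) h
  have hP : P.degree ≠ 0 := by
    intro h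
    rw [eq_C_of_degree_eq_zero h, coeff_C, if_neg (hpos j₀).ne'] at hcoeff
    exact hb hcoeff.symm
  obtain ⟨x, hx⟩ := IsAlgClosed.exists_root P hP
  rw [IsRoot.def] at hx
  simp only [P, eval_sub, eval_finsetSum, eval_mul, eval_C, eval_pow, eval_X, eval_one] at hx
  refine ⟨x, ?_, ?_⟩
  · rintro rfl
    rw [Finset.sum_eq_zero fun j _ => by rw [zero_pow (hpos j).ne', mul_zero]] at hx
    simp at hx
  · have h2 := congrArg (fun y => y * x) hx
    simp only [sub_mul, Finset.sum_mul, zero_mul, one_mul] at h2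
    rw [← h2]
    congr 1
    refine Finset.sum_congr rfl fun j _ => ?_
    rw [mul_assoc, ← pow_succ, Nat.sub_add_cancel (Nat.one_le_pow _ _ hp.out.pos)]

/-! ### Equations over `W(k)` -/

theorem _root_.WittVector.surjective_of_mod (T : WittVector p k →+ WittVector p k)
    (h : ∀ u, ∃ t, (p : WittVector p k) ∣ u - T t) : Function.Surjective T := by
  refine surjective_of_surjective_mod p T WittVector.exists_limit
    WittVector.eq_zero_of_forall_eq_nsmul fun u => ?_
  obtain ⟨t, u', hu⟩ := h u
  exact ⟨t, u', by rw [nsmul_eq_mul, ← hu]; ring⟩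

/-- Once the smaller power of p is divided out, the operator is modulo p the power map x ↦ x^(p^n),
the Artin–Schreier map x ↦ x^(p^n) - x, or -1. Each is surjective on k, hence the operator is
surjective on W(k). The factor p^(a+b) leaves room for the division. -/
theorem _root_.WittVector.exists_frobenius_sub_eq (n a b : ℕ) (hn : 0 < n) (c : WittVector p k) :
    ∃ x : WittVector p k, (p : WittVector p k) ^ a * (WittVector.frobeniusEquiv p k ^ n) x -
      (p : WittVector p k) ^ b * x = (p : WittVector p k) ^ (a + b) * c := by
  set σ := WittVector.frobeniusEquiv p k ^ n with hσ
  rcases lt_trichotomy a b with hab | rfl | hab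
  · obtain ⟨d, rfl⟩ := Nat.exists_eq_add_of_lt hab
    let T : WittVector p k →+ WittVector p k :=
      σ.toRingHom.toAddMonoidHom - AddMonoidHom.mulLeft ((p : WittVector p k) ^ (d + 1))
    have hT : ∀ x, T x = σ x - (p : WittVector p k) ^ (d + 1) * x := fun x => rfl
    obtain ⟨x, hx⟩ := WittVector.surjective_of_mod T (fun u => ⟨σ.symm u, by
      rw [hT, RingEquiv.apply_symm_apply, sub_sub_cancel, pow_succ', mul_assoc]
      exact dvd_mul_right _ _⟩) ((p : WittVector p k) ^ (a + d + 1) * c)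
    refine ⟨x, ?_⟩
    rw [hT] at hx
    calc _ = (p : WittVector p k) ^ a * (σ x - (p : WittVector p k) ^ (d + 1) * x) := by ring
      _ = _ := by rw [hx]; ring
  · obtain ⟨m, rfl⟩ := Nat.exists_eq_add_of_lt hn
    let T : WittVector p k →+ WittVector p k :=
      σ.toRingHom.toAddMonoidHom - AddMonoidHom.id _
    have hT : ∀ x, T x = σ x - x := fun x => rfl
    obtain ⟨x, hx⟩ := WittVector.surjective_of_mod T (fun u => by
      obtain ⟨y, hy⟩ := exists_additive_polynomial_eq (p := p) (m + 1)
        (fun j => if j = m then 1 else 0) (WittVector.constantCoeff u)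
      obtain ⟨t, rfl⟩ := WittVector.constantCoeff_surjective p y
      refine ⟨t, ?_⟩
      rw [WittVector.dvd_iff_constantCoeff, hT, map_sub, map_sub, hσ,
        WittVector.constantCoeff_frobeniusEquiv_pow, ← hy]
      simp) ((p : WittVector p k) ^ a * c)
    refine ⟨x, ?_⟩
    rw [hT] at hx
    calc _ = (p : WittVector p k) ^ a * (σ x - x) := by ring
      _ = _ := by rw [hx]; ring
  · obtain ⟨d, rfl⟩ := Nat.exists_eq_add_of_lt hab
    let T : WittVector p k →+ WittVector p k :=
      (AddMonoidHom.mulLeft ((p : WittVector p k) ^ (d + 1))).comp σ.toRingHom.toAddMonoidHom -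
        AddMonoidHom.id _
    have hT : ∀ x, T x = (p : WittVector p k) ^ (d + 1) * σ x - x := fun x => rfl
    obtain ⟨x, hx⟩ := WittVector.surjective_of_mod T (fun u => ⟨-u, by
      rw [hT, pow_succ', mul_assoc, map_neg]
      exact ⟨(p : WittVector p k) ^ d * σ u, by ring⟩⟩) ((p : WittVector p k) ^ (b + d + 1) * c)
    refine ⟨x, ?_⟩
    rw [hT] at hx
    calc _ = (p : WittVector p k) ^ b * ((p : WittVector p k) ^ (d + 1) * σ x - x) := by ring
      _ = _ := by rw [hx]; ring

/-- The sequences `a` with `a (j + n) = p a j`: a free module of rank `n` on which the shift is an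
`n`-th root of `p`. -/
def rootModule (p : ℕ) [Fact p.Prime] (k : Type*) [Field k] [CharP k p] (n : ℕ) :
    AddSubgroup (ℕ → WittVector p k) where
  carrier := {a | ∀ j, a (j + n) = p * a j}
  add_mem' {a b} ha hb j := by simp only [Pi.add_apply, ha j, hb j, mul_add]
  zero_mem' j := by simp
  neg_mem' {a} ha j := by simp only [Pi.neg_apply, ha j, mul_neg]

theorem apply_add_mul_of_mem_rootModule {n : ℕ} {a : ℕ → WittVector p k}
    (ha : a ∈ rootModule p k n) (j t : ℕ) :
    a (j + n * t) = (p : WittVector p k) ^ t * a j := by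
  induction t with
  | zero => simp
  | succ t ih => rw [Nat.mul_succ, ← add_assoc, ha, ih, pow_succ']; ring

/-! ### A Frobenius equation over W(k)[π] with π^n = p -/

section RootEquation

variable {n : ℕ} (m : ℕ) (u : ℕ → WittVector p k) (f : ℕ → ℕ)

/-- The operator `∑_j u_j π ^ f_j σ ^ (j + 1) - 1`, where `π` is the shift. -/
noncomputable def rootOperator : (ℕ → WittVector p k) →+ (ℕ → WittVector p k) where
  toFun t l := ∑ j ∈ Finset.range m, u j * (WittVector.frobeniusEquiv p k ^ (j + 1)) (t (l + f j)) -
    t l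
  map_zero' := by
    funext l
    simp
  map_add' t t' := by
    funext l
    simp only [Pi.add_apply, map_add, mul_add, Finset.sum_add_distrib]
    ring

theorem rootOperator_apply (t : ℕ → WittVector p k) (l : ℕ) : rootOperator m u f t l =
    ∑ j ∈ Finset.range m, u j * (WittVector.frobeniusEquiv p k ^ (j + 1)) (t (l + f j)) - t l := rfl

theorem rootOperator_mem {t : ℕ → WittVector p k} (ht : t ∈ rootModule p k n) :
    rootOperator m u f t ∈ rootModule p k n := by
  intro l
  rw [rootOperator_apply, rootOperator_apply, ht, mul_sub, Finset.mul_sum]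
  congr 1
  refine Finset.sum_congr rfl fun j _ => ?_
  rw [add_right_comm, ht, map_mul, map_natCast]
  ring

theorem rootOperator_shift (t : ℕ → WittVector p k) (K : ℕ) :
    rootOperator m u f (fun l => t (l + K)) = fun l => rootOperator m u f t (l + K) := by
  funext l
  simp only [rootOperator_apply]
  congr 1
  refine Finset.sum_congr rfl fun j _ => ?_
  rw [add_right_comm]

/-- Reduction modulo the shift π is the residue of a_{n-1}: dividing by π prepends a term w, and the
defining relation of the module at index 0 demands a_{n-1} = p w. -/
theorem exists_shift_eq (hn : 0 < n) {a : ℕ → WittVector p k} (ha : a ∈ rootModule p k n)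
    (h : WittVector.constantCoeff (a (n - 1)) = 0) :
    ∃ b ∈ rootModule p k n, a = fun l => b (l + 1) := by
  obtain ⟨w, hw⟩ := WittVector.dvd_iff_constantCoeff.mpr h
  refine ⟨fun l => if l = 0 then w else a (l - 1), fun l => ?_, ?_⟩
  · rcases Nat.eq_zero_or_pos l with rfl | hl
    · simp only [zero_add, hn.ne', if_false, if_true, hw]
    · simp only [(Nat.add_pos_left hl n).ne', hl.ne', if_false]
      rw [← ha]
      congr 1; omega
  · funext l
    simp

theorem exists_mem_rootModule (hn : 0 < n) (x : k) :
    ∃ a ∈ rootModule p k n, WittVector.constantCoeff (a (n - 1)) = x := by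
  obtain ⟨y, rfl⟩ := WittVector.constantCoeff_surjective p x
  refine ⟨fun l => (p : WittVector p k) ^ (l / n) * y, fun l => ?_, ?_⟩
  · simp only [Nat.add_div_right _ hn, pow_succ']
    ring
  · simp only [Nat.div_eq_of_lt (Nat.sub_lt hn Nat.one_pos), pow_zero, one_mul]

/-- Terms with f_j > 0 contain a factor π and vanish modulo π; the others form an additive
polynomial. -/
theorem constantCoeff_rootOperator (hn : 0 < n) {t : ℕ → WittVector p k}
    (ht : t ∈ rootModule p k n) :
    WittVector.constantCoeff (rootOperator m u f t (n - 1)) =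
      ∑ j ∈ Finset.range m, (if f j = 0 then WittVector.constantCoeff (u j) else 0) *
        WittVector.constantCoeff (t (n - 1)) ^ p ^ (j + 1) -
        WittVector.constantCoeff (t (n - 1)) := by
  rw [rootOperator_apply, map_sub, map_sum]
  congr 1
  refine Finset.sum_congr rfl fun j _ => ?_
  rw [map_mul, WittVector.constantCoeff_frobeniusEquiv_pow]
  split_ifs with hf
  · rw [hf, add_zero]
  · have h1 : n - 1 + f j = f j - 1 + n := by omega
    have h2 : WittVector.constantCoeff (t (n - 1 + f j)) = 0 := by
      rw [h1, ht, ← WittVector.dvd_iff_constantCoeff]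
      exact dvd_mul_right _ _
    rw [h2, zero_pow (pow_ne_zero _ hp.out.ne_zero), mul_zero, zero_mul]

theorem exists_rootOperator_eq_sub_shift (hn : 0 < n) {a : ℕ → WittVector p k}
    (ha : a ∈ rootModule p k n) : ∃ t ∈ rootModule p k n, ∃ b ∈ rootModule p k n,
      rootOperator m u f t = a - fun l => b (l + 1) := by
  obtain ⟨x, hx⟩ := exists_additive_polynomial_eq (p := p) m
    (fun j => if f j = 0 then WittVector.constantCoeff (u j) else 0)
    (WittVector.constantCoeff (a (n - 1)))
  obtain ⟨t, ht, rfl⟩ := exists_mem_rootModule (p := p) hn x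
  obtain ⟨b, hb, hab⟩ := exists_shift_eq hn
    (AddSubgroup.sub_mem _ ha (rootOperator_mem m u f ht)) (by
      rw [Pi.sub_apply, map_sub, constantCoeff_rootOperator m u f hn ht, hx, sub_self])
  exact ⟨t, ht, b, hb, by rw [← hab]; abel⟩

theorem exists_rootOperator_eq_sub_shift_iterate (hn : 0 < n) {a : ℕ → WittVector p k}
    (ha : a ∈ rootModule p k n) (K : ℕ) : ∃ t ∈ rootModule p k n, ∃ b ∈ rootModule p k n,
      rootOperator m u f t = a - fun l => b (l + K) := by
  induction K with
  | zero => exact ⟨0, zero_mem _, a, ha, by rw [map_zero]; simp⟩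
  | succ K ih =>
    obtain ⟨t, ht, b, hb, hab⟩ := ih
    obtain ⟨t', ht', b', hb', hab'⟩ := exists_rootOperator_eq_sub_shift m u f hn hb
    refine ⟨t + fun l => t' (l + K), add_mem ht fun j => ?_, b', hb', ?_⟩
    · rw [add_right_comm, ht']
    · rw [map_add, hab, rootOperator_shift, hab']
      funext l
      simp only [Pi.add_apply, Pi.sub_apply, add_assoc]
      ring

theorem exists_rootOperator_eq (hn : 0 < n) {a : ℕ → WittVector p k}
    (ha : a ∈ rootModule p k n) : ∃ t ∈ rootModule p k n, rootOperator m u f t = a := by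
  let T : rootModule p k n →+ rootModule p k n :=
    ((rootOperator m u f).comp (rootModule p k n).subtype).codRestrict _
      fun t => rootOperator_mem m u f t.2
  have hp0 : (p : WittVector p k) ≠ 0 := WittVector.p_nonzero p k
  have hT : Function.Surjective T := by
    refine surjective_of_surjective_mod p T (fun s => ?_) (fun b hb => ?_) (fun b => ?_)
    · choose t ht using fun l => WittVector.exists_limit fun i => (s i : ℕ → WittVector p k) l
      choose z hz using ht
      have hz' : ∀ N l, (p : WittVector p k) ^ N * z l N =
          t l - ∑ i ∈ Finset.range N, (p : WittVector p k) ^ i * (s i : ℕ → WittVector p k) l := by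
        intro N l
        have h := hz l N
        simp only [nsmul_eq_mul, Nat.cast_pow] at h
        rw [eq_sub_iff_add_eq', ← h]
      have hs : ∀ N l, ∑ i ∈ Finset.range N,
          (p : WittVector p k) ^ i * (s i : ℕ → WittVector p k) (l + n) = p *
          ∑ i ∈ Finset.range N, (p : WittVector p k) ^ i * (s i : ℕ → WittVector p k) l := by
        intro N l
        rw [Finset.mul_sum]
        refine Finset.sum_congr rfl fun i _ => ?_
        rw [(s i).2 l]
        ring
      have htmem : t ∈ rootModule p k n := by
        intro l
        rw [← sub_eq_zero]
        refine WittVector.eq_zero_of_forall_pow_dvd fun N => ⟨z (l + n) N - p * z l N, ?_⟩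
        rw [mul_sub, hz', hs, mul_left_comm, hz']
        ring
      refine ⟨⟨t, htmem⟩, fun N => ⟨⟨fun l => z l N, fun l => ?_⟩, ?_⟩⟩
      · apply mul_left_cancel₀ (pow_ne_zero N hp0)
        rw [hz', hs, htmem, mul_left_comm, hz']
        ring
      · apply Subtype.ext
        funext l
        simp [hz', Finset.sum_apply]
    · apply Subtype.ext
      funext l
      refine WittVector.eq_zero_of_forall_eq_nsmul _ fun N => ?_
      obtain ⟨z, hz⟩ := hb N
      exact ⟨(z : ℕ → WittVector p k) l, by rw [hz]; simp⟩
    -- Since π^n = p, approximating n times modulo π is one approximation modulo p.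
    · obtain ⟨t, ht, c, hc, h⟩ := exists_rootOperator_eq_sub_shift_iterate m u f hn b.2 n
      refine ⟨⟨t, ht⟩, ⟨c, hc⟩, ?_⟩
      apply Subtype.ext
      change rootOperator m u f t = _
      rw [h]
      funext l
      simp [hc l]
  obtain ⟨t, ht⟩ := hT ⟨a, ha⟩
  exact ⟨t, t.2, congrArg Subtype.val ht⟩

/-- Write T for the operator. A nonzero root of the reduced polynomial lifts to t with T t = π b. If
T t' = b, then t - π t' lies in the kernel and has the same nonzero residue. -/
theorem exists_rootOperator_eq_zero (hn : 0 < n) {j₀ : ℕ} (hj₀ : j₀ < m) (hf : f j₀ = 0)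
    (hu : WittVector.constantCoeff (u j₀) ≠ 0) :
    ∃ t ∈ rootModule p k n, t ≠ 0 ∧ rootOperator m u f t = 0 := by
  obtain ⟨x, hx0, hx⟩ := exists_ne_zero_additive_polynomial_eq_zero (p := p) m
    (fun j => if f j = 0 then WittVector.constantCoeff (u j) else 0) hj₀ (by rwa [if_pos hf])
  obtain ⟨t, ht, rfl⟩ := exists_mem_rootModule (p := p) hn x
  obtain ⟨b, hb, hab⟩ := exists_shift_eq hn (rootOperator_mem m u f ht) (by
      rw [constantCoeff_rootOperator m u f hn ht, hx])
  obtain ⟨t', ht', htb⟩ := exists_rootOperator_eq m u f hn hb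
  refine ⟨t - fun l => t' (l + 1), sub_mem ht fun l => ?_, fun h => hx0 ?_, ?_⟩
  · rw [add_right_comm, ht']
  · have h1 := congrArg (fun a => WittVector.constantCoeff (a (n - 1))) h
    simp only [Pi.sub_apply, map_sub, Pi.zero_apply, map_zero] at h1
    have h2 : n - 1 + 1 = 0 + n := by omega
    rw [h2, ht', WittVector.dvd_iff_constantCoeff.mp (dvd_mul_right _ _), sub_zero] at h1
    exact h1
  · rw [map_sub, rootOperator_shift, htb, hab, sub_self]

end RootEquation

end Witt

/-! ## The theorem of Dieudonné and Manin -/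

section DieudonneManin

variable {p : ℕ} [hp : Fact p.Prime] {k : Type*} [Field k] [CharP k p] [IsAlgClosed k]
  {M : Type*} [AddCommGroup M] [Module (WittVector p k) M]

/-- The smallest slope of the relation `F ^ m x = ∑ a_i F ^ i x`. -/
theorem exists_min_slope {m : ℕ} (e : ℕ → ℕ) (S : Finset ℕ) (hS : S.Nonempty)
    (hSm : ∀ i ∈ S, i < m) : ∃ i₀ ∈ S, ∀ i ∈ S, e i₀ * (m - i) ≤ (m - i₀) * e i := by
  obtain ⟨i₀, hi₀, h⟩ := S.exists_min_image (fun i => (e i : ℚ) / ((m - i : ℕ) : ℚ)) hS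
  refine ⟨i₀, hi₀, fun i hi => ?_⟩
  have h1 := h i hi
  have hpos : ∀ i ∈ S, (0 : ℚ) < ((m - i : ℕ) : ℚ) := fun i hi => by
    have := hSm i hi
    exact_mod_cast Nat.sub_pos_of_lt this
  rw [div_le_div_iff₀ (hpos i₀ hi₀) (hpos i hi)] at h1
  rw [mul_comm (m - i₀)]
  exact_mod_cast h1

/-- With s/n the smallest slope of the relation and π^n = p, the equation F v = π^s v is solved by v
= ∑ c_i F^i x with c_i in W(k)[π]. Comparing coefficients expresses all c_i through c_{m-1} = π^(sm)
t and leaves a single equation for t. In terms of sequences, F v_l = v_{l+s} and v_{l+n} = p v_l, so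
F^n v_l = p^s v_l. -/
theorem exists_eigenvector_of_relation [Module.IsTorsionFree (WittVector p k) M] {F : M → M}
    (hF : IsSemilinear (WittVector.frobeniusEquiv p k) F) (x : M) (m : ℕ)
    (hx : LinearIndependent (WittVector p k) fun i : Fin m => F^[i] x) (a : ℕ → WittVector p k)
    (ha : F^[m] x = ∑ i ∈ Finset.range m, a i • F^[i] x) (ha0 : ∃ i < m, a i ≠ 0) :
    ∃ v ≠ 0, ∃ n s : ℕ, 0 < n ∧ F^[n] v = (p : WittVector p k) ^ s • v := by
  classical
  have hu : ∀ b : WittVector p k, ∃ (e : ℕ) (u : WittVector p k),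
      b = (p : WittVector p k) ^ e * u ∧ (b ≠ 0 → WittVector.constantCoeff u ≠ 0) := by
    intro b
    by_cases hb : b = 0
    · exact ⟨0, 0, by simp [hb], fun h => absurd hb h⟩
    · obtain ⟨e, u, h⟩ := WittVector.exists_eq_pow_p_mul' b hb
      exact ⟨e, u, h, fun _ => (u.isUnit.map WittVector.constantCoeff).ne_zero⟩
  choose e u hau hu using fun i => hu (a i)
  obtain ⟨i₀, hi₀, hmin⟩ := exists_min_slope (m := m) e
    ((Finset.range m).filter fun i => a i ≠ 0) (by
      obtain ⟨i, hi, hi0⟩ := ha0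
      exact ⟨i, Finset.mem_filter.mpr ⟨Finset.mem_range.mpr hi, hi0⟩⟩)
    (fun i hi => Finset.mem_range.mp (Finset.mem_filter.mp hi).1)
  obtain ⟨hi₀m, hi₀0⟩ := Finset.mem_filter.mp hi₀
  rw [Finset.mem_range] at hi₀m
  let n := m - i₀
  let s := e i₀
  have hn : 0 < n := Nat.sub_pos_of_lt hi₀m
  -- Exponent of π left over in the equation for t. For a_i ≠ 0 it is not truncated, by minimality
  -- of the slope s/n, and it is 0 at i₀; for a_i = 0 the factor u_i vanishes.
  let f : ℕ → ℕ := fun i => n * e i - s * (m - i)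
  let σ := WittVector.frobeniusEquiv p k
  obtain ⟨t, ht, ht0, hTt⟩ := exists_rootOperator_eq_zero (n := n) m
    (fun j => (σ ^ j) (u (m - 1 - j))) (fun j => f (m - 1 - j)) hn (j₀ := m - 1 - i₀) (by omega)
    (by
      have : m - 1 - (m - 1 - i₀) = i₀ := by omega
      simp only [this, f, n, s, mul_comm, Nat.sub_self])
    (by
      have : m - 1 - (m - 1 - i₀) = i₀ := by omega
      rw [this, WittVector.constantCoeff_frobeniusEquiv_pow]
      exact pow_ne_zero _ (hu i₀ hi₀0))
  have hsol : ∀ l, t l = ∑ i ∈ Finset.range m, (σ ^ (m - 1 - i)) (u i) *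
      (σ ^ (m - i)) (t (l + f i)) := by
    intro l
    have h := congrFun hTt l
    rw [rootOperator_apply, Pi.zero_apply, sub_eq_zero] at h
    rw [← h, ← Finset.sum_range_reflect]
    refine Finset.sum_congr rfl fun i hi => ?_
    have := Finset.mem_range.mp hi
    rw [show m - 1 - (m - 1 - i) = i by omega, show m - 1 - i + 1 = m - i by omega]
  -- Solution of π^s c_0 = a_0 σ(c_{m-1}) and π^s c_{i+1} = σ(c_i) + a_{i+1} σ(c_{m-1}), the
  -- coefficients of F v = π^s v. The factor π^(sm) in c_{m-1} keeps all exponents of π nonnegative.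
  let c : ℕ → ℕ → WittVector p k := fun i l => ∑ j ∈ Finset.range (i + 1),
    (σ ^ (i - j)) (a j) * (σ ^ (i - j + 1)) (t (l + s * (m - 1 - i + j)))
  have hc_last : ∀ l, c (m - 1) l = t (l + s * m) := by
    intro l
    rw [hsol]
    simp only [c]
    rw [Nat.sub_add_cancel (by omega)]
    refine Finset.sum_congr rfl fun i hi => ?_
    have hi' := Finset.mem_range.mp hi
    rw [show m - 1 - i + 1 = m - i by omega, Nat.sub_self, zero_add]
    by_cases hai : a i = 0
    · have : u i = 0 := by
        have h := hau i
        rw [hai] at h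
        exact (mul_eq_zero.mp h.symm).resolve_left (pow_ne_zero _ (WittVector.p_nonzero p k))
      rw [hai, this, map_zero, zero_mul, zero_mul]
    · have hle := hmin i (Finset.mem_filter.mpr ⟨hi, hai⟩)
      have h1 : l + s * m + f i = l + s * i + n * e i := by
        have h2 : s * m = s * i + s * (m - i) := by rw [← mul_add]; congr 1; omega
        have h3 : s * (m - i) ≤ n * e i := hle
        simp only [f]
        omega
      rw [h1, apply_add_mul_of_mem_rootModule ht, hau i, map_mul, map_mul, map_pow, map_pow,
        map_natCast, map_natCast]
      ring
  have hc_period : ∀ i l, c i (l + n) = p * c i l := by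
    intro i l
    simp only [c, Finset.mul_sum]
    refine Finset.sum_congr rfl fun j _ => ?_
    rw [add_right_comm, ht, map_mul, map_natCast]
    ring
  have hc_zero : ∀ l, 0 < m → c 0 (l + s) = a 0 * σ (c (m - 1) l) := by
    intro l hm
    rw [hc_last]
    simp only [c, zero_add, Finset.sum_range_one, Nat.sub_self, pow_zero, RingAut.one_apply,
      pow_one, Nat.sub_zero, add_zero]
    congr 3
    have : s * m = s + s * (m - 1) := by
      calc s * m = s * (1 + (m - 1)) := by congr 1; omega
        _ = _ := by ring
    omega
  have hc_succ : ∀ l i, i + 1 < m →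
      c (i + 1) (l + s) = σ (c i l) + a (i + 1) * σ (c (m - 1) l) := by
    intro l i hi
    rw [hc_last]
    simp only [c]
    rw [Finset.sum_range_succ, map_sum]
    have hidx : ∀ j, l + s + s * (m - 1 - (i + 1) + j) = l + s * (m - 1 - i + j) := by
      intro j
      have : s * (m - 1 - i + j) = s + s * (m - 1 - (i + 1) + j) := by
        calc s * (m - 1 - i + j) = s * (1 + (m - 1 - (i + 1) + j)) := by congr 1; omega
          _ = _ := by ring
      omega
    congr 1
    · refine Finset.sum_congr rfl fun j hj => ?_
      have := Finset.mem_range.mp hj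
      rw [hidx, map_mul, show i + 1 - j = i - j + 1 by omega, pow_succ' σ (i - j + 1),
        RingAut.mul_apply, pow_succ' σ (i - j), RingAut.mul_apply, RingAut.mul_apply]
    · rw [hidx, Nat.sub_self, pow_zero, RingAut.one_apply, zero_add, pow_one,
        show m - 1 - i + (i + 1) = m by omega]
  have hm : 0 < m := by omega
  let v : ℕ → M := fun l => ∑ i ∈ Finset.range m, c i l • F^[i] x
  have hFv : ∀ l, F (v l) = v (l + s) := by
    intro l
    simp only [v]
    rw [hF.map_sum]
    obtain ⟨m', rfl⟩ := Nat.exists_eq_succ_of_ne_zero hm.ne'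
    rw [Finset.sum_range_succ]
    simp only [hF.map_smul, ← Function.iterate_succ_apply' F]
    have h1 : ∑ i ∈ Finset.range m', c (i + 1) (l + s) • F^[i + 1] x =
        ∑ i ∈ Finset.range m', (σ (c i l) + a (i + 1) * σ (c m' l)) • F^[i + 1] x := by
      refine Finset.sum_congr rfl fun i hi => ?_
      rw [hc_succ l i (Nat.succ_lt_succ (Finset.mem_range.mp hi))]
      rfl
    rw [ha, Finset.sum_range_succ' (fun i => a i • F^[i] x),
      Finset.sum_range_succ' (fun i => c i (l + s) • F^[i] x), hc_zero l hm, h1]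
    simp only [add_smul, Finset.sum_add_distrib, smul_add, Finset.smul_sum, smul_smul,
      Nat.succ_eq_add_one, Nat.add_sub_cancel, σ, mul_comm]
    abel
  have hFvn : ∀ q l, F^[q] (v l) = v (l + s * q) := by
    intro q l
    induction q with
    | zero => simp
    | succ q ih => rw [Function.iterate_succ_apply', ih, hFv, Nat.mul_succ, add_assoc]
  have hvn : ∀ q l, v (l + n * q) = (p : WittVector p k) ^ q • v l := by
    intro q l
    simp only [v, Finset.smul_sum, smul_smul]
    refine Finset.sum_congr rfl fun i _ => ?_
    rw [apply_add_mul_of_mem_rootModule (n := n) (hc_period i)]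
  obtain ⟨l₀, hl₀⟩ := Function.ne_iff.mp ht0
  -- At this index c_{m-1} is t(l₀ + n s m) = p^(sm) t(l₀), which is nonzero.
  refine ⟨v (l₀ + s * m * (n - 1)), fun hv0 => hl₀ ?_, n, s, hn, ?_⟩
  · have h1 := linearIndependent_iff'.mp hx Finset.univ
      (fun i => c i (l₀ + s * m * (n - 1))) (by
        rw [← hv0]
        exact Fin.sum_univ_eq_sum_range (fun i => c i (l₀ + s * m * (n - 1)) • F^[i] x) m)
      ⟨m - 1, by omega⟩ (Finset.mem_univ _)
    simp only [hc_last] at h1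
    rw [add_assoc, ← Nat.mul_succ, Nat.succ_eq_add_one, Nat.sub_add_cancel hn, mul_comm (s * m),
      apply_add_mul_of_mem_rootModule ht] at h1
    exact (mul_eq_zero.mp h1).resolve_left (pow_ne_zero _ (WittVector.p_nonzero p k))
  · rw [hFvn, mul_comm s n, hvn]

theorem eq_zero_of_forall_eq_pow_smul [Module.Free (WittVector p k) M] {v : M}
    (h : ∀ N : ℕ, ∃ w, v = (p : WittVector p k) ^ N • w) : v = 0 := by
  let b := Module.Free.chooseBasis (WittVector p k) M
  refine b.ext_elem fun i => ?_
  rw [map_zero, Finsupp.zero_apply]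
  refine WittVector.eq_zero_of_forall_pow_dvd fun N => ?_
  obtain ⟨w, hw⟩ := h N
  exact ⟨b.repr w i, by rw [hw, map_smul, Finsupp.smul_apply, smul_eq_mul]⟩

/-- The first linear relation among the iterates of a vector x ≠ 0 has leading coefficient p^c times
a unit. For G = p^c F in place of F it becomes monic, and an eigenvector of a power of G is one of
the same power of F. -/
theorem exists_eigenvector [Module.Free (WittVector p k) M] [Module.Finite (WittVector p k) M]
    [Nontrivial M] {F : M → M} (hF : IsSemilinear (WittVector.frobeniusEquiv p k) F)
    (hinj : ∀ x, F x = 0 → x = 0) :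
    ∃ v ≠ 0, ∃ n s : ℕ, 0 < n ∧ F^[n] v = (p : WittVector p k) ^ s • v := by
  classical
  have hp0 : (p : WittVector p k) ≠ 0 := WittVector.p_nonzero p k
  obtain ⟨x, hx⟩ := exists_ne (0 : M)
  have hex : ∃ m : ℕ, ¬ LinearIndependent (WittVector p k) fun i : Fin m => F^[i] x := by
    refine ⟨Module.finrank (WittVector p k) M + 1, fun h => ?_⟩
    have := h.fintype_card_le_finrank
    simp at this
  obtain ⟨m, hm⟩ : ∃ m, Nat.find hex = m + 1 := by
    refine Nat.exists_eq_succ_of_ne_zero fun h => Nat.find_spec hex ?_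
    rw [h]
    exact linearIndependent_empty_type
  have hdep := Nat.find_spec hex
  have hind := not_not.mp (Nat.find_min hex (m := m) (by omega))
  rw [hm] at hdep
  obtain ⟨g, hg, hg0⟩ := Fintype.not_linearIndependent_iff.mp hdep
  rw [Fin.sum_univ_castSucc] at hg
  simp only [Fin.val_castSucc, Fin.val_last] at hg
  have hlast : g (Fin.last m) ≠ 0 := by
    intro h0
    rw [h0, zero_smul, add_zero] at hg
    have := Fintype.linearIndependent_iff.mp hind _ hg
    obtain ⟨i, hi⟩ := hg0
    refine hi ?_
    induction i using Fin.lastCases with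
    | last => exact h0
    | cast i => exact this i
  obtain ⟨c, w, hw⟩ := WittVector.exists_eq_pow_p_mul' _ hlast
  let a : ℕ → WittVector p k := fun i =>
    if h : i < m then -((w⁻¹ : (WittVector p k)ˣ) * g (Fin.castSucc ⟨i, h⟩)) else 0
  have ha : (p : WittVector p k) ^ c • F^[m] x = ∑ i ∈ Finset.range m, a i • F^[i] x := by
    rw [← Fin.sum_univ_eq_sum_range (fun i => a i • F^[i] x)]
    have h1 := congrArg (fun y => (w⁻¹ : (WittVector p k)ˣ).val • y) hg
    simp only [smul_add, smul_zero, Finset.smul_sum, smul_smul, hw] at h1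
    rw [mul_left_comm, Units.inv_mul, mul_one] at h1
    rw [eq_neg_of_add_eq_zero_right h1, ← Finset.sum_neg_distrib]
    refine Finset.sum_congr rfl fun i _ => ?_
    simp [a]
    rfl
  let G : M → M := fun y => (p : WittVector p k) ^ c • F y
  have hG : IsSemilinear (WittVector.frobeniusEquiv p k) G :=
    ⟨fun y z => by simp only [G, hF.map_add, smul_add],
      fun b y => by simp only [G, hF.map_smul, smul_comm ((p : WittVector p k) ^ c)]⟩
  have hGF : ∀ i y, G^[i] y = (p : WittVector p k) ^ (c * i) • F^[i] y := by
    intro i y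
    induction i with
    | zero => simp
    | succ i ih =>
      rw [Function.iterate_succ_apply', ih, Function.iterate_succ_apply']
      simp only [G]
      rw [hF.map_pow_smul, smul_smul, ← pow_add]
      congr 2; ring
  have hinjn : ∀ i y, F^[i] y = 0 → y = 0 := by
    intro i y h
    induction i with
    | zero => exact h
    | succ i ih => exact ih (hinj _ (by rwa [← Function.iterate_succ_apply' F]))
  obtain ⟨v, hv0, n, s, hn, hv⟩ := exists_eigenvector_of_relation hG x m (by
      have h2 : ∀ i : Fin m, G^[i] x = (p : WittVector p k) ^ (c * i) • F^[i] x :=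
        fun i => hGF _ _
      rw [Fintype.linearIndependent_iff] at hind ⊢
      intro g' hg' i
      simp only [h2, smul_smul] at hg'
      exact (mul_eq_zero.mp (hind _ hg' i)).resolve_right (pow_ne_zero _ hp0))
    (fun i => a i * (p : WittVector p k) ^ (c * (m - 1 - i))) (by
      cases m with
      | zero =>
        simp only [Finset.range_zero, Finset.sum_empty, Function.iterate_zero, id] at ha ⊢
        exact (smul_eq_zero.mp ha).resolve_left (pow_ne_zero _ hp0)
      | succ m =>
        rw [hGF, Nat.mul_succ, pow_add, mul_smul, ha, Finset.smul_sum]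
        refine Finset.sum_congr rfl fun i hi => ?_
        have hi' := Finset.mem_range.mp hi
        rw [hGF, smul_smul, smul_smul, mul_assoc, ← pow_add, ← mul_add, mul_comm]
        congr 4
        omega) (by
      by_contra hcon
      push Not at hcon
      refine hx (hinjn m x ?_)
      have h0 : ∑ i ∈ Finset.range m, a i • F^[i] x = 0 := by
        refine Finset.sum_eq_zero fun i hi => ?_
        have := (mul_eq_zero.mp (hcon i (Finset.mem_range.mp hi))).resolve_right
          (pow_ne_zero _ hp0)
        rw [this, zero_smul]
      rw [h0] at ha
      exact (smul_eq_zero.mp ha).resolve_left (pow_ne_zero _ hp0))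
  rw [hGF] at hv
  rcases le_or_gt (c * n) s with h | h
  · obtain ⟨d, rfl⟩ := Nat.exists_eq_add_of_le h
    refine ⟨v, hv0, n, d, hn, ?_⟩
    rw [pow_add, mul_smul] at hv
    exact smul_right_injective M (pow_ne_zero _ hp0) hv
  -- A negative slope would give v = p^(d+1) F^n v, and iterating shows that v is infinitely
  -- divisible by p.
  · exfalso
    obtain ⟨d, hd⟩ := Nat.exists_eq_add_of_lt h
    rw [hd, add_assoc, pow_add, mul_smul] at hv
    have hv1 := smul_right_injective M (pow_ne_zero _ hp0) hv
    refine hv0 (eq_zero_of_forall_eq_pow_smul (p := p) (k := k) fun N => ?_)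
    have hiter : ∀ N : ℕ, (p : WittVector p k) ^ ((d + 1) * N) • F^[n * N] v = v := by
      intro N
      induction N with
      | zero => simp
      | succ N ih =>
        conv_rhs => rw [← ih, ← hv1]
        rw [(hF.iterate _).map_pow_smul, ← Function.iterate_add_apply, smul_smul, ← pow_add]
        rfl
    refine ⟨(p : WittVector p k) ^ (d * N) • F^[n * N] v, ?_⟩
    rw [smul_smul, ← pow_add, add_comm, ← Nat.succ_mul]
    exact (hiter N).symm

end DieudonneManin

/-! ### Spans of eigenvectors and their saturation -/

section DieudonneManin

variable {p : ℕ} [hp : Fact p.Prime] {k : Type*} [Field k] [CharP k p] [IsAlgClosed k]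
  {M : Type*} [AddCommGroup M] [Module (WittVector p k) M]

/-- The vectors `v` with `F ^ N v = p ^ s v` for some `s`. -/
def eigenvectors (p : ℕ) [Fact p.Prime] (k : Type*) [Field k] [CharP k p] {M : Type*}
    [AddCommGroup M] [Module (WittVector p k) M] (F : M → M) (N : ℕ) : Set M :=
  {v | ∃ s : ℕ, F^[N] v = (p : WittVector p k) ^ s • v}

section

variable {τ : WittVector p k ≃+* WittVector p k} {F : M → M}

theorem span_eigenvectors_mono (hF : IsSemilinear τ F) {N N' : ℕ} (h : N ∣ N') :
    Submodule.span (WittVector p k) (eigenvectors p k F N) ≤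
      Submodule.span (WittVector p k) (eigenvectors p k F N') := by
  obtain ⟨t, rfl⟩ := h
  refine Submodule.span_mono ?_
  rintro v ⟨s, hs⟩
  exact ⟨_, hF.iterate_eigen hs t⟩

theorem map_mem_span_eigenvectors (hF : IsSemilinear τ F) {N : ℕ} {x : M}
    (hx : x ∈ Submodule.span (WittVector p k) (eigenvectors p k F N)) :
    F x ∈ Submodule.span (WittVector p k) (eigenvectors p k F N) := by
  induction hx using Submodule.span_induction with
  | mem x hx =>
    obtain ⟨s, hs⟩ := hx
    refine Submodule.subset_span ⟨s, ?_⟩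
    rw [← Function.iterate_succ_apply, Function.iterate_succ_apply', hs, hF.map_pow_smul]
  | zero => rw [hF.map_zero]; exact zero_mem _
  | add x y _ _ hx hy => rw [hF.map_add]; exact add_mem hx hy
  | smul c x _ hx => rw [hF.map_smul]; exact Submodule.smul_mem _ _ hx

theorem iterate_mem_span_eigenvectors (hF : IsSemilinear τ F) {N : ℕ} {x : M}
    (hx : x ∈ Submodule.span (WittVector p k) (eigenvectors p k F N)) (t : ℕ) :
    F^[t] x ∈ Submodule.span (WittVector p k) (eigenvectors p k F N) := by
  induction t with
  | zero => exact hx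
  | succ t ih =>
    rw [Function.iterate_succ_apply']
    exact map_mem_span_eigenvectors hF ih

/-- Up to `p`-power torsion, `F` is surjective on the span of the eigenvectors. -/
theorem exists_map_eq_pow_smul (hF : IsSemilinear τ F) {N : ℕ} (hN : 0 < N) {x : M}
    (hx : x ∈ Submodule.span (WittVector p k) (eigenvectors p k F N)) :
    ∃ e : ℕ, ∃ y ∈ Submodule.span (WittVector p k) (eigenvectors p k F N),
      F y = (p : WittVector p k) ^ e • x := by
  induction hx using Submodule.span_induction with
  | mem x hx =>
    obtain ⟨s, hs⟩ := hx
    refine ⟨s, F^[N - 1] x, iterate_mem_span_eigenvectors hF (Submodule.subset_span ⟨s, hs⟩) _, ?_⟩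
    rw [← Function.iterate_succ_apply' F, Nat.succ_eq_add_one, Nat.sub_add_cancel hN, hs]
  | zero => exact ⟨0, 0, zero_mem _, by rw [hF.map_zero, smul_zero]⟩
  | add x y _ _ hx hy =>
    obtain ⟨e, x', hx', hx⟩ := hx
    obtain ⟨e', y', hy', hy⟩ := hy
    refine ⟨e + e', (p : WittVector p k) ^ e' • x' + (p : WittVector p k) ^ e • y',
      add_mem (Submodule.smul_mem _ _ hx') (Submodule.smul_mem _ _ hy'), ?_⟩
    rw [hF.map_add, hF.map_pow_smul, hF.map_pow_smul, hx, hy, smul_smul, smul_smul, ← pow_add,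
      ← pow_add, add_comm e' e, smul_add]
  | smul c x _ hx =>
    obtain ⟨e, x', hx', hx⟩ := hx
    refine ⟨e, τ.symm c • x', Submodule.smul_mem _ _ hx', ?_⟩
    rw [hF.map_smul, RingEquiv.apply_symm_apply, hx, smul_comm]

end

variable {F : M → M}

/-- Up to `p`-power torsion, `F ^ N - p ^ b` is surjective on the span of the eigenvectors. -/
theorem exists_iterate_sub_eq (hF : IsSemilinear (WittVector.frobeniusEquiv p k) F) {N : ℕ}
    (hN : 0 < N) (b : ℕ) {u : M}
    (hu : u ∈ Submodule.span (WittVector p k) (eigenvectors p k F N)) :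
    ∃ e : ℕ, ∃ x ∈ Submodule.span (WittVector p k) (eigenvectors p k F N),
      F^[N] x - (p : WittVector p k) ^ b • x = (p : WittVector p k) ^ e • u := by
  have hFN := hF.iterate N
  -- The operator does not commute with scalars, so the induction must run over sums of multiples c
  -- v of eigenvectors; each such term is an equation for one Witt vector.
  induction hu using Submodule.closure_induction with
  | zero => exact ⟨0, 0, zero_mem _, by rw [hFN.map_zero, smul_zero, smul_zero, sub_zero]⟩
  | add x y _ _ hx hy =>
    obtain ⟨e, x', hx', hx⟩ := hx
    obtain ⟨e', y', hy', hy⟩ := hy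
    refine ⟨e + e', (p : WittVector p k) ^ e' • x' + (p : WittVector p k) ^ e • y',
      add_mem (Submodule.smul_mem _ _ hx') (Submodule.smul_mem _ _ hy'), ?_⟩
    rw [hFN.map_add, hFN.map_pow_smul, hFN.map_pow_smul, smul_add, add_sub_add_comm,
      smul_comm _ ((p : WittVector p k) ^ e'), smul_comm _ ((p : WittVector p k) ^ e) y',
      ← smul_sub, ← smul_sub, hx, hy, smul_smul, smul_smul, ← pow_add, ← pow_add, add_comm e' e,
      smul_add]
  | smul_mem c v hv =>
    obtain ⟨s, hs⟩ := hv
    obtain ⟨x, hx⟩ := WittVector.exists_frobenius_sub_eq N s b hN c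
    refine ⟨s + b, x • v, Submodule.smul_mem _ _ (Submodule.subset_span ⟨s, hs⟩), ?_⟩
    rw [hFN.map_smul, hs, smul_smul, smul_smul, smul_smul, ← sub_smul, ← hx, mul_comm _ (_ ^ s)]

/-- Induction on F^(n(t+1)) w - p^(s(t+1)) w = F^(nt)(F^n w - p^s w) + p^s (F^(nt) w - p^(st) w). -/
theorem iterate_mul_sub_mem {τ : WittVector p k ≃+* WittVector p k} (hF : IsSemilinear τ F)
    {S : Submodule (WittVector p k) M}
    (hS : ∀ x ∈ S, F x ∈ S) {n s : ℕ} {w : M} (h : F^[n] w - (p : WittVector p k) ^ s • w ∈ S)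
    (t : ℕ) : F^[n * t] w - (p : WittVector p k) ^ (s * t) • w ∈ S := by
  have hSn : ∀ x ∈ S, ∀ q, F^[q] x ∈ S := fun x hx q => by
    induction q with
    | zero => exact hx
    | succ q ih => rw [Function.iterate_succ_apply']; exact hS _ ih
  induction t with
  | zero => simp
  | succ t ih =>
    have h1 := add_mem (hSn _ h (n * t)) (S.smul_mem ((p : WittVector p k) ^ s) ih)
    rw [(hF.iterate _).map_sub, (hF.iterate _).map_pow_smul, ← Function.iterate_add_apply,
      smul_sub, smul_smul, ← pow_add, sub_add_sub_cancel] at h1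
    rw [Nat.mul_succ, Nat.mul_succ, add_comm (s * t)]
    exact h1

/-- The theorem of Dieudonné and Manin: over an algebraically closed field `k`, an `F`-crystal is
spanned up to `p`-power torsion by vectors `v` with `F ^ n v = p ^ s v`. -/
theorem exists_pow_smul_mem_span_eigenvectors [Module.Free (WittVector p k) M]
    [Module.Finite (WittVector p k) M] (hF : IsSemilinear (WittVector.frobeniusEquiv p k) F)
    (hinj : ∀ x, F x = 0 → x = 0) (m : M) : ∃ N : ℕ, 0 < N ∧ ∃ c : ℕ,
      (p : WittVector p k) ^ c • m ∈
        Submodule.span (WittVector p k) (eigenvectors p k F N) := by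
  have hp0 : (p : WittVector p k) ≠ 0 := WittVector.p_nonzero p k
  let V : Submodule (WittVector p k) M :=
    { carrier := {m | ∃ N : ℕ, 0 < N ∧ ∃ c : ℕ, (p : WittVector p k) ^ c • m ∈
        Submodule.span (WittVector p k) (eigenvectors p k F N)}
      zero_mem' := ⟨1, one_pos, 0, by simp⟩
      add_mem' := by
        rintro x y ⟨N, hN, c, hc⟩ ⟨N', hN', c', hc'⟩
        refine ⟨N * N', Nat.mul_pos hN hN', c + c', ?_⟩
        rw [smul_add]
        exact add_mem
          (span_eigenvectors_mono hF (dvd_mul_right _ _)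
            (pow_smul_mem_of_le (Nat.le_add_right _ _) hc))
          (span_eigenvectors_mono hF (dvd_mul_left _ _)
            (pow_smul_mem_of_le (Nat.le_add_left _ _) hc'))
      smul_mem' := by
        rintro a x ⟨N, hN, c, hc⟩
        exact ⟨N, hN, c, by rw [smul_comm]; exact Submodule.smul_mem _ _ hc⟩ }
  have hV : ∀ x, x ∈ V ↔ ∃ N : ℕ, 0 < N ∧ ∃ c : ℕ, (p : WittVector p k) ^ c • x ∈
        Submodule.span (WittVector p k) (eigenvectors p k F N) := fun x => Iff.rfl
  have hsat : ∀ (c : ℕ) x, (p : WittVector p k) ^ c • x ∈ V → x ∈ V := by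
    rintro c x ⟨N, hN, c', hc'⟩
    exact ⟨N, hN, c' + c, by rwa [pow_add, mul_smul]⟩
  have hFV : ∀ x ∈ V, F x ∈ V := by
    rintro x ⟨N, hN, c, hc⟩
    exact ⟨N, hN, c, by rw [← hF.map_pow_smul]; exact map_mem_span_eigenvectors hF hc⟩
  have hFV' : ∀ x, F x ∈ V → x ∈ V := by
    rintro x ⟨N, hN, c, hc⟩
    obtain ⟨e, y, hy, hxy⟩ := exists_map_eq_pow_smul hF hN hc
    refine ⟨N, hN, e + c, ?_⟩
    have : y = (p : WittVector p k) ^ (e + c) • x := by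
      refine sub_eq_zero.mp (hinj _ ?_)
      rw [hF.map_sub, hF.map_pow_smul, hxy, pow_add, mul_smul, sub_self]
    rwa [← this]
  -- V is saturated and stable under F and under preimages by F. If it were proper, M/V would be a
  -- nonzero free module with injective Frobenius, hence would contain an eigenvector; this is
  -- corrected below to an eigenvector in M.
  suffices h : V = ⊤ from (hV m).mp (h ▸ Submodule.mem_top)
  by_contra hne
  have : Nontrivial (M ⧸ V) := Submodule.Quotient.nontrivial_iff.mpr hne
  have : Module.IsTorsionFree (WittVector p k) (M ⧸ V) := by
    refine Module.isTorsionFree_iff_smul_eq_zero.mpr fun r q h => ?_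
    by_contra hcon
    push Not at hcon
    obtain ⟨hr, hq⟩ := hcon
    obtain ⟨x, rfl⟩ := Submodule.Quotient.mk_surjective V q
    obtain ⟨c, u, rfl⟩ := WittVector.exists_eq_pow_p_mul' r hr
    rw [← Submodule.Quotient.mk_smul, Submodule.Quotient.mk_eq_zero, mul_comm, mul_smul] at h
    have h1 := V.smul_mem (u⁻¹ : (WittVector p k)ˣ).val h
    rw [smul_smul, Units.inv_mul, one_smul] at h1
    exact hq ((Submodule.Quotient.mk_eq_zero V).mpr (hsat _ _ h1))
  let Fl : M →ₛₗ[((WittVector.frobeniusEquiv p k : WittVector p k ≃+* WittVector p k) :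
      WittVector p k →+* WittVector p k)] M :=
    { toFun := F, map_add' := hF.map_add, map_smul' := hF.map_smul }
  let Fq := V.mapQ V Fl hFV
  have hFq : ∀ x, Fq (Submodule.Quotient.mk x) = Submodule.Quotient.mk (F x) := fun x => rfl
  have hFqn : ∀ n x, Fq^[n] (Submodule.Quotient.mk x) = Submodule.Quotient.mk (F^[n] x) := by
    intro n x
    induction n with
    | zero => rfl
    | succ n ih => rw [Function.iterate_succ_apply', ih, hFq, Function.iterate_succ_apply']
  obtain ⟨q, hq, n, s, hn, hqs⟩ := exists_eigenvector (F := Fq) ⟨Fq.map_add, Fq.map_smulₛₗ⟩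
    (fun q hq => by
      obtain ⟨x, rfl⟩ := Submodule.Quotient.mk_surjective V q
      rw [hFq, Submodule.Quotient.mk_eq_zero] at hq
      exact (Submodule.Quotient.mk_eq_zero V).mpr (hFV' x hq))
  obtain ⟨w, rfl⟩ := Submodule.Quotient.mk_surjective V q
  rw [hFqn, ← Submodule.Quotient.mk_smul, Submodule.Quotient.eq] at hqs
  obtain ⟨N, hN, c, hc⟩ := hqs
  rw [smul_sub, ← (hF.iterate n).map_pow_smul, smul_comm] at hc
  -- The exponent n N serves both for w and for the eigenvectors that span the error term.
  have h1 := iterate_mul_sub_mem hF (fun x hx => map_mem_span_eigenvectors hF hx) hc N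
  obtain ⟨e, x, hx, hxe⟩ := exists_iterate_sub_eq hF (Nat.mul_pos hn hN) (s * N)
    (span_eigenvectors_mono hF (dvd_mul_left N n) h1)
  refine hq ((Submodule.Quotient.mk_eq_zero V).mpr ?_)
  refine ⟨n * N, Nat.mul_pos hn hN, e + c, ?_⟩
  rw [pow_add, mul_smul]
  set w' := (p : WittVector p k) ^ c • w
  -- x was chosen so that F^(nN) - p^(sN) takes the same value on x and on p^e w'.
  have h2 : (p : WittVector p k) ^ e • w' - x ∈ eigenvectors p k F (n * N) := by
    refine ⟨s * N, ?_⟩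
    rw [(hF.iterate _).map_sub, (hF.iterate _).map_pow_smul, smul_sub,
      smul_comm _ ((p : WittVector p k) ^ e)]
    rw [smul_sub] at hxe
    rw [sub_eq_sub_iff_sub_eq_sub, hxe]
  have h3 := add_mem (Submodule.subset_span (R := WittVector p k) h2) hx
  rwa [sub_add_cancel] at h3

end DieudonneManin

/-! ## The ring of integers of an unramified extension -/

section Integers

variable {p : ℕ} [hp : Fact p.Prime] {k : Type*} [Field k] [CharP k p] [IsAlgClosed k]

theorem exists_natCast_add_pow_mul (z : ℤ_[p]) (N : ℕ) :
    ∃ (n : ℕ) (y : ℤ_[p]), z = n + (p : ℤ_[p]) ^ N * y := by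
  obtain ⟨y, hy⟩ := Ideal.mem_span_singleton.mp (PadicInt.appr_spec N z)
  exact ⟨z.appr N, y, by rw [← hy]; ring⟩

/-- Modulo p^N every p-adic integer is a natural number, and W(k) is p-adically separated. The same
argument gives `end_padicInt_eq`. -/
theorem padicInt_ringHom_ext (f g : ℤ_[p] →+* WittVector p k) : f = g := by
  ext1 z
  rw [← sub_eq_zero]
  refine WittVector.eq_zero_of_forall_pow_dvd fun N => ?_
  obtain ⟨n, y, rfl⟩ := exists_natCast_add_pow_mul z N
  refine ⟨f y - g y, ?_⟩
  simp only [map_add, map_natCast, map_mul, map_pow]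
  ring

theorem end_padicInt_eq {M : Type*} [AddCommGroup M] [Module (WittVector p k) M]
    [Module.Free (WittVector p k) M] (f : ℤ_[p] →+* Module.End (WittVector p k) M)
    (g : ℤ_[p] →+* WittVector p k) : f = (algebraMap _ _ : WittVector p k →+* _).comp g := by
  ext z m
  rw [← sub_eq_zero]
  refine eq_zero_of_forall_eq_pow_smul (p := p) (k := k) fun N => ?_
  obtain ⟨n, y, rfl⟩ := exists_natCast_add_pow_mul z N
  refine ⟨f y m - g y • m, ?_⟩
  have h1 : (f ((n : ℤ_[p]) + (p : ℤ_[p]) ^ N * y)) m =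
      n • m + (p : WittVector p k) ^ N • f y m := by
    rw [map_add, map_natCast, map_mul, map_pow, map_natCast, LinearMap.add_apply,
      Module.End.mul_apply, ← Nat.cast_pow, Module.End.natCast_apply, Module.End.natCast_apply,
      ← Nat.cast_pow, Nat.cast_smul_eq_nsmul]
  rw [h1, RingHom.comp_apply, Module.algebraMap_end_apply, map_add, map_natCast, map_mul, map_pow,
    map_natCast, add_smul, mul_smul, Nat.cast_smul_eq_nsmul, smul_sub]
  abel

theorem padicInt_toWitt_injective (f : ℤ_[p] →+* WittVector p k) : Function.Injective f := by
  rw [injective_iff_map_eq_zero]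
  intro z hz
  by_contra hz0
  rw [PadicInt.unitCoeff_spec hz0, map_mul, map_pow, map_natCast] at hz
  rcases mul_eq_zero.mp hz with h | h
  · exact ((PadicInt.unitCoeff hz0).isUnit.map f).ne_zero h
  · exact pow_ne_zero _ (WittVector.p_nonzero p k) h

variable {B : Type*} [Field B] [Algebra ℚ_[p] B] [FiniteDimensional ℚ_[p] B]
    [Algebra ℤ_[p] B] [IsScalarTower ℤ_[p] ℚ_[p] B]
    (τ : integralClosure ℤ_[p] B →+* WittVector p k)

/-- O_B is a domain integral over ℤ_p, so a nonzero kernel would meet ℤ_p nontrivially. -/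
theorem toWitt_injective : Function.Injective τ := by
  rw [RingHom.injective_iff_ker_eq_bot]
  refine Ideal.eq_bot_of_comap_eq_bot (R := ℤ_[p]) ?_
  rw [RingHom.comap_ker, ← RingHom.injective_iff_ker_eq_bot]
  exact padicInt_toWitt_injective _

/-- The `p`-adic place of `W(k)`. -/
noncomputable def wittPlace (p : ℕ) [Fact p.Prime] (k : Type*) [Field k] [CharP k p]
    [IsAlgClosed k] : IsDedekindDomain.HeightOneSpectrum (WittVector p k) where
  asIdeal := Ideal.span {(p : WittVector p k)}
  isPrime := (Ideal.span_singleton_prime (WittVector.p_nonzero p k)).mpr WittVector.natCast_prime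
  ne_bot := by
    rw [Ne, Ideal.span_singleton_eq_bot]
    exact WittVector.p_nonzero p k

/-- τ extends to an embedding of B into the fraction field of W(k); the p-adic absolute value there,
normalized by |p| = 1/p, is restricted to B. -/
theorem exists_absoluteValue : ∃ f : AbsoluteValue B ℝ,
    (∀ x : ℚ_[p], f (algebraMap ℚ_[p] B x) = ‖x‖) ∧
    ∀ (x : integralClosure ℤ_[p] B) (w : WittVector p k), τ x = p * w →
      f x ≤ (p : ℝ)⁻¹ := by
  have hp1 : (1 : NNReal) < p := by exact_mod_cast hp.out.one_lt
  have : IsFractionRing (integralClosure ℤ_[p] B) B :=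
    integralClosure.isFractionRing_of_finite_extension ℚ_[p] B
  let K := FractionRing (WittVector p k)
  have hinj : Function.Injective ((algebraMap (WittVector p k) K).comp τ) :=
    (IsFractionRing.injective _ K).comp (toWitt_injective τ)
  let φ : B →+* K := IsFractionRing.lift hinj
  have hφ : ∀ x : integralClosure ℤ_[p] B, φ x = algebraMap _ K (τ x) :=
    fun x => IsFractionRing.lift_algebraMap hinj x
  let f : AbsoluteValue B ℝ := ((wittPlace p k).adicAbv (K := K) hp1).comp φ.injective
  have hf : ∀ x : integralClosure ℤ_[p] B, f x = (wittPlace p k).intAdicAbv hp1 (τ x) := by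
    intro x
    rw [← IsDedekindDomain.HeightOneSpectrum.adicAbv_of_algebraMap (K := K), ← hφ]
    rfl
  have hfp : (wittPlace p k).intAdicAbv hp1 (p : WittVector p k) = (p : ℝ)⁻¹ := by
    have h1 := (wittPlace p k).intValuation_singleton (WittVector.p_nonzero p k) rfl
    change ((WithZeroMulInt.toNNReal (ne_zero_of_lt hp1)
      ((wittPlace p k).intValuation (p : WittVector p k)) : NNReal) : ℝ) = _
    rw [h1, WithZeroMulInt.toNNReal_neg_apply _ WithZero.exp_ne_zero]
    change (((p : NNReal) ^ (-1 : ℤ) : NNReal) : ℝ) = _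
    simp
  have hle : ∀ w, (wittPlace p k).intAdicAbv hp1 w ≤ 1 :=
    (wittPlace p k).intAdicAbv_le_one hp1
  have hcoe : ∀ z : ℤ_[p], algebraMap ℚ_[p] B z =
      ((algebraMap ℤ_[p] (integralClosure ℤ_[p] B) z : integralClosure ℤ_[p] B) : B) := by
    intro z
    rw [← PadicInt.algebraMap_apply, ← IsScalarTower.algebraMap_apply]
    rfl
  have hint : ∀ z : ℤ_[p], f (algebraMap ℚ_[p] B z) = ‖z‖ := by
    intro z
    by_cases hz : z = 0
    · simp [hz]
    have hunit : ∀ u : ℤ_[p]ˣ, f (algebraMap ℚ_[p] B (u : ℤ_[p])) = 1 := by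
      intro u
      refine le_antisymm (by rw [hcoe, hf]; exact hle _) ?_
      by_contra hlt
      push Not at hlt
      have h1 : f (algebraMap ℚ_[p] B (u : ℤ_[p])) *
          f (algebraMap ℚ_[p] B ((u⁻¹ : ℤ_[p]ˣ) : ℤ_[p])) = 1 := by
        rw [← map_mul, ← map_mul, ← PadicInt.coe_mul, Units.mul_inv, PadicInt.coe_one, map_one,
          map_one]
      have h2 : f (algebraMap ℚ_[p] B ((u⁻¹ : ℤ_[p]ˣ) : ℤ_[p])) ≤ 1 := by
        rw [hcoe, hf]; exact hle _
      nlinarith [f.nonneg (algebraMap ℚ_[p] B (u : ℤ_[p]))]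
    have hP : f (algebraMap ℚ_[p] B ((p : ℤ_[p]) : ℚ_[p])) = (p : ℝ)⁻¹ := by
      rw [hcoe, hf, map_natCast, map_natCast, hfp]
    conv_lhs => rw [PadicInt.unitCoeff_spec hz]
    rw [PadicInt.coe_mul, PadicInt.coe_pow, map_mul, map_pow, map_mul, map_pow, hunit, hP, one_mul,
      PadicInt.norm_eq_zpow_neg_valuation hz]
    simp
  refine ⟨f, fun x => ?_, fun x w hxw => ?_⟩
  · obtain ⟨a, b, -, rfl⟩ := IsFractionRing.div_surjective (A := ℤ_[p]) x
    rw [map_div₀, map_div₀, PadicInt.algebraMap_apply, PadicInt.algebraMap_apply, hint, hint,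
      norm_div]
    rfl
  · rw [hf, hxw, map_mul, hfp]
    exact mul_le_of_le_one_right (by positivity) (hle w)

/-- The spectral norm bounds the coefficients of the minimal polynomial, so here they lie in ℤ_p. -/
theorem isIntegral_of_spectralNorm_le_one {y : B} (h : spectralNorm ℚ_[p] B y ≤ 1) :
    IsIntegral ℤ_[p] y := by
  have hy : IsIntegral ℚ_[p] y := Algebra.IsIntegral.isIntegral y
  have h1 := (spectralValue_le_one_iff (minpoly.monic hy)).mp h
  have h2 : minpoly ℚ_[p] y ∈ Polynomial.lifts (algebraMap ℤ_[p] ℚ_[p]) := by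
    rw [Polynomial.lifts_iff_coeff_lifts]
    intro n
    exact ⟨⟨_, h1 n⟩, rfl⟩
  obtain ⟨q, hq, -, hqm⟩ := Polynomial.lifts_and_natDegree_eq_and_monic h2 (minpoly.monic hy)
  refine ⟨q, hqm, ?_⟩
  have h3 := minpoly.aeval ℚ_[p] y
  rw [← hq, Polynomial.aeval_map_algebraMap] at h3
  exact h3

/-- An element of `O_B` whose image in `W(k)` is divisible by `p` is divisible by `p`. -/
theorem dvd_of_dvd_toWitt {x : integralClosure ℤ_[p] B} (h : (p : WittVector p k) ∣ τ x) :
    (p : integralClosure ℤ_[p] B) ∣ x := by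
  obtain ⟨w, hw⟩ := h
  obtain ⟨f, hf, hfx⟩ := exists_absoluteValue τ
  have hp0 : (p : B) ≠ 0 := by
    have : CharZero B := charZero_of_injective_algebraMap (algebraMap ℚ_[p] B).injective
    exact_mod_cast hp.out.ne_zero
  have hfp : f (p : B) = (p : ℝ)⁻¹ := by
    have := hf (p : ℚ_[p])
    rw [map_natCast, Padic.norm_p] at this
    exact this
  have hy : f ((x : B) / p) ≤ 1 := by
    rw [map_div₀, hfp]
    exact (div_le_one (by have := hp.out.pos; positivity)).mpr (hfx x w hw)
  -- The absolute value of ℚ_p extends uniquely to B, so f is the spectral norm and the bound makes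
  -- x/p integral.
  rw [spectralNorm_unique_field_norm_ext hf] at hy
  refine ⟨⟨(x : B) / p, isIntegral_of_spectralNorm_le_one hy⟩, Subtype.ext ?_⟩
  change (x : B) = p * (x / p)
  field_simp

end Integers

/-! ### A generator of the residue field and its conjugates -/

section Generator

variable {p : ℕ} [hp : Fact p.Prime] {k : Type*} [Field k] [CharP k p] [IsAlgClosed k]
  {B : Type*} [Field B] [Algebra ℚ_[p] B] [FiniteDimensional ℚ_[p] B]
    [Algebra ℤ_[p] B] [IsScalarTower ℤ_[p] ℚ_[p] B]
    (τ : integralClosure ℤ_[p] B →+* WittVector p k)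

theorem isTorsionFree_padicInt (p : ℕ) [Fact p.Prime] (B : Type*) [Field B] [Algebra ℚ_[p] B]
    [Algebra ℤ_[p] B] [IsScalarTower ℤ_[p] ℚ_[p] B] : Module.IsTorsionFree ℤ_[p] B := by
  rw [Module.isTorsionFree_iff_algebraMap_injective, IsScalarTower.algebraMap_eq ℤ_[p] ℚ_[p] B]
  exact (algebraMap ℚ_[p] B).injective.comp (IsFractionRing.injective ℤ_[p] ℚ_[p])

/-- The residue field of `O_B` has `p ^ r` elements. -/
theorem card_residue_range :
    Nat.card (WittVector.constantCoeff.comp τ).range = p ^ Module.finrank ℚ_[p] B := by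
  have := isTorsionFree_padicInt p B
  have hfree : Module.Free ℤ_[p] (integralClosure ℤ_[p] B) :=
    IsIntegralClosure.module_free ℤ_[p] ℚ_[p] B _
  have hnoeth : IsNoetherian ℤ_[p] (integralClosure ℤ_[p] B) :=
    IsIntegralClosure.isNoetherian ℤ_[p] ℚ_[p] B _
  have hrank : Module.finrank ℤ_[p] (integralClosure ℤ_[p] B) = Module.finrank ℚ_[p] B :=
    IsIntegralClosure.rank ℤ_[p] ℚ_[p] B _
  let b := Module.finBasisOfFinrankEq ℤ_[p] (integralClosure ℤ_[p] B) hrank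
  -- Coordinates modulo p identify O_B / p with 𝔽_p^r. The residue of τ has the same fibres as Φ,
  -- since τ(x) is divisible by p exactly when x is; so its image has p^r elements.
  let Φ : integralClosure ℤ_[p] B → (Fin (Module.finrank ℚ_[p] B) → ZMod p) :=
    fun x i => PadicInt.toZMod (b.repr x i)
  have hΦ : Function.Surjective Φ := by
    intro a
    refine ⟨∑ i, ((a i).val : ℤ_[p]) • b i, ?_⟩
    funext i
    simp only [Φ]
    rw [b.repr_sum_self, map_natCast, ZMod.natCast_zmod_val]
  have hdvd : ∀ z : ℤ_[p], PadicInt.toZMod z = 0 ↔ (p : ℤ_[p]) ∣ z := by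
    intro z
    rw [← RingHom.mem_ker, PadicInt.ker_toZMod, PadicInt.maximalIdeal_eq_span_p,
      Ideal.mem_span_singleton]
  have hiff : ∀ x y, Φ x = Φ y ↔ WittVector.constantCoeff (τ x) = WittVector.constantCoeff (τ y) := by
    intro x y
    rw [← sub_eq_zero (a := WittVector.constantCoeff (τ x)), ← map_sub, ← map_sub,
      ← WittVector.dvd_iff_constantCoeff]
    have h1 : Φ x = Φ y ↔ ∀ i, (p : ℤ_[p]) ∣ b.repr (x - y) i := by
      rw [funext_iff]
      refine forall_congr' fun i => ?_
      rw [← hdvd, map_sub, Finsupp.sub_apply, map_sub, sub_eq_zero]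
    rw [h1]
    constructor
    · intro h
      choose c hc using h
      have h2 : x - y = p * ∑ i, c i • b i := by
        rw [← b.sum_repr (x - y), Finset.mul_sum]
        refine Finset.sum_congr rfl fun i _ => ?_
        rw [hc i, mul_smul, Algebra.smul_def, map_natCast]
      rw [h2, map_mul, map_natCast]
      exact dvd_mul_right _ _
    · intro h i
      obtain ⟨w, hw⟩ := dvd_of_dvd_toWitt τ h
      refine ⟨b.repr w i, ?_⟩
      have h3 : (p : integralClosure ℤ_[p] B) * w = (p : ℤ_[p]) • w := by
        rw [Algebra.smul_def, map_natCast]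
      rw [hw, h3, map_smul, Finsupp.smul_apply, smul_eq_mul]
  let g : (Fin (Module.finrank ℚ_[p] B) → ZMod p) → (WittVector.constantCoeff.comp τ).range :=
    fun a => (WittVector.constantCoeff.comp τ).rangeRestrict (Function.surjInv hΦ a)
  have hg : Function.Bijective g := by
    constructor
    · intro a a' h
      have h1 := (hiff (Function.surjInv hΦ a) (Function.surjInv hΦ a')).mpr
        (congrArg Subtype.val h)
      rwa [Function.surjInv_eq hΦ, Function.surjInv_eq hΦ] at h1
    · rintro ⟨_, x, rfl⟩
      refine ⟨Φ x, Subtype.ext ?_⟩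
      exact (hiff _ _).mp (Function.surjInv_eq hΦ _)
  rw [← Nat.card_congr (Equiv.ofBijective g hg), Nat.card_fun, Nat.card_zmod]
  simp

/-- A generator of the residue field of `O_B`: its conjugates are distinct. -/
theorem exists_residue_generator : ∃ b : integralClosure ℤ_[p] B,
    WittVector.constantCoeff (τ b) ^ p ^ Module.finrank ℚ_[p] B = WittVector.constantCoeff (τ b) ∧
    ∀ i < Module.finrank ℚ_[p] B, ∀ j < Module.finrank ℚ_[p] B,
      WittVector.constantCoeff (τ b) ^ p ^ i = WittVector.constantCoeff (τ b) ^ p ^ j → i = j := by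
  set r := Module.finrank ℚ_[p] B with hr
  have hcard := card_residue_range τ
  rw [← hr] at hcard
  set E := (WittVector.constantCoeff.comp τ).range
  have hp1 := hp.out.one_lt
  have hfin : Finite E := Nat.finite_of_card_ne_zero (by rw [hcard]; exact pow_ne_zero _ hp.out.ne_zero)
  have : Fintype E := Fintype.ofFinite E
  classical
  let _ : Field E := Fintype.fieldOfDomain E
  obtain ⟨g, hg⟩ := IsCyclic.exists_ofOrder_eq_natCard (α := Eˣ)
  rw [Nat.card_units, hcard] at hg
  obtain ⟨b, hb⟩ := (g : E).2
  have hb' : WittVector.constantCoeff (τ b) = ((g : E) : k) := hb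
  have horder : orderOf (WittVector.constantCoeff (τ b)) = p ^ r - 1 := by
    rw [hb', ← hg, ← orderOf_units, ← orderOf_injective (E.subtype : E →* k) Subtype.val_injective]
    rfl
  have hne : WittVector.constantCoeff (τ b) ≠ 0 := by
    rw [hb']
    exact fun h => g.ne_zero (Subtype.ext h)
  -- By injectivity of Frobenius, a coincidence would force the order p^r - 1 to divide p^(j-i) - 1,
  -- with 0 < j - i < r.
  have key : ∀ i j, i < j → j < r →
      WittVector.constantCoeff (τ b) ^ p ^ i ≠ WittVector.constantCoeff (τ b) ^ p ^ j := by
    intro i j hij hjr h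
    obtain ⟨d, rfl⟩ := Nat.exists_eq_add_of_lt hij
    set β := WittVector.constantCoeff (τ b)
    have h1 : β = β ^ p ^ (d + 1) := by
      rw [show i + d + 1 = d + 1 + i by ring, pow_add p (d + 1) i, pow_mul] at h
      exact iterateFrobenius_inj k p i h
    have hpos : 1 < p ^ (d + 1) := Nat.one_lt_pow (by omega) hp1
    have h2 : β ^ (p ^ (d + 1) - 1) = 1 := by
      apply mul_right_cancel₀ hne
      rw [← pow_succ, Nat.sub_add_cancel hpos.le, one_mul, ← h1]
    have h3 := Nat.le_of_dvd (by omega) (orderOf_dvd_of_pow_eq_one h2)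
    rw [horder] at h3
    have h4 : p ^ (d + 1) < p ^ r := Nat.pow_lt_pow_right hp1 (by omega)
    omega
  refine ⟨b, ?_, fun i hi j hj h => ?_⟩
  · have h1 : WittVector.constantCoeff (τ b) ^ (p ^ r - 1) = 1 := by
      rw [← horder, pow_orderOf_eq_one]
    conv_lhs => rw [← Nat.sub_add_cancel (Nat.one_le_pow r p hp.out.pos)]
    rw [pow_succ, h1, one_mul]
  · rcases lt_trichotomy i j with hij | hij | hij
    · exact absurd h (key i j hij hj)
    · exact hij
    · exact absurd h.symm (key j i hij hi)

open Polynomial in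
/-- The product of the `X - σ^i τ b` is the image of the minimal polynomial of a generator `b`, and
`O_B` is generated by `b` up to `p`-power torsion. -/
theorem exists_generator : ∃ b : integralClosure ℤ_[p] B,
    (∀ i < Module.finrank ℚ_[p] B, ∀ j < Module.finrank ℚ_[p] B, i ≠ j →
      IsUnit ((WittVector.frobeniusEquiv p k ^ i) (τ b) -
        (WittVector.frobeniusEquiv p k ^ j) (τ b))) ∧
    (minpoly ℤ_[p] b).map (τ.comp (algebraMap ℤ_[p] _)) =
      ∏ i ∈ Finset.range (Module.finrank ℚ_[p] B),
        (X - C ((WittVector.frobeniusEquiv p k ^ i) (τ b))) ∧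
    (WittVector.frobeniusEquiv p k ^ Module.finrank ℚ_[p] B) (τ b) = τ b ∧
    ∀ x : integralClosure ℤ_[p] B, ∃ (n : ℕ) (q : ℤ_[p][X]), (p : integralClosure ℤ_[p] B) ^ n * x =
      aeval b q := by
  obtain ⟨b, hbr, hb⟩ := exists_residue_generator τ
  set r := Module.finrank ℚ_[p] B with hr
  set σ := WittVector.frobeniusEquiv p k
  let β : ℕ → WittVector p k := fun i => (σ ^ i) (τ b)
  have hβ : ∀ i, WittVector.constantCoeff (β i) = WittVector.constantCoeff (τ b) ^ p ^ i :=
    fun i => WittVector.constantCoeff_frobeniusEquiv_pow i _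
  have hisunit : ∀ x : WittVector p k, WittVector.constantCoeff x ≠ 0 → IsUnit x :=
    fun x hx => WittVector.isUnit_of_coeff_zero_ne_zero x hx
  have hunit : ∀ i < r, ∀ j < r, i ≠ j → IsUnit (β i - β j) := by
    intro i hi j hj hij
    refine hisunit _ fun h => hij (hb i hi j hj ?_)
    rwa [map_sub, sub_eq_zero, hβ, hβ] at h
  have hint : IsIntegral ℤ_[p] b := Algebra.IsIntegral.isIntegral b
  have hmonic := minpoly.monic hint
  set G := (minpoly ℤ_[p] b).map (τ.comp (algebraMap ℤ_[p] _)) with hG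
  -- All σ^i ∘ τ restrict to the same homomorphism on ℤ_p, so they send b to roots of the same
  -- polynomial.
  have hroot : ∀ i, G.IsRoot (β i) := by
    intro i
    have h1 := congrArg (((σ ^ i : WittVector p k ≃+* WittVector p k) :
      WittVector p k →+* WittVector p k).comp τ) (minpoly.aeval ℤ_[p] b)
    rw [map_zero, aeval_def, hom_eval₂, padicInt_ringHom_ext (RingHom.comp _ _)
      (τ.comp (algebraMap ℤ_[p] _))] at h1
    rw [IsRoot.def, hG, eval_map]
    exact h1
  have hmin : minpoly ℚ_[p] (b : B) = (minpoly ℤ_[p] b).map (algebraMap ℤ_[p] ℚ_[p]) := by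
    have := minpoly.isIntegrallyClosed_eq_field_fractions ℚ_[p] B hint
    exact this
  have hdeg : (minpoly ℚ_[p] (b : B)).natDegree = (minpoly ℤ_[p] b).natDegree := by
    rw [hmin, hmonic.natDegree_map]
  have hle : (minpoly ℤ_[p] b).natDegree ≤ r := hdeg ▸ minpoly.natDegree_le _
  have hPmonic : (∏ i ∈ Finset.range r, (X - C (β i))).Monic := monic_prod_X_sub_C _ _
  have hPdeg : (∏ i ∈ Finset.range r, (X - C (β i))).natDegree = r := by
    rw [natDegree_prod_of_monic _ _ fun i _ => monic_X_sub_C _]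
    simp
  -- Unit differences make the linear factors coprime. The product has degree r and G at most r, so
  -- the two monic polynomials agree.
  have hdvd : ∏ i ∈ Finset.range r, (X - C (β i)) ∣ G := by
    refine Finset.prod_dvd_of_coprime ?_ fun i _ => dvd_iff_isRoot.mpr (hroot i)
    intro i hi j hj hij
    exact isCoprime_X_sub_C_of_isUnit_sub
      (hunit i (Finset.mem_range.mp hi) j (Finset.mem_range.mp hj) hij)
  have hGmonic : G.Monic := hmonic.map _
  have hGdeg : G.natDegree = (minpoly ℤ_[p] b).natDegree := hmonic.natDegree_map _
  have hGP : G = ∏ i ∈ Finset.range r, (X - C (β i)) := by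
    refine (eq_of_monic_of_dvd_of_natDegree_le hPmonic hGmonic hdvd ?_)
    omega
  have hdegr : (minpoly ℚ_[p] (b : B)).natDegree = r := by
    rw [hdeg, ← hGdeg, hGP, hPdeg]
  refine ⟨b, hunit, hGP, ?_, fun x => ?_⟩
  -- σ^r τ(b) is again a root, hence equals some σ^i τ(b) with i < r; comparing residues gives i =
  -- 0.
  · have h1 := hroot r
    rw [hGP, IsRoot.def, eval_prod, Finset.prod_eq_zero_iff] at h1
    obtain ⟨i, hi, h2⟩ := h1
    rw [eval_sub, eval_X, eval_C, sub_eq_zero] at h2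
    have h3 := congrArg WittVector.constantCoeff h2
    have h4 : i = 0 := by
      refine hb i (Finset.mem_range.mp hi) 0 (Nat.pos_of_ne_zero fun h => ?_) ?_
      · rw [h] at hi; simp at hi
      · rw [← hβ i, ← h3, hβ, hbr, pow_zero, pow_one]
    rw [h4] at h2
    exact h2
  · have htop := (Field.primitive_element_iff_minpoly_natDegree_eq ℚ_[p] (b : B)).mpr hdegr
    have hx : (x : B) ∈ (IntermediateField.adjoin ℚ_[p] {(b : B)}).toSubalgebra := by
      rw [htop]; trivial
    rw [IntermediateField.adjoin_simple_toSubalgebra_of_isAlgebraic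
      (Algebra.IsAlgebraic.isAlgebraic _)] at hx
    rw [Algebra.adjoin_singleton_eq_range_aeval] at hx
    obtain ⟨q, hq⟩ := hx
    have hclear : ∀ q : ℚ_[p][X], ∃ (n : ℕ) (q' : ℤ_[p][X]),
        C ((p : ℚ_[p]) ^ n) * q = q'.map (algebraMap ℤ_[p] ℚ_[p]) := by
      intro q
      induction q using Polynomial.induction_on' with
      | add q₁ q₂ h₁ h₂ =>
        obtain ⟨n₁, q₁', h₁⟩ := h₁
        obtain ⟨n₂, q₂', h₂⟩ := h₂
        refine ⟨n₁ + n₂, C ((p : ℤ_[p]) ^ n₂) * q₁' + C ((p : ℤ_[p]) ^ n₁) * q₂', ?_⟩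
        rw [Polynomial.map_add, Polynomial.map_mul, Polynomial.map_mul, ← h₁, ← h₂, map_C, map_C]
        simp only [map_pow, map_natCast, pow_add, map_mul]
        ring
      | monomial m c =>
        obtain ⟨n, hn⟩ : ∃ n : ℕ, ‖(p : ℚ_[p]) ^ n * c‖ ≤ 1 := by
          by_cases hc : c = 0
          · exact ⟨0, by simp [hc]⟩
          obtain ⟨n, hn⟩ := PadicInt.exists_pow_neg_lt p (ε := ‖c‖⁻¹) (by positivity)
          refine ⟨n, ?_⟩
          rw [norm_mul, Padic.norm_p_pow]
          have := norm_pos_iff.mpr hc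
          calc _ ≤ ‖c‖⁻¹ * ‖c‖ := by gcongr
            _ = 1 := inv_mul_cancel₀ this.ne'
        obtain ⟨z, hz⟩ : ∃ z : ℤ_[p], algebraMap ℤ_[p] ℚ_[p] z = (p : ℚ_[p]) ^ n * c :=
          ⟨⟨_, hn⟩, rfl⟩
        refine ⟨n, monomial m z, ?_⟩
        rw [map_monomial, C_mul_monomial, hz]
    obtain ⟨n, q', hq'⟩ := hclear q
    refine ⟨n, q', Subtype.ext ?_⟩
    have h1 := congrArg (aeval (b : B)) hq'
    rw [aeval_map_algebraMap, map_mul, aeval_C, map_pow, map_natCast] at h1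
    have h2 : ((aeval b q' : integralClosure ℤ_[p] B) : B) = aeval (b : B) q' := by
      exact (aeval_algebraMap_apply B b q').symm
    have h3 : aeval (b : B) q = (x : B) := hq
    rw [h2, ← h1, h3]
    rfl

end Generator

/-! ## The decomposition into isotypic summands -/

section Projections

variable {R M : Type*} [CommRing R] [AddCommGroup M] [Module R M]

open Polynomial in
theorem aeval_apply_of_apply_eq_smul {T : Module.End R M} {c : R} {m : M} (h : T m = c • m)
    (P : R[X]) : aeval T P m = P.eval c • m := by
  induction P using Polynomial.induction_on' with
  | add P Q hP hQ => rw [map_add, LinearMap.add_apply, hP, hQ, eval_add, add_smul]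
  | monomial n a =>
    have hn : (T ^ n) m = c ^ n • m := by
      induction n with
      | zero => simp
      | succ n ih => rw [pow_succ', Module.End.mul_apply, ih, map_smul, h, smul_smul, pow_succ]
    rw [aeval_monomial, Module.End.mul_apply, hn, Module.algebraMap_end_apply, smul_smul,
      eval_monomial]

open Polynomial in
/-- An endomorphism killed by a product of linear polynomials with strongly distinct roots is
diagonalizable. -/
theorem exists_eigenprojections {T : Module.End R M} {S : Finset ℕ} (β : ℕ → R)
    (hβ : ∀ i ∈ S, ∀ j ∈ S, i ≠ j → IsUnit (β i - β j))
    (hT : aeval T (∏ i ∈ S, (X - C (β i))) = 0) :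
    ∃ e : ℕ → M →ₗ[R] M, (∀ i ∈ S, ∀ m, T (e i m) = β i • e i m) ∧
      (∀ m, ∑ i ∈ S, e i m = m) ∧
      ∀ i ∈ S, ∀ j ∈ S, ∀ m, T m = β j • m → e i m = if i = j then m else 0 := by
  classical
  let q : ℕ → R[X] := fun i => ∏ j ∈ S.erase i, (X - C (β j))
  have hq : ∀ i ∈ S, (X - C (β i)) * q i = ∏ i ∈ S, (X - C (β i)) :=
    fun i hi => Finset.mul_prod_erase S (fun j => X - C (β j)) hi
  have hunit : ∀ i ∈ S, IsUnit ((q i).eval (β i)) := by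
    intro i hi
    rw [eval_prod]
    refine (Finset.prod_induction _ IsUnit (fun _ _ => IsUnit.mul) isUnit_one) fun j hj => ?_
    rw [eval_sub, eval_X, eval_C]
    exact hβ i hi j (Finset.mem_of_mem_erase hj) (Finset.ne_of_mem_erase hj).symm
  have hqj : ∀ i ∈ S, ∀ j ∈ S, i ≠ j → (q i).eval (β j) = 0 := by
    intro i hi j hj hij
    rw [eval_prod]
    exact Finset.prod_eq_zero (Finset.mem_erase.mpr ⟨hij.symm, hj⟩) (by simp)
  -- Lagrange interpolation polynomials, defined over R because q_i(β_i) is a unit. The projections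
  -- are the P_i(T); they sum to 1 because ∑ P_i - 1 vanishes at every β_j and is thus a multiple of
  -- the polynomial that kills T.
  let P : ℕ → R[X] := fun i => C (Ring.inverse ((q i).eval (β i))) * q i
  have hP : ∀ i ∈ S, ∀ j ∈ S, (P i).eval (β j) = if i = j then 1 else 0 := by
    intro i hi j hj
    rw [eval_mul, eval_C]
    split_ifs with h
    · rw [← h, Ring.inverse_mul_cancel _ (hunit i hi)]
    · rw [hqj i hi j hj h, mul_zero]
  refine ⟨fun i => aeval T (P i), fun i hi m => ?_, fun m => ?_, fun i hi j hj m hm => ?_⟩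
  · have h1 : aeval T ((X - C (β i)) * P i) = 0 := by
      rw [mul_left_comm, hq i hi, map_mul, hT, mul_zero]
    have h2 := congrArg (fun f => f m) h1
    simp only [map_mul, map_sub, aeval_X, aeval_C, Module.End.mul_apply, LinearMap.sub_apply,
      Module.algebraMap_end_apply, LinearMap.zero_apply] at h2
    rw [← sub_eq_zero]
    exact h2
  · have h1 : ∏ i ∈ S, (X - C (β i)) ∣ ∑ i ∈ S, P i - 1 := by
      refine Finset.prod_dvd_of_coprime ?_ fun j hj => dvd_iff_isRoot.mpr ?_
      · intro i hi j hj hij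
        exact isCoprime_X_sub_C_of_isUnit_sub (hβ i hi j hj hij)
      · rw [IsRoot.def, eval_sub, eval_finsetSum, eval_one,
          Finset.sum_congr rfl fun i hi => hP i hi j hj]
        simp [hj]
    obtain ⟨Q, hQ⟩ := h1
    have h2 := congrArg (aeval T) hQ
    rw [map_mul, hT, zero_mul, map_sub, map_sum, map_one, sub_eq_zero] at h2
    rw [← LinearMap.sum_apply, h2, Module.End.one_apply]
  · rw [aeval_apply_of_apply_eq_smul hm, hP i hi j hj]
    split_ifs <;> simp

end Projections

/-! ### The cyclic grading of a crystal -/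

section Decomposition

variable {p : ℕ} [hp : Fact p.Prime] {k : Type*} [Field k] [CharP k p] [IsAlgClosed k]
  {B : Type*} [Field B] [Algebra ℚ_[p] B] [FiniteDimensional ℚ_[p] B]
    [Algebra ℤ_[p] B] [IsScalarTower ℤ_[p] ℚ_[p] B]
  {M : Type*} [AddCommGroup M] [Module (WittVector p k) M]
  [Module.Free (WittVector p k) M]

/-- A grading of `M` by `ℤ / r` for which `F` has degree one; the degrees are given by natural
numbers. -/
structure IsCyclicGrading (r : ℕ) (F : M → M) (L : ℕ → Submodule (WittVector p k) M)
    (e : ℕ → M →ₗ[WittVector p k] M) : Prop where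
  pos : 0 < r
  period : ∀ i, L (i + r) = L i
  map_mem : ∀ i, ∀ m ∈ L i, F m ∈ L (i + 1)
  proj_mem : ∀ i m, e i m ∈ L i
  sum_proj : ∀ m, ∑ i ∈ Finset.range r, e i m = m
  proj_apply : ∀ i j m, m ∈ L j → e i m = if i % r = j % r then m else 0

variable (X : FCrystal p k (integralClosure ℤ_[p] B) M)
    (τ : integralClosure ℤ_[p] B →+* WittVector p k)

theorem FCrystal.isSemilinear : IsSemilinear (WittVector.frobeniusEquiv p k) X.F :=
  ⟨X.F.map_add, X.F.map_smulₛₗ⟩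

theorem FCrystal.injective (x : M) (h : X.F x = 0) : x = 0 := by
  obtain ⟨n, hn⟩ := X.ker_torsion x h
  exact (smul_eq_zero.mp hn).resolve_left (pow_ne_zero _ (WittVector.p_nonzero p k))

theorem frobenius_iterate_eq (i : ℕ) (x : WittVector p k) :
    WittVector.frobenius^[i] x = (WittVector.frobeniusEquiv p k ^ i) x := by
  induction i generalizing x with
  | zero => rfl
  | succ i ih => rw [Function.iterate_succ_apply, ih, pow_succ]; rfl

theorem FCrystal.mem_isotypic {i : ℕ} {m : M} : m ∈ X.isotypic τ i ↔
    ∀ b, X.ι b m = (WittVector.frobeniusEquiv p k ^ i) (τ b) • m := by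
  simp only [← frobenius_iterate_eq]
  rfl

theorem FCrystal.map_mem_isotypic (i : ℕ) (m : M) (hm : m ∈ X.isotypic τ i) :
    X.F m ∈ X.isotypic τ (i + 1) := by
  rw [X.mem_isotypic] at hm ⊢
  intro b
  rw [← X.commute, hm, X.isSemilinear.map_smul, pow_succ']
  rfl

open Polynomial in
-- Up to powers of p, elements of O_B are polynomials in b over ℤ_p, and M is torsion-free; so M^(i)
-- is the eigenspace of ι(b) for σ^i τ(b). The minimal polynomial of b kills ι(b) and splits with
-- unit differences of roots, which gives the projections; σ^r τ(b) = τ(b) gives the period.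
theorem FCrystal.isCyclicGrading : ∃ e, IsCyclicGrading (Module.finrank ℚ_[p] B) X.F
    (X.isotypic τ) e := by
  obtain ⟨b, hunit, hmin, hb, hgen⟩ := exists_generator τ
  set r := Module.finrank ℚ_[p] B with hr
  set σ := WittVector.frobeniusEquiv p k
  have hpos : 0 < r := Module.finrank_pos
  let j := τ.comp (algebraMap ℤ_[p] (integralClosure ℤ_[p] B))
  have hι : X.ι.comp (algebraMap ℤ_[p] _) =
      (algebraMap (WittVector p k) (Module.End (WittVector p k) M)).comp j := end_padicInt_eq _ _
  have haeval : ∀ q : ℤ_[p][X], X.ι (aeval b q) = aeval (X.ι b) (q.map j) := by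
    intro q
    rw [aeval_def, hom_eval₂, hι, aeval_def, eval₂_map]
  have hring : ∀ (f : integralClosure ℤ_[p] B →+* WittVector p k) (q : ℤ_[p][X]),
      f (aeval b q) = (q.map j).eval (f b) := by
    intro f q
    rw [aeval_def, hom_eval₂, padicInt_ringHom_ext (f.comp _) j, eval_map]
  have hp0 : (p : WittVector p k) ≠ 0 := WittVector.p_nonzero p k
  have hmem : ∀ i m, m ∈ X.isotypic τ i ↔ X.ι b m = (σ ^ i) (τ b) • m := by
    intro i m
    rw [X.mem_isotypic]
    refine ⟨fun h => h b, fun h x => ?_⟩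
    obtain ⟨n, q, hx⟩ := hgen x
    apply smul_right_injective M (pow_ne_zero n hp0)
    simp only
    have h1 : (p : WittVector p k) ^ n • X.ι x m = X.ι ((p : integralClosure ℤ_[p] B) ^ n * x) m := by
      rw [map_mul, map_pow, map_natCast, Module.End.mul_apply,
        ← Nat.cast_pow (α := Module.End (WittVector p k) M), Module.End.natCast_apply,
        ← Nat.cast_pow, Nat.cast_smul_eq_nsmul]
    have h2 : (p : WittVector p k) ^ n * (σ ^ i) (τ x) =
        (σ ^ i) (τ ((p : integralClosure ℤ_[p] B) ^ n * x)) := by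
      simp only [map_mul, map_pow, map_natCast]
    rw [h1, smul_smul, h2, hx, haeval, aeval_apply_of_apply_eq_smul h]
    congr 1
    exact (hring (((σ ^ i : WittVector p k ≃+* WittVector p k) :
      WittVector p k →+* WittVector p k).comp τ) q).symm
  have hperiod : ∀ i, X.isotypic τ (i + r) = X.isotypic τ i := by
    intro i
    ext m
    rw [hmem, hmem, pow_add, RingAut.mul_apply, hb]
  have hmod : ∀ i, X.isotypic τ (i % r) = X.isotypic τ i := by
    intro i
    conv_rhs => rw [← Nat.mod_add_div i r]
    generalize i / r = t
    induction t with
    | zero => simp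
    | succ t ih => rw [Nat.mul_succ, ← add_assoc, hperiod, ih]
  obtain ⟨e, he, hsum, happly⟩ := exists_eigenprojections (T := X.ι b) (S := Finset.range r)
    (fun i => (σ ^ i) (τ b))
    (fun i hi j hj hij => hunit i (Finset.mem_range.mp hi) j (Finset.mem_range.mp hj) hij) (by
      rw [← hmin, ← haeval, minpoly.aeval, map_zero])
  have hlt : ∀ i, i % r ∈ Finset.range r := fun i => Finset.mem_range.mpr (Nat.mod_lt _ hpos)
  refine ⟨fun i => e (i % r), hpos, hperiod, X.map_mem_isotypic τ, fun i m => ?_, fun m => ?_,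
    fun i l m hm => ?_⟩
  · rw [← hmod, hmem]
    exact he _ (hlt i) m
  · conv_rhs => rw [← hsum m]
    refine Finset.sum_congr rfl fun i hi => ?_
    rw [Nat.mod_eq_of_lt (Finset.mem_range.mp hi)]
  · rw [← hmod, hmem] at hm
    exact happly _ (hlt i) _ (hlt l) m hm

end Decomposition

/-! ## Newton polygons and eigenbases -/

section Saturation

variable {R P : Type*} [CommRing R] [AddCommGroup P] [Module R P] {p : ℕ}

theorem exists_pow_smul_mem_of_mem_span [IsDomain R] {E : Set P} {L : Submodule R P}
    (h : ∀ m ∈ E, ∃ c : ℕ, (p : R) ^ c • m ∈ L) {m : P} (hm : m ∈ Submodule.span R E) :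
    ∃ c : ℕ, (p : R) ^ c • m ∈ L := by
  induction hm using Submodule.span_induction with
  | mem x hx => exact h x hx
  | zero => exact ⟨0, by simp⟩
  | add x y _ _ hx hy =>
    obtain ⟨c, hc⟩ := hx
    obtain ⟨d, hd⟩ := hy
    refine ⟨max c d, ?_⟩
    rw [smul_add]
    exact add_mem (pow_smul_mem_of_le (le_max_left c d) hc)
      (pow_smul_mem_of_le (le_max_right c d) hd)
  | smul a x _ hx =>
    obtain ⟨c, hc⟩ := hx
    refine ⟨c, ?_⟩
    rw [smul_comm]
    exact L.smul_mem _ hc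

/-- Multiplication by a suitable p^c embeds S into the span of the independent vectors, which lies
in S. -/
theorem finrank_eq_card_of_saturates [IsDomain R] [IsNoetherianRing R] [Module.Finite R P]
    [Module.IsTorsionFree R P]
    (hp : (p : R) ≠ 0) {ι : Type*} [Fintype ι] {v : ι → P} (hv : LinearIndependent R v)
    {S : Submodule R P} (hS : ∀ j, v j ∈ S)
    (hsat : ∀ m ∈ S, ∃ c : ℕ, (p : R) ^ c • m ∈ Submodule.span R (Set.range v)) :
    Module.finrank R S = Fintype.card ι := by
  rw [← finrank_span_eq_card hv]
  refine le_antisymm ?_ (Submodule.finrank_mono (Submodule.span_le.mpr ?_))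
  · obtain ⟨c, hc⟩ := exists_uniform_pow_smul_mem (IsNoetherian.noetherian S) hsat
    refine LinearMap.finrank_le_finrank_of_injective
      (f := ((LinearMap.lsmul R P ((p : R) ^ c)).restrict hc)) ?_
    intro x y hxy
    have := congrArg Subtype.val hxy
    exact Subtype.ext (smul_right_injective P (pow_ne_zero c hp) this)
  · rintro _ ⟨j, rfl⟩
    exact hS j

theorem IsSemilinear.linearIndependent_comp {τ : R ≃+* R} {G : P → P} (hG : IsSemilinear τ G)
    (hinj : ∀ x, G x = 0 → x = 0) {ι : Type*} [Fintype ι] {v : ι → P}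
    (hv : LinearIndependent R v) : LinearIndependent R (G ∘ v) := by
  rw [Fintype.linearIndependent_iff] at hv ⊢
  intro g hg j
  have h1 : G (∑ j, τ.symm (g j) • v j) = 0 := by
    rw [hG.map_sum, ← hg]
    refine Finset.sum_congr rfl fun j _ => ?_
    rw [hG.map_smul, RingEquiv.apply_symm_apply, Function.comp_apply]
  have h2 := hv _ (hinj _ h1) j
  simpa using h2

theorem IsSemilinear.map_mem_span {τ : R ≃+* R} {G : P → P} (hG : IsSemilinear τ G) {E : Set P}
    {L : Submodule R P} (hE : ∀ x ∈ E, G x ∈ L) {x : P} (hx : x ∈ Submodule.span R E) :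
    G x ∈ L := by
  induction hx using Submodule.span_induction with
  | mem x hx => exact hE x hx
  | zero => rw [hG.map_zero]; exact zero_mem _
  | add x y _ _ hx hy => rw [hG.map_add]; exact add_mem hx hy
  | smul c x _ hx => rw [hG.map_smul]; exact L.smul_mem _ hx

theorem iterate_eq_zero {G : P → P} (hinj : ∀ x, G x = 0 → x = 0) (q : ℕ) (x : P)
    (h : G^[q] x = 0) : x = 0 := by
  induction q with
  | zero => exact h
  | succ q ih =>
    rw [Function.iterate_succ_apply'] at h
    exact ih (hinj _ h)

end Saturation

theorem map_snd_product {α β γ : Type*} (t : Multiset α) (u : Multiset β) (f : β → γ) :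
    (t ×ˢ u).map (fun x => f x.2) = t.card • u.map f := by
  induction t using Multiset.induction_on with
  | empty => simp
  | cons a t ih =>
    rw [Multiset.cons_product, Multiset.map_add, ih, Multiset.card_cons, succ_nsmul',
      Multiset.map_map]
    rfl

section Newton

variable {p : ℕ} [hp : Fact p.Prime] {k : Type*} [Field k] [CharP k p] [IsAlgClosed k]
  {M : Type*} [AddCommGroup M] [Module (WittVector p k) M] [Module.Free (WittVector p k) M]
  [Module.Finite (WittVector p k) M] {τ : WittVector p k ≃+* WittVector p k}
  {ι : Type*} {L : Submodule (WittVector p k) M} {G : M → M} {N : ℕ} {s : ι → ℕ} {v : ι → M}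

/-- A maximal linearly independent subset of E spans E up to p-power torsion, nonzero scalars being
powers of p times units. The product of the exponents of its members is a common exponent. -/
theorem exists_isEigenbasis_of_span (hG : IsSemilinear τ G) {E : Set M} (hEL : E ⊆ L)
    (hE : ∀ v ∈ E, ∃ N, 0 < N ∧ v ∈ eigenvectors p k G N)
    (hL : ∀ m ∈ L, ∃ c : ℕ, (p : WittVector p k) ^ c • m ∈ Submodule.span (WittVector p k) E) :
    ∃ (n N : ℕ) (s : Fin n → ℕ) (v : Fin n → M), IsEigenbasis p L G N s v := by
  classical
  obtain ⟨J, hJ, hmax⟩ := exists_maximal_linearIndepOn (WittVector p k) (fun x : E => (x : M))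
  have : Finite J := LinearIndependent.finite hJ
  have := Fintype.ofFinite J
  choose N hN s hs using hE
  let w : J → M := fun x => x.1.1
  let N' : ℕ := ∏ x : J, N x.1.1 x.1.2
  have hN' : 0 < N' := Finset.prod_pos fun x _ => hN _ _
  have heig : ∀ x : J, ∃ t : ℕ, G^[N'] (w x) = (p : WittVector p k) ^ t • w x := by
    intro x
    obtain ⟨t, ht⟩ := Finset.dvd_prod_of_mem (fun x : J => N x.1.1 x.1.2) (Finset.mem_univ x)
    refine ⟨s x.1.1 x.1.2 * t, ?_⟩
    rw [show N' = _ from ht]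
    exact hG.iterate_eigen (hs _ _) t
  choose t ht using heig
  let f := (Fintype.equivFin J).symm
  refine ⟨Fintype.card J, N', t ∘ f, w ∘ f, hN', fun j => hEL (f j).1.2, fun j => ht (f j),
    hJ.comp f f.injective, fun m hm => ?_⟩
  obtain ⟨c, hc⟩ := hL m hm
  have hE' : ∀ m ∈ E, ∃ c : ℕ, (p : WittVector p k) ^ c • m ∈
      Submodule.span (WittVector p k) (Set.range (w ∘ f)) := by
    intro m hm
    have hr : Set.range (w ∘ f) = (fun x : E => (x : M)) '' J := by
      rw [f.surjective.range_comp]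
      ext y
      simp [w]
    rw [hr]
    by_cases hmJ : (⟨m, hm⟩ : E) ∈ J
    · exact ⟨0, by rw [pow_zero, one_smul]; exact Submodule.subset_span ⟨_, hmJ, rfl⟩⟩
    · obtain ⟨a, ha, hmem⟩ := hmax _ hmJ
      obtain ⟨c, u, rfl⟩ := WittVector.exists_eq_pow_p_mul' a ha
      refine ⟨c, ?_⟩
      rw [mul_comm, mul_smul] at hmem
      exact (Submodule.smul_mem_iff_of_isUnit _ u.isUnit).mp hmem
  obtain ⟨d, hd⟩ := exists_pow_smul_mem_of_mem_span hE' hc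
  exact ⟨d + c, by rwa [pow_add, mul_smul]⟩

theorem IsEigenbasis.finrank_eq [Fintype ι] (hv : IsEigenbasis p L G N s v) :
    Module.finrank (WittVector p k) L = Fintype.card ι :=
  finrank_eq_card_of_saturates (WittVector.p_nonzero p k) hv.linearIndependent hv.mem hv.saturates

theorem eq_of_pow_mul_eq {a : WittVector p k} (ha : a ≠ 0) {m n : ℕ}
    (h : (p : WittVector p k) ^ m * a = τ a * (p : WittVector p k) ^ n) : m = n := by
  have hP : Prime (p : WittVector p k) := WittVector.natCast_prime
  obtain ⟨c, hc⟩ : ∃ c : ℕ, emultiplicity (p : WittVector p k) a = c :=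
    ⟨_, (FiniteMultiplicity.of_not_isUnit hP.not_isUnit ha).emultiplicity_eq_multiplicity⟩
  have h1 := congrArg (emultiplicity (p : WittVector p k)) h
  rw [emultiplicity_mul hP, emultiplicity_mul hP, emultiplicity_ringEquiv,
    emultiplicity_pow_self_of_prime hP, emultiplicity_pow_self_of_prime hP, hc] at h1
  norm_cast at h1
  omega

/-- If G^n w = p^t w and p^c w = ∑ a_j v_j, applying G^(nN) gives p^(tN) a_j = τ^(nN)(a_j) p^(s_j
n). Valuations force t/n = s_j/N wherever a_j ≠ 0, so the slope part is, up to torsion, spanned by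
the v_j of that slope. -/
theorem IsEigenbasis.finrank_slopePart [Fintype ι] (hG : IsSemilinear τ G)
    (hv : IsEigenbasis p L G N s v) (q : ℚ) :
    Module.finrank (WittVector p k) (slopePart p L G q) =
      (Finset.univ.val.map fun j => (s j : ℚ) / N).count q := by
  classical
  have hcard : (Finset.univ.val.map fun j => (s j : ℚ) / N).count q =
      Fintype.card {j // (s j : ℚ) / N = q} := by
    rw [Multiset.count_map, Fintype.card_subtype, Finset.card_def, Finset.filter_val]
    simp only [eq_comm]
  rw [hcard]
  refine finrank_eq_card_of_saturates (WittVector.p_nonzero p k)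
    (hv.linearIndependent.comp (Subtype.val : {j // (s j : ℚ) / N = q} → ι)
      Subtype.val_injective) (fun j => ?_) fun m hm => ?_
  · exact Submodule.subset_span ⟨hv.mem _, N, s j, hv.pos, j.2, hv.eigen _⟩
  refine exists_pow_smul_mem_of_mem_span ?_ hm
  rintro w ⟨hwL, n, t, hn, hq, hw⟩
  obtain ⟨c, hc⟩ := hv.saturates w hwL
  refine ⟨c, ?_⟩
  obtain ⟨a, ha⟩ := (Submodule.mem_span_range_iff_exists_fun _).mp hc
  have h1 : ∑ j, ((p : WittVector p k) ^ (t * N) * a j) • v j =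
      ∑ j, ((τ ^ (n * N)) (a j) * (p : WittVector p k) ^ (s j * n)) • v j := by
    have h2 : G^[n * N] (∑ j, a j • v j) = (p : WittVector p k) ^ (t * N) • ∑ j, a j • v j := by
      rw [ha, (hG.iterate _).map_pow_smul, hG.iterate_eigen hw, smul_comm]
    rw [(hG.iterate _).map_sum, Finset.smul_sum] at h2
    simp only [mul_smul]
    rw [← h2]
    refine Finset.sum_congr rfl fun j _ => ?_
    rw [(hG.iterate _).map_smul, mul_comm n N, hG.iterate_eigen (hv.eigen j)]
  have h2 := hv.linearIndependent.eq_coords_of_eq h1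
  rw [← ha]
  refine Submodule.sum_mem _ fun j _ => ?_
  by_cases hj : a j = 0
  · rw [hj, zero_smul]; exact zero_mem _
  · have h3 := eq_of_pow_mul_eq hj (h2 j)
    refine Submodule.smul_mem _ _ (Submodule.subset_span ⟨⟨j, ?_⟩, rfl⟩)
    have hN := hv.pos
    rw [← hq, div_eq_div_iff (by positivity) (by positivity)]
    exact_mod_cast h3.symm

theorem IsEigenbasis.newtonPolygon_eq [Fintype ι] (hG : IsSemilinear τ G)
    (hv : IsEigenbasis p L G N s v) :
    newtonPolygon p L G = Finset.univ.val.map fun j => (s j : ℚ) / N := by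
  classical
  unfold newtonPolygon
  simp only [hv.finrank_slopePart hG]
  set t := Finset.univ.val.map fun j => (s j : ℚ) / N
  rw [finsum_eq_sum_of_support_subset (s := t.toFinset)]
  · conv_rhs => rw [← Multiset.toFinset_sum_count_nsmul_eq t]
    simp only [Multiset.nsmul_singleton]
  · intro q hq
    rw [Finset.mem_coe, Multiset.mem_toFinset]
    by_contra h
    exact hq (by simp [Multiset.count_eq_zero_of_notMem h])

end Newton

/-! ### Slopes of the graded pieces -/

section CyclicGrading

variable {p : ℕ} [hp : Fact p.Prime] {k : Type*} [Field k] [CharP k p] [IsAlgClosed k]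
  {M : Type*} [AddCommGroup M] [Module (WittVector p k) M]
  {τ : WittVector p k ≃+* WittVector p k} {r : ℕ} {F : M → M}
  {L : ℕ → Submodule (WittVector p k) M} {e : ℕ → M →ₗ[WittVector p k] M}

namespace IsCyclicGrading

theorem proj_eq_sum (h : IsCyclicGrading r F L e) (i : ℕ) (m : M) :
    e i m = ∑ j ∈ Finset.range r, if i % r = j % r then e j m else 0 := by
  conv_lhs => rw [← h.sum_proj m]
  rw [map_sum]
  exact Finset.sum_congr rfl fun j _ => h.proj_apply i j _ (h.proj_mem j m)

theorem proj_congr (h : IsCyclicGrading r F L e) {i j : ℕ} (hij : i % r = j % r) : e i = e j := by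
  ext m
  rw [h.proj_eq_sum, h.proj_eq_sum, hij]

theorem proj_self (h : IsCyclicGrading r F L e) {i : ℕ} {m : M} (hm : m ∈ L i) : e i m = m := by
  rw [h.proj_apply i i m hm, if_pos rfl]

theorem proj_map (h : IsCyclicGrading r F L e) (hF : IsSemilinear τ F) (i : ℕ) (m : M) :
    e (i + 1) (F m) = F (e i m) := by
  conv_lhs => rw [← h.sum_proj m]
  rw [hF.map_sum, map_sum, h.proj_eq_sum i m, hF.map_sum]
  refine Finset.sum_congr rfl fun j _ => ?_
  rw [h.proj_apply _ _ _ (h.map_mem j _ (h.proj_mem j m)), apply_ite F, hF.map_zero]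
  exact if_congr ⟨fun h => Nat.ModEq.add_right_cancel' 1 h, fun h => Nat.ModEq.add_right 1 h⟩
    rfl rfl

theorem proj_iterate (h : IsCyclicGrading r F L e) (hF : IsSemilinear τ F) (i q : ℕ) (m : M) :
    e (i + q) (F^[q] m) = F^[q] (e i m) := by
  induction q with
  | zero => rfl
  | succ q ih =>
    rw [Function.iterate_succ_apply', Function.iterate_succ_apply', ← ih, ← add_assoc,
      h.proj_map hF]

theorem iterate_mem (h : IsCyclicGrading r F L e) {i : ℕ} {m : M} (hm : m ∈ L i) (q : ℕ) :
    F^[q] m ∈ L (i + q) := by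
  induction q with
  | zero => exact hm
  | succ q ih => rw [Function.iterate_succ_apply', ← add_assoc]; exact h.map_mem _ _ ih

theorem coker_torsion (h : IsCyclicGrading r F L e) (hF : IsSemilinear τ F)
    (hcok : ∀ m, ∃ (n : ℕ) (m' : M), F m' = (p : WittVector p k) ^ n • m) {i q : ℕ} {m : M}
    (hm : m ∈ L (i + q)) : ∃ n : ℕ, ∃ m' ∈ L i, F^[q] m' = (p : WittVector p k) ^ n • m := by
  have h1 : ∀ (q : ℕ) (m : M), ∃ (n : ℕ) (m' : M), F^[q] m' = (p : WittVector p k) ^ n • m := by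
    intro q
    induction q with
    | zero => exact fun m => ⟨0, m, by simp⟩
    | succ q ih =>
      intro m
      obtain ⟨a, y, hy⟩ := hcok m
      obtain ⟨b, z, hz⟩ := ih y
      refine ⟨b + a, z, ?_⟩
      rw [Function.iterate_succ_apply', hz, hF.map_pow_smul, hy, smul_smul, ← pow_add]
  obtain ⟨n, m', hm'⟩ := h1 q m
  refine ⟨n, e i m', h.proj_mem _ _, ?_⟩
  rw [← h.proj_iterate hF, hm', map_smul, h.proj_self hm]

/-- F^q commutes with F^r, is injective, and maps L_i into L_{i+q} with p-power torsion cokernel;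
the exponents s_j are therefore unchanged. -/
theorem isEigenbasis_iterate (h : IsCyclicGrading r F L e) (hF : IsSemilinear τ F)
    (hinj : ∀ x, F x = 0 → x = 0)
    (hcok : ∀ m, ∃ (n : ℕ) (m' : M), F m' = (p : WittVector p k) ^ n • m) {ι : Type*} [Fintype ι]
    {i N : ℕ} {s : ι → ℕ} {v : ι → M} (hv : IsEigenbasis p (L i) F^[r] N s v) (q : ℕ) :
    IsEigenbasis p (L (i + q)) F^[r] N s (F^[q] ∘ v) := by
  refine ⟨hv.pos, fun j => h.iterate_mem (hv.mem j) q, fun j => ?_,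
    (hF.iterate q).linearIndependent_comp (iterate_eq_zero hinj q) hv.linearIndependent,
    fun m hm => ?_⟩
  · rw [← Function.iterate_mul, Function.comp_apply, ← Function.iterate_add_apply, add_comm,
      Function.iterate_add_apply, Function.iterate_mul, hv.eigen, (hF.iterate q).map_pow_smul]
  · obtain ⟨n, m', hm', hq⟩ := h.coker_torsion hF hcok hm
    obtain ⟨c, hc⟩ := hv.saturates m' hm'
    refine ⟨c + n, ?_⟩
    rw [pow_add, mul_smul, ← hq, ← (hF.iterate q).map_pow_smul]
    refine (hF.iterate q).map_mem_span ?_ hc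
    rintro _ ⟨j, rfl⟩
    exact Submodule.subset_span ⟨j, rfl⟩

/-- F^(rN) acts on each F^i v_j by p^s_j, so every exponent occurs r times. Independence and
saturation are checked degree by degree with the projections. -/
theorem isEigenbasis_top (h : IsCyclicGrading r F L e) (hF : IsSemilinear τ F)
    (hinj : ∀ x, F x = 0 → x = 0)
    (hcok : ∀ m, ∃ (n : ℕ) (m' : M), F m' = (p : WittVector p k) ^ n • m) {ι : Type*} [Fintype ι]
    {N : ℕ} {s : ι → ℕ} {v : ι → M} (hv : IsEigenbasis p (L 0) F^[r] N s v) :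
    IsEigenbasis p (⊤ : Submodule (WittVector p k) M) F (r * N) (fun x : Fin r × ι => s x.2)
      (fun x => F^[x.1] (v x.2)) := by
  have hi := fun i => h.isEigenbasis_iterate hF hinj hcok hv i
  simp only [zero_add] at hi
  refine ⟨Nat.mul_pos h.pos hv.pos, fun _ => trivial, fun x => ?_, ?_, fun m _ => ?_⟩
  · rw [Function.iterate_mul]
    exact (hi x.1).eigen x.2
  · rw [Fintype.linearIndependent_iff]
    rintro g hg ⟨i, j⟩
    refine Fintype.linearIndependent_iff.mp (hi i).linearIndependent (fun j => g (i, j)) ?_ j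
    have h1 := congrArg (e i) hg
    rw [Fintype.sum_prod_type, map_sum, map_zero] at h1
    rw [← h1, Finset.sum_eq_single i]
    · refine (h.proj_self (Submodule.sum_mem _ fun j _ => ?_)).symm
      exact Submodule.smul_mem _ _ ((hi i).mem j)
    · intro l _ hl
      rw [h.proj_apply _ l, if_neg]
      · rw [Nat.mod_eq_of_lt i.2, Nat.mod_eq_of_lt l.2]
        exact fun h => hl (Fin.ext h.symm)
      · exact Submodule.sum_mem _ fun j _ => Submodule.smul_mem _ _ ((hi l).mem j)
    · exact fun hi => absurd (Finset.mem_univ i) hi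
  · refine exists_pow_smul_mem_of_mem_span (E := {m | ∃ i < r, m ∈ L i}) ?_ ?_
    · rintro m ⟨i, hir, hm⟩
      obtain ⟨c, hc⟩ := (hi i).saturates m hm
      refine ⟨c, Submodule.span_mono ?_ hc⟩
      rintro _ ⟨j, rfl⟩
      exact ⟨(⟨i, hir⟩, j), rfl⟩
    · rw [← h.sum_proj m]
      exact Submodule.sum_mem _ fun i hir =>
        Submodule.subset_span ⟨i, Finset.mem_range.mp hir, h.proj_mem i m⟩

variable [Module.Free (WittVector p k) M] [Module.Finite (WittVector p k) M]

/-- If F^N v = p^s v, then F^(Nr) preserves degrees, so each homogeneous component of v is an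
eigenvector of (F^r)^N with eigenvalue p^(sr). Projecting the theorem of Dieudonné and Manin to
degree i thus gives enough eigenvectors. -/
theorem exists_isEigenbasis (h : IsCyclicGrading r F L e)
    (hF : IsSemilinear (WittVector.frobeniusEquiv p k) F) (hinj : ∀ x, F x = 0 → x = 0) (i : ℕ) :
    ∃ (n N : ℕ) (s : Fin n → ℕ) (v : Fin n → M), IsEigenbasis p (L i) F^[r] N s v := by
  refine exists_isEigenbasis_of_span (hF.iterate r)
    (E := {v | v ∈ L i ∧ ∃ N, 0 < N ∧ v ∈ eigenvectors p k F^[r] N}) (fun v hv => hv.1)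
    (fun v hv => hv.2) fun m hm => ?_
  obtain ⟨N, hN, c, hc⟩ := exists_pow_smul_mem_span_eigenvectors hF hinj m
  refine ⟨c, ?_⟩
  have h1 := Submodule.mem_map_of_mem (f := e i) hc
  rw [map_smul, h.proj_self hm, Submodule.map_span] at h1
  refine Submodule.span_mono ?_ h1
  rintro _ ⟨v, ⟨s, hs⟩, rfl⟩
  refine ⟨h.proj_mem i v, N, hN, s * r, ?_⟩
  rw [← Function.iterate_mul, mul_comm, ← h.proj_iterate hF, hF.iterate_eigen hs, map_smul,
    h.proj_congr (i := i + N * r) (j := i) (by simp)]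

/-- The slopes of the summands of a cyclic grading. -/
theorem exists_slopes (h : IsCyclicGrading r F L e)
    (hF : IsSemilinear (WittVector.frobeniusEquiv p k) F) (hinj : ∀ x, F x = 0 → x = 0)
    (hcok : ∀ m, ∃ (n : ℕ) (m' : M), F m' = (p : WittVector p k) ^ n • m) :
    ∃ (d N : ℕ) (s : Fin d → ℕ), Module.finrank (WittVector p k) M = r * d ∧
      (∀ i, Module.finrank (WittVector p k) (L i) = d) ∧
      (∀ i, ∃ v, IsEigenbasis p (L i) F^[r] N s v) ∧
      (∀ i, newtonPolygon p (L i) F^[r] = Finset.univ.val.map fun j => (s j : ℚ) / N) ∧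
      rReduction r (newtonPolygon p (⊤ : Submodule (WittVector p k) M) F) =
        Finset.univ.val.map fun j => (s j : ℚ) / N := by
  obtain ⟨d, N, s, v, hv⟩ := h.exists_isEigenbasis hF hinj 0
  have hi := fun i => h.isEigenbasis_iterate hF hinj hcok hv i
  simp only [zero_add] at hi
  have htop := h.isEigenbasis_top hF hinj hcok hv
  refine ⟨d, N, s, ?_, fun i => ?_, fun i => ⟨_, hi i⟩,
    fun i => (hi i).newtonPolygon_eq (hF.iterate r), ?_⟩
  · rw [← finrank_top, htop.finrank_eq, Fintype.card_prod, Fintype.card_fin, Fintype.card_fin]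
  · rw [(hi i).finrank_eq, Fintype.card_fin]
  · have h1 : newtonPolygon p (⊤ : Submodule (WittVector p k) M) F =
        r • Finset.univ.val.map fun j => (s j : ℚ) / (r * N) := by
      rw [htop.newtonPolygon_eq hF, ← Finset.univ_product_univ, Finset.product_val,
        map_snd_product _ _ fun j => (s j : ℚ) / (r * N : ℕ), Finset.card_val, Finset.card_fin]
      push_cast
      rfl
    rw [h1, rReduction_nsmul h.pos, Multiset.map_map]
    refine Multiset.map_congr rfl fun j _ => ?_
    have := h.pos
    rw [Function.comp_apply]
    field_simp

end IsCyclicGrading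

end CyclicGrading

/-! ## Hodge polygons of a cyclic grading -/

/-- The restriction of `G` to a map `L → L'`. -/
def restrictTo {R M : Type*} [CommRing R] [AddCommGroup M] [Module R M] (G : M → M)
    (L L' : Submodule R M) (h : ∀ m ∈ L, G m ∈ L') : L → L' :=
  fun x => ⟨G x, h x x.2⟩

theorem IsSemilinear.restrictTo {R M : Type*} [CommRing R] [AddCommGroup M] [Module R M]
    {τ : R ≃+* R} {G : M → M} (hG : IsSemilinear τ G) {L L' : Submodule R M}
    (h : ∀ m ∈ L, G m ∈ L') : IsSemilinear τ (restrictTo G L L' h) :=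
  ⟨fun x y => Subtype.ext (hG.map_add x y), fun c x => Subtype.ext (hG.map_smul c x)⟩

section Smith

variable {p : ℕ} [hp : Fact p.Prime] {k : Type*} [Field k] [CharP k p] [IsAlgClosed k]
  {M : Type*} [AddCommGroup M] [Module (WittVector p k) M]
  {τ : WittVector p k ≃+* WittVector p k} {G : M → M} {L L' : Submodule (WittVector p k) M}

theorem mem_imageLattice (hG : IsSemilinear τ G) {x : M} :
    x ∈ imageLattice p L G ↔ ∃ m ∈ L, G m = x := by
  refine ⟨fun hx => ?_, fun ⟨m, hm, hx⟩ => Submodule.subset_span ⟨m, hm, hx⟩⟩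
  rw [imageLattice] at hx
  induction hx using Submodule.span_induction with
  | mem x hx => exact hx
  | zero => exact ⟨0, zero_mem _, hG.map_zero⟩
  | add x y _ _ hx hy =>
    obtain ⟨m, hm, rfl⟩ := hx
    obtain ⟨m', hm', rfl⟩ := hy
    exact ⟨m + m', add_mem hm hm', hG.map_add _ _⟩
  | smul c x _ hx =>
    obtain ⟨m, hm, rfl⟩ := hx
    exact ⟨τ.symm c • m, L.smul_mem _ hm, by rw [hG.map_smul, RingEquiv.apply_symm_apply]⟩

/-- The relative position provides a basis e of L' adapted to the lattice G(L). Since G is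
injective, the preimages of the p^a_j e_j form a basis of L. -/
theorem exists_hasSmithForm [Module.Free (WittVector p k) M] [Module.Finite (WittVector p k) M]
    (hG : IsSemilinear τ G) (hinj : ∀ x, G x = 0 → x = 0) (h : ∀ m ∈ L, G m ∈ L')
    (hcok : ∀ m ∈ L', ∃ n : ℕ, ∃ m' ∈ L, G m' = (p : WittVector p k) ^ n • m) {d : ℕ}
    (hd : Module.finrank (WittVector p k) L' = d) :
    ∃ a : Fin d → ℕ, relativePosition p L' (imageLattice p L G) = Finset.univ.val.map a ∧
      HasSmithForm (WittVector p k) p (restrictTo G L L' h) a := by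
  have hex : ∃ s, HasRelativePosition p L' (imageLattice p L G) s := by
    refine exists_hasRelativePosition p L' _ (Submodule.span_le.mpr ?_) fun m hm => ?_
    · rintro _ ⟨m, hm, rfl⟩
      exact h m hm
    · obtain ⟨n, m', hm', hn⟩ := hcok m hm
      exact ⟨n, (mem_imageLattice hG).mpr ⟨m', hm', hn⟩⟩
  have hrel : HasRelativePosition p L' (imageLattice p L G)
      (relativePosition p L' (imageLattice p L G)) := by
    rw [relativePosition, dif_pos hex]
    exact hex.choose_spec
  obtain ⟨n, e, a, hli, hspan, hspanN, hs⟩ := hrel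
  obtain rfl : n = d := by
    rw [← hd, ← hspan, finrank_span_eq_card hli, Fintype.card_fin]
  refine ⟨a, hs, ?_⟩
  have hf : ∀ j, ∃ m ∈ L, G m = (p : WittVector p k) ^ a j • e j := fun j => by
    rw [← mem_imageLattice hG, ← hspanN]
    exact Submodule.subset_span ⟨j, rfl⟩
  choose f hfL hf using hf
  have hfli : LinearIndependent (WittVector p k) f := by
    rw [Fintype.linearIndependent_iff]
    intro g hg j
    have h1 := congrArg G hg
    rw [hG.map_sum, hG.map_zero] at h1
    simp only [hG.map_smul, hf, smul_smul] at h1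
    have h2 := Fintype.linearIndependent_iff.mp hli _ h1 j
    have h3 := (mul_eq_zero.mp h2).resolve_right (pow_ne_zero _ (WittVector.p_nonzero p k))
    rwa [map_eq_zero_iff τ τ.injective] at h3
  have hfspan : ∀ m ∈ L, m ∈ Submodule.span (WittVector p k) (Set.range f) := by
    intro m hm
    have h1 : G m ∈ imageLattice p L G := Submodule.subset_span ⟨m, hm, rfl⟩
    rw [← hspanN, Submodule.mem_span_range_iff_exists_fun] at h1
    obtain ⟨c, hc⟩ := h1
    have h2 : G (m - ∑ j, τ.symm (c j) • f j) = 0 := by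
      rw [hG.map_sub, hG.map_sum, ← hc, sub_eq_zero]
      refine Finset.sum_congr rfl fun j _ => ?_
      rw [hG.map_smul, RingEquiv.apply_symm_apply, hf]
    rw [sub_eq_zero.mp (hinj _ h2)]
    exact Submodule.sum_mem _ fun j _ =>
      Submodule.smul_mem _ _ (Submodule.subset_span ⟨j, rfl⟩)
  have hbasis : ∀ {L : Submodule (WittVector p k) M} {f : Fin n → M}
      (hL : Submodule.span (WittVector p k) (Set.range f) = L),
      LinearIndependent (WittVector p k) f →
      ∃ b : Module.Basis (Fin n) (WittVector p k) L, ∀ j, (b j : M) = f j := by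
    rintro L f rfl hf
    exact ⟨Module.Basis.span hf, fun j => congrArg Subtype.val (Module.Basis.span_apply hf j)⟩
  obtain ⟨bf, hbf⟩ := hbasis (le_antisymm (Submodule.span_le.mpr (by
    rintro _ ⟨j, rfl⟩
    exact hfL j)) hfspan) hfli
  obtain ⟨be, hbe⟩ := hbasis hspan hli
  refine ⟨bf, be, fun j => Subtype.ext ?_⟩
  change G (bf j : M) = (p : WittVector p k) ^ a j • (be j : M)
  rw [hbf, hbe, hf]

theorem IsEigenbasis.restrictTo {ι : Type*} {N : ℕ} {s : ι → ℕ} {v : ι → M}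
    (hv : IsEigenbasis p L G N s v) (h : ∀ m ∈ L, G m ∈ L) :
    IsEigenbasis p (⊤ : Submodule (WittVector p k) L) (restrictTo G L L h) N s
      fun j => ⟨v j, hv.mem j⟩ := by
  refine ⟨hv.pos, fun _ => trivial, fun j => ?_, ?_, fun m _ => ?_⟩
  · have h1 : ∀ (n : ℕ) (x : L), (((FCrystals.restrictTo G L L h)^[n] x : L) : M) = G^[n] x := by
      intro n x
      induction n generalizing x with
      | zero => rfl
      | succ n ih => rw [Function.iterate_succ_apply, ih]; rfl
    exact Subtype.ext ((h1 N _).trans (hv.eigen j))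
  · exact LinearIndependent.of_comp L.subtype hv.linearIndependent
  · obtain ⟨c, hc⟩ := hv.saturates m m.2
    refine ⟨c, ?_⟩
    have h1 : Submodule.span (WittVector p k) (Set.range v) =
        (Submodule.span (WittVector p k) (Set.range fun j => (⟨v j, hv.mem j⟩ : L))).map
          L.subtype := by
      rw [Submodule.map_span, ← Set.range_comp]
      rfl
    rw [h1] at hc
    obtain ⟨x, hx, hxm⟩ := hc
    rwa [show (p : WittVector p k) ^ c • m = x from Subtype.ext hxm.symm]

end Smith

/-- The ordinate of a polygon with natural slopes is the minimum of the sums over subsets. -/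
theorem exists_nat_eq_polygonValue {d : ℕ} (a : Fin d → ℕ) {l : ℕ} (hl : l ≤ d) :
    ∃ A : ℕ, polygonValue ((Finset.univ.val.map a).map fun x : ℕ => (x : ℚ)) l = A ∧
      (∀ S : Finset (Fin d), S.card = l → A ≤ ∑ j ∈ S, a j) ∧
      ∃ S : Finset (Fin d), S.card = l ∧ ∑ j ∈ S, a j = A := by
  rw [Multiset.map_map]
  obtain ⟨S, hS, h⟩ := exists_sum_eq_polygonValue ((fun x : ℕ => (x : ℚ)) ∘ a) (l := l) (by simpa)
  refine ⟨∑ j ∈ S, a j, ?_, fun T hT => ?_, S, hS, rfl⟩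
  · rw [← h]
    simp
  · have := polygonValue_le_sum ((fun x : ℕ => (x : ℚ)) ∘ a) T
    rw [hT, ← h] at this
    simp only [Function.comp_apply] at this
    exact_mod_cast this

/-! ### Comparison of the Newton and Hodge polygons -/

section CyclicGrading

variable {p : ℕ} [hp : Fact p.Prime] {k : Type*} [Field k] [CharP k p] [IsAlgClosed k]
  {M : Type*} [AddCommGroup M] [Module (WittVector p k) M]
  {τ : WittVector p k ≃+* WittVector p k} {r : ℕ} {F : M → M}
  {L : ℕ → Submodule (WittVector p k) M} {e : ℕ → M →ₗ[WittVector p k] M}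

namespace IsCyclicGrading

theorem restrictTo_iterate_succ (h : IsCyclicGrading r F L e) (i q : ℕ) :
    restrictTo F^[q + 1] (L i) (L (i + q + 1)) (fun _ hm => h.iterate_mem hm (q + 1)) =
      restrictTo F (L (i + q)) (L (i + q + 1)) (h.map_mem (i + q)) ∘
        restrictTo F^[q] (L i) (L (i + q)) fun _ hm => h.iterate_mem hm q :=
  funext fun x => Subtype.ext (Function.iterate_succ_apply' F q x)

theorem formsDivisible_iterate (h : IsCyclicGrading r F L e) (hF : IsSemilinear τ F) {l : ℕ}
    {A : ℕ → ℕ} (hA : ∀ i, FormsDivisible (WittVector p k) p l (A i)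
      (restrictTo F (L i) (L (i + 1)) (h.map_mem i))) (i q : ℕ) :
    FormsDivisible (WittVector p k) p l (∑ t ∈ Finset.range q, A (i + t))
      (restrictTo F^[q] (L i) (L (i + q)) fun _ hm => h.iterate_mem hm q) := by
  induction q with
  | zero => intro ω x; simp
  | succ q ih =>
    have h1 := FormsDivisible.comp (WittVector.p_nonzero p k) (hF.restrictTo (h.map_mem (i + q)))
      (hA (i + q)) ih
    rw [← h.restrictTo_iterate_succ, ← Finset.sum_range_succ] at h1
    exact h1

theorem detScales_iterate (h : IsCyclicGrading r F L e) {d : ℕ}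
    (b : ∀ i, Module.Basis (Fin d) (WittVector p k) (L i)) {A : ℕ → ℕ}
    (hA : ∀ i, DetScales p d (A i) τ (restrictTo F (L i) (L (i + 1)) (h.map_mem i))) (i q : ℕ) :
    ∃ τ' : WittVector p k ≃+* WittVector p k, DetScales p d (∑ t ∈ Finset.range q, A (i + t)) τ'
      (restrictTo F^[q] (L i) (L (i + q)) fun _ hm => h.iterate_mem hm q) := by
  induction q with
  | zero => exact ⟨_, detScales_id⟩
  | succ q ih =>
    obtain ⟨τ', ih⟩ := ih
    have h1 := DetScales.comp (b (i + q)) (hA (i + q)) ih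
    rw [← h.restrictTo_iterate_succ, ← Finset.sum_range_succ] at h1
    exact ⟨_, h1⟩

variable [Module.Free (WittVector p k) M] [Module.Finite (WittVector p k) M]

/-- Each Newton ordinate is a sum over some index set S, to which Mazur's inequality applies with A
the Hodge ordinate; the determinant gives the end point. -/
theorem polygonLE_hodgePolygon (h : IsCyclicGrading r F L e) (hF : IsSemilinear τ F)
    (hinj : ∀ x, F x = 0 → x = 0)
    (hcok : ∀ m, ∃ (n : ℕ) (m' : M), F m' = (p : WittVector p k) ^ n • m) {d N i : ℕ}
    {s : Fin d → ℕ} {v : Fin d → M} (hv : IsEigenbasis p (L i) F^[r] N s v) :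
    PolygonLE (Finset.univ.val.map fun j => (s j : ℚ) / N) (hodgePolygon p (L i) F^[r]) := by
  have hmap : ∀ m ∈ L i, F^[r] m ∈ L i := fun m hm => h.period i ▸ h.iterate_mem hm r
  obtain ⟨b, hb, hsmith⟩ := exists_hasSmithForm (hF.iterate r) (iterate_eq_zero hinj r) hmap
    (fun m hm => h.coker_torsion hF hcok (h.period i ▸ hm)) (hv.finrank_eq.trans (Fintype.card_fin d))
  have hsemi := (hF.iterate r).restrictTo hmap
  have hvi := hv.restrictTo hmap
  have hP : Prime (p : WittVector p k) := WittVector.natCast_prime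
  have hN : (0 : ℚ) < N := by exact_mod_cast hv.pos
  rw [hodgePolygon, hb]
  refine ⟨by simp, fun l hl => ?_, ?_⟩
  · have hl' : l ≤ d := by simpa using hl
    obtain ⟨A, hA, hmin, -⟩ := exists_nat_eq_polygonValue b hl'
    obtain ⟨S, hS, hsum⟩ := exists_sum_eq_polygonValue (fun j => (s j : ℚ) / N) (l := l) (by simpa)
    rw [hA, ← hsum, ← Finset.sum_div, le_div_iff₀ hN, mul_comm]
    exact_mod_cast hvi.mul_le_sum hP hsemi (hsmith.formsDivisible hsemi hmin) S hS
  · have h1 := hvi.sum_eq hP hsmith.choose (hsmith.detScales hsemi)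
    rw [Multiset.map_map]
    change ∑ j, (s j : ℚ) / N = ∑ j, (b j : ℚ)
    rw [← Finset.sum_div, div_eq_iff hN.ne', mul_comm]
    exact_mod_cast h1

/-- Factor F^r into r steps through L_i, L_{i+1}, …: the divisibility of l-forms by the steps adds
up and bounds the elementary divisors of F^r from below. -/
theorem hodgePolygon_polygonLE (h : IsCyclicGrading r F L e) (hF : IsSemilinear τ F)
    (hinj : ∀ x, F x = 0 → x = 0)
    (hcok : ∀ m, ∃ (n : ℕ) (m' : M), F m' = (p : WittVector p k) ^ n • m) {d : ℕ}
    (hd : ∀ i, Module.finrank (WittVector p k) (L i) = d) (x : ℕ → ℕ → ℚ)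
    (hx : ∀ i j, x i j = (((relativePosition p (L (i + 1)) (imageLattice p (L i) F)).sort
      (· ≤ ·)).getD j 0 : ℕ)) (i : ℕ) :
    PolygonLE (hodgePolygon p (L i) F^[r]) (rReduction r (blockEntries r d (blockAverage r x))) := by
  have hP : Prime (p : WittVector p k) := WittVector.natCast_prime
  have hr : (r : ℚ) ≠ 0 := by exact_mod_cast h.pos.ne'
  have hmap : ∀ m ∈ L i, F^[r] m ∈ L i := fun m hm => h.period i ▸ h.iterate_mem hm r
  have hsemi := (hF.iterate r).restrictTo hmap
  obtain ⟨b, hb, hsmith⟩ := exists_hasSmithForm (hF.iterate r) (iterate_eq_zero hinj r) hmap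
    (fun m hm => h.coker_torsion hF hcok (h.period i ▸ hm)) (hd i)
  have hstep := fun i => exists_hasSmithForm hF hinj (h.map_mem i)
    (fun m hm => h.coker_torsion (q := 1) hF hcok hm) (hd (i + 1))
  choose a ha hsm using hstep
  have hperiod : ∀ i j, x (i + r) j = x i j := fun i j => by
    rw [hx, hx, add_right_comm, h.period, h.period]
  -- By periodicity all averaged blocks coincide. The r-reduction keeps one of them and cancels the
  -- factor 1/r.
  have hred : rReduction r (blockEntries r d (blockAverage r x)) =
      (Multiset.range d).map fun j => ∑ t ∈ Finset.range r, x t j := by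
    rw [blockEntries_of_forall_eq _ (fun j => 1 / (r : ℚ) * ∑ t ∈ Finset.range r, x t j),
      rReduction_nsmul h.pos, Multiset.map_map]
    · refine Multiset.map_congr rfl fun j _ => ?_
      rw [Function.comp_apply, ← mul_assoc, mul_one_div_cancel hr, one_mul]
    · intro i _ j _
      rw [blockAverage]
      simp only [blockShift_iterate]
      rw [sum_range_add_of_periodic (fun t => x t j) fun i => hperiod i j]
  -- For j < d the default value 0 of `getD` is never reached, so sortedness of each block carries
  -- over to the sum of the blocks.
  have hmono : ∀ t, ∀ i j, i ≤ j → j < d → x t i ≤ x t j := by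
    intro t i j hij hj
    rw [hx, hx, ha, Nat.cast_le]
    have hlen : ((Finset.univ.val.map (a t)).sort (· ≤ ·)).length = d := by simp
    rw [List.getD_eq_getElem _ _ (by omega), List.getD_eq_getElem _ _ (by omega)]
    exact (Multiset.pairwise_sort _ (· ≤ ·)).rel_get_of_le (a := ⟨i, by omega⟩) (b := ⟨j, by omega⟩)
      hij
  have hvalue : ∀ l ≤ d, polygonValue ((Multiset.range d).map
      fun j => ∑ t ∈ Finset.range r, x t j) l = ∑ t ∈ Finset.range r,
        polygonValue ((Finset.univ.val.map (a (i + t))).map fun x : ℕ => (x : ℚ)) l := by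
    intro l hl
    have h1 : ∀ t, polygonValue ((Finset.univ.val.map (a t)).map fun x : ℕ => (x : ℚ)) l =
        ∑ j ∈ Finset.range l, x t j := fun t => by
      rw [polygonValue_map_natCast _ _ (by simpa using hl), ← ha]
      exact Finset.sum_congr rfl fun j _ => (hx t j).symm
    rw [polygonValue_map_range _ (fun i j hij hj =>
      Finset.sum_le_sum fun t _ => hmono t i j hij hj) hl, Finset.sum_comm]
    simp only [h1]
    exact (sum_range_add_of_periodic (fun t => ∑ j ∈ Finset.range l, x t j)
      (fun i => Finset.sum_congr rfl fun j _ => hperiod i j) i).symm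
  have hpoly : ∀ l ≤ d, ∃ (A : ℕ → ℕ) (C : ℕ), polygonValue ((Multiset.range d).map
      fun j => ∑ t ∈ Finset.range r, x t j) l = (∑ t ∈ Finset.range r, A (i + t) : ℕ) ∧
      polygonValue ((Finset.univ.val.map b).map fun x : ℕ => (x : ℚ)) l = C ∧
      ∑ t ∈ Finset.range r, A (i + t) ≤ C := by
    intro l hl
    choose A hA hmin _ using fun t => exists_nat_eq_polygonValue (a t) hl
    obtain ⟨C, hC, -, S, hS, hSC⟩ := exists_nat_eq_polygonValue b hl
    refine ⟨A, C, ?_, hC, ?_⟩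
    · rw [hvalue l hl]
      push_cast
      exact Finset.sum_congr rfl fun t _ => hA _
    -- The target is a variable because the type of the restricted map depends on it, and L (i + r)
    -- = L i holds only propositionally.
    · have h1 : ∀ L', L (i + r) = L' → ∀ hm : ∀ m ∈ L i, F^[r] m ∈ L',
          FormsDivisible (WittVector p k) p l (∑ t ∈ Finset.range r, A (i + t))
            (restrictTo F^[r] (L i) L' hm) := by
        rintro _ rfl _
        exact h.formsDivisible_iterate hF
          (fun t => (hsm t).formsDivisible (hF.restrictTo _) (hmin t)) i r
      rw [← hSC]
      exact hsmith.le_of_formsDivisible hP (h1 _ (h.period i) hmap) S hS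
  rw [hodgePolygon, hb, hred]
  refine ⟨by simp, fun l hl => ?_, ?_⟩
  · obtain ⟨A, C, h1, h2, h3⟩ := hpoly l (by simpa using hl)
    rw [h1, h2]
    exact_mod_cast h3
  · have h1 : ∀ L', L (i + r) = L' → ∀ hm : ∀ m ∈ L i, F^[r] m ∈ L',
        ∃ τ' : WittVector p k ≃+* WittVector p k, DetScales p d (∑ t ∈ Finset.range r, ∑ j, a (i + t) j) τ'
          (restrictTo F^[r] (L i) L' hm) := by
      rintro _ rfl _
      exact h.detScales_iterate (fun i => (hsm i).choose) (A := fun t => ∑ j, a t j)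
        (fun t => (hsm t).detScales (hF.restrictTo _)) i r
    obtain ⟨τ', hτ'⟩ := h1 _ (h.period i) hmap
    have h2 := DetScales.unique hP hsmith.choose hsmith.choose (hsmith.detScales hsemi) hτ'
    have h3 := polygonValue_card ((Multiset.range d).map fun j => ∑ t ∈ Finset.range r, x t j)
    rw [Multiset.card_map, Multiset.card_range, hvalue d le_rfl] at h3
    rw [← h3, Multiset.map_map]
    change ∑ j, (b j : ℚ) = _
    rw [← Nat.cast_sum, h2, Nat.cast_sum]
    refine Finset.sum_congr rfl fun t _ => ?_
    have h4 := polygonValue_card ((Finset.univ.val.map (a (i + t))).map fun x : ℕ => (x : ℚ))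
    rw [Multiset.card_map, Multiset.card_map, Finset.card_val, Finset.card_fin] at h4
    rw [h4, Multiset.map_map, Nat.cast_sum]
    rfl

end IsCyclicGrading

end CyclicGrading

end FCrystals

theorem mainTheorem6 (p : ℕ) [Fact p.Prime]
    {k : Type*} [Field k] [CharP k p] [IsAlgClosed k]
    {B : Type*} [Field B] [Algebra ℚ_[p] B] [FiniteDimensional ℚ_[p] B]
    [Algebra ℤ_[p] B] [IsScalarTower ℤ_[p] ℚ_[p] B]
    [Algebra.FormallyUnramified ℤ_[p] (integralClosure ℤ_[p] B)]
    {M : Type*} [AddCommGroup M] [Module (WittVector p k) M]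
    [Module.Free (WittVector p k) M] [Module.Finite (WittVector p k) M]
    (X : FCrystals.FCrystal p k (integralClosure ℤ_[p] B) M)
    (r : ℕ) (hr : r = Module.finrank ℚ_[p] B)
    (τ : integralClosure ℤ_[p] B →+* WittVector p k) (i : ℕ) :
    X.newtonIsotypic τ r i = FCrystals.rReduction r X.newton ∧
    FCrystals.PolygonLE (FCrystals.rReduction r X.newton) (X.hodgeIsotypic τ r i) ∧
    FCrystals.PolygonLE (X.hodgeIsotypic τ r i)
      (FCrystals.rReduction r (X.sigmaInvariantHodge τ r)) := by
  obtain ⟨e, h⟩ := X.isCyclicGrading τ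
  rw [← hr] at h
  obtain ⟨d, N, s, hM, hd, hv, hnewton, hred⟩ :=
    h.exists_slopes X.isSemilinear X.injective X.coker_torsion
  obtain ⟨v, hv⟩ := hv i
  rw [FCrystals.FCrystal.newton, hred]
  refine ⟨hnewton i, h.polygonLE_hodgePolygon X.isSemilinear X.injective X.coker_torsion hv, ?_⟩
  rw [FCrystals.FCrystal.sigmaInvariantHodge, hM, Nat.mul_div_cancel_left _ h.pos]
  exact h.hodgePolygon_polygonLE X.isSemilinear X.injective X.coker_torsion hd _
    (fun _ _ => rfl) i
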